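/- Assume the generalized Riemann hypothesis: for every Dirichlet character $\chi$, all zeros of $L(s,\chi)$ in the strip $0<\operatorname{Re}s<1$ satisfy $\operatorname{Re}s=\tfrac12$. For a primitive Dirichlet character $\chi$ mod $q>1$ and real $t$ that is not the imaginary part of a zero of $L(s,\chi)$ in the strip $0<\operatorname{Re}s<1$, put $$S(t,\chi)=\frac1\pi\arg L\left(\tfrac12+it,\chi\right),$$ where the argument is given by continuous variation along the half-line $s=\sigma+it$ as $\sigma$ decreases from $+\infty$ to $\tfrac12$, starting with the value $0$; if $t$ is the imaginary part of such a zero, put $S(t,\chi)=\tfrac12\{S(t+0,\chi)+S(t-0,\chi)\}$. Then $S(t,\chi)$ is well defined (the argument, respectively the two one-sided limits, exist), and there is an absolute constant $C>0$ such that for every $q>1$, every primitive Dirichlet character $\chi$ mod $q$ and every real $t\ge 0$, $$|S(t,\chi)|<0.804\cdot\frac{\log (q(t+1))}{\log\log (q(t+3))}+C\,\frac{\log (q(t+3))}{(\log\log (q(t+3)))^2}.$$ -/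

import Mathlib

open Filter Topology

noncomputable section

/-- The generalized Riemann hypothesis for Dirichlet `L`-functions: every zero of every `L(s, χ)` in
the open critical strip lies on the critical line. -/
def GRH : Prop :=
  ∀ (q : ℕ) [NeZero q] (χ : DirichletCharacter ℂ q) (s : ℂ),
    0 < s.re → s.re < 1 → DirichletCharacter.LFunction χ s = 0 → s.re = 1 / 2

/-- `t` is the imaginary part `γ(χ)` of a non-trivial zero of `L(s, χ)`. -/
def IsOrdinate {q : ℕ} [NeZero q] (χ : DirichletCharacter ℂ q) (t : ℝ) : Prop :=
  ∃ β : ℝ, 0 < β ∧ β < 1 ∧ DirichletCharacter.LFunction χ (⟨β, t⟩ : ℂ) = 0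

/-- `θ` is the argument of `L(1/2 + it, χ)` obtained by continuous variation along the half-line
`σ + it`, as `σ` decreases from `+∞` to `1/2`, starting with the value zero: `φ σ` is the argument
of `L(σ + it, χ)`. -/
def IsArgL {q : ℕ} [NeZero q] (χ : DirichletCharacter ℂ q) (t θ : ℝ) : Prop :=
  ∃ φ : ℝ → ℝ, ContinuousOn φ (Set.Ici (1 / 2)) ∧ Tendsto φ atTop (𝓝 0) ∧
    (∀ σ : ℝ, 1 / 2 ≤ σ →
      DirichletCharacter.LFunction χ (⟨σ, t⟩ : ℂ) =
        (‖DirichletCharacter.LFunction χ (⟨σ, t⟩ : ℂ)‖ : ℂ) * Complex.exp ((φ σ : ℂ) * Complex.I)) ∧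
    φ (1 / 2) = θ

open Classical in
/-- `arg L(1/2 + it, χ)` by continuous variation, for `t` that is not an ordinate
(a default value is used where no such argument exists). -/
def argL {q : ℕ} [NeZero q] (χ : DirichletCharacter ℂ q) (t : ℝ) : ℝ :=
  if h : ∃ θ : ℝ, IsArgL χ t θ then h.choose else 0

open Classical in
/-- `S(t, χ) = (1/π) arg L(1/2 + it, χ)` if `t` is not the ordinate of a non-trivial zero, and
`S(t, χ) = (S(t + 0, χ) + S(t - 0, χ)) / 2` if it is. -/
def argS {q : ℕ} [NeZero q] (t : ℝ) (χ : DirichletCharacter ℂ q) : ℝ :=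
  if IsOrdinate χ t then
    1 / 2 * (limUnder (𝓝[>] t) (fun u => 1 / Real.pi * argL χ u) +
      limUnder (𝓝[<] t) (fun u => 1 / Real.pi * argL χ u))
  else 1 / Real.pi * argL χ t

/-- No default value enters `S(t, χ)`: the argument by continuous variation exists if `t` is not an
ordinate, and the two one-sided limits exist if it is. -/
def ArgSWellDefined {q : ℕ} [NeZero q] (t : ℝ) (χ : DirichletCharacter ℂ q) : Prop :=
  (¬ IsOrdinate χ t → IsArgL χ t (Real.pi * argS t χ)) ∧
  (IsOrdinate χ t → ∃ a b : ℝ,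
    Tendsto (fun u => argS u χ) (𝓝[>] t) (𝓝 a) ∧
    Tendsto (fun u => argS u χ) (𝓝[<] t) (𝓝 b) ∧
    argS t χ = 1 / 2 * (a + b))

end

/-! Write Q = q(|t| + 3) and M = log log Q, so that log Q = e^M. Under GRH, log L(s, χ) has a
holomorphic branch ℓ on Re s > 1/2, and the argument in question is the boundary value of Im ℓ. The
task is to bound Im ℓ uniformly close to the critical line.

The main input is a positivity statement, `re_logDerivXi_nonneg`: the completed function ξ, that is
L times its archimedean factor, satisfies Re ξ'/ξ ≥ 0 to the right of the critical line. No product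
over zeros is used. The quotient ξ(s - δ)/ξ(s + δ) has modulus at most 1 on the critical line by the
functional equation, and Phragmén–Lindelöf extends the bound to the right. The archimedean factor
has logarithmic derivative with real part (log Q)/2 + O(1). So log |L| cannot fall faster than about
(log Q)/2 per unit of σ, and by Cauchy–Riemann arg L cannot fall faster than that per unit of t.
Moreover x · Re ξ'/ξ(1/2 + x + it) is nondecreasing in x (Schwarz–Pick), which limits the effect of
zeros close by.

The second ingredient is a bound of about 0.25 e^M/M for ℓ at distance 2/M from the line, decaying
like exp(-1.99 M x) further right (`norm_le_decay`). It is self-improving. A bound K on Re s ≥ 1/2 +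
2/M passes to the line Re s = 1/2 + 1/(2M) by positivity and Borel–Carathéodory. A localized three
lines theorem carries it back with a gain, so that K ≤ 0.36 K + 0.156/M.

Finally, Cauchy's theorem on a rectangle expresses the integral of arg L over a short vertical
segment through two horizontal integrals of log |L|, which the first two ingredients bound. As arg L
cannot drop quickly, a large value at t would force a large mean over a one-sided interval. With
intervals of length 5/M this gives |arg L| ≤ 2.45 e^M/M (`abs_im_le`), and 2.45/π < 0.804. Bounded M
is left to a crude estimate absorbed by C. That S is well defined follows from the local form ℓ = m
log(s - ρ) + continuous at each point ρ of the critical line. -/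

/-! ### Complex analysis on half-planes and discs -/

/-- A holomorphic function on a right half-plane has a primitive. -/
theorem exists_primitive_on_halfPlane {c : ℝ} {f : ℂ → ℂ}
    (hf : DifferentiableOn ℂ f {s : ℂ | c < s.re}) :
    ∃ g : ℂ → ℂ, ∀ s : ℂ, c < s.re → HasDerivAt g (f s) s := by
  -- The Cayley map carries the unit disc to the half-plane. A primitive of the pulled-back f(φ(w))
  -- φ'(w) on the disc, composed with the inverse map, is a primitive of f.
  set φ : ℂ → ℂ := fun w => c + (1 + w) / (1 - w) with hφ
  have hne : ∀ w ∈ Metric.ball (0 : ℂ) 1, (1 : ℂ) - w ≠ 0 := by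
    intro w hw h
    have : w = 1 := by linear_combination -h
    simp [this] at hw
  have hre : ∀ w ∈ Metric.ball (0 : ℂ) 1, c < (φ w).re := by
    intro w hw
    have hw' : ‖w‖ < 1 := by simpa using hw
    have h1 : Complex.normSq w < 1 := by
      rw [Complex.normSq_eq_norm_sq]; nlinarith [norm_nonneg w]
    have h2 : 0 < Complex.normSq (1 - w) := Complex.normSq_pos.2 (hne w hw)
    have : ((1 + w) / (1 - w)).re = (1 - Complex.normSq w) / Complex.normSq (1 - w) := by
      rw [Complex.div_re]
      simp [Complex.normSq_apply]
      ring
    simp only [hφ, Complex.add_re, Complex.ofReal_re, this]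
    have := div_pos (sub_pos.2 h1) h2
    linarith
  have hφd : ∀ w ∈ Metric.ball (0 : ℂ) 1, HasDerivAt φ (2 / (1 - w) ^ 2) w := by
    intro w hw
    have := (((hasDerivAt_id w).const_add 1).div ((hasDerivAt_id w).const_sub 1) (hne w hw)).const_add
      (c : ℂ)
    refine this.congr_deriv ?_
    simp only [id]
    congr 1
    ring
  have hF : DifferentiableOn ℂ (fun w => f (φ w) * (2 / (1 - w) ^ 2)) (Metric.ball 0 1) := by
    refine DifferentiableOn.mul ?_ ?_
    · exact hf.comp (fun w hw => (hφd w hw).differentiableAt.differentiableWithinAt)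
        (fun w hw => hre w hw)
    · intro w hw
      have := hne w hw
      apply DifferentiableAt.differentiableWithinAt
      fun_prop (disch := exact pow_ne_zero 2 this)
  obtain ⟨G, hG⟩ := hF.isExactOn_ball
  refine ⟨fun s => G ((s - c - 1) / (s - c + 1)), fun s hs => ?_⟩
  have hz : s - c + 1 ≠ 0 := by
    intro h
    have := congrArg Complex.re h
    simp at this
    linarith
  have hw : (s - c - 1) / (s - c + 1) ∈ Metric.ball (0 : ℂ) 1 := by
    rw [mem_ball_zero_iff, norm_div, div_lt_one (norm_pos_iff.2 hz)]
    rw [← sq_lt_sq₀ (norm_nonneg _) (norm_nonneg _), ← Complex.normSq_eq_norm_sq,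
      ← Complex.normSq_eq_norm_sq, Complex.normSq_apply, Complex.normSq_apply]
    simp
    nlinarith
  have hψ : HasDerivAt (fun s : ℂ => (s - c - 1) / (s - c + 1)) (2 / (s - c + 1) ^ 2) s := by
    have := ((((hasDerivAt_id s).sub_const (c : ℂ)).sub_const 1)).div
      (((hasDerivAt_id s).sub_const (c : ℂ)).add_const 1) hz
    refine this.congr_deriv ?_
    simp only [id]
    congr 1
    ring
  have h1 : (1 : ℂ) - (s - c - 1) / (s - c + 1) = 2 / (s - c + 1) := by field_simp; ring
  have h2 : φ ((s - c - 1) / (s - c + 1)) = s := by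
    simp only [hφ, h1]; field_simp; ring
  have := (hG _ hw).comp s hψ
  refine this.congr_deriv ?_
  simp only [h2, h1]
  field_simp

/-- **Schwarz–Pick** on a right half-plane for functions with nonnegative real part. -/
theorem norm_deriv_le_re_div_of_re_nonneg {c : ℝ} {f : ℂ → ℂ}
    (hf : DifferentiableOn ℂ f {s : ℂ | c < s.re}) (hre : ∀ s : ℂ, c < s.re → 0 ≤ (f s).re)
    {s : ℂ} (hs : c < s.re) : ‖deriv f s‖ ≤ (f s).re / (s.re - c) := by
  have hx : 0 < s.re - c := sub_pos.2 hs
  have hopen : IsOpen {s : ℂ | c < s.re} := isOpen_lt continuous_const Complex.continuous_re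
  refine le_of_forall_pos_le_add fun ε hε => ?_
  -- Adding η makes the real part strictly positive, so the Cayley quotient below has no pole; after
  -- division by the distance to the boundary it costs exactly ε.
  set η := ε * (s.re - c) with hη
  have hη0 : 0 < η := mul_pos hε hx
  set x : ℝ := s.re - c
  set p : ℂ → ℂ := fun z => f z + η with hp
  have hpre : ∀ z : ℂ, c < z.re → 0 < (p z).re := fun z hz => by
    simp only [hp, Complex.add_re, Complex.ofReal_re]; linarith [hre z hz]
  set φ : ℂ → ℂ := fun w => (s - x) + x * ((1 + w) / (1 - w)) with hφ
  have hne : ∀ w ∈ Metric.ball (0 : ℂ) 1, (1 : ℂ) - w ≠ 0 := by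
    intro w hw h
    have : w = 1 := by linear_combination -h
    simp [this] at hw
  have hφre : ∀ w ∈ Metric.ball (0 : ℂ) 1, c < (φ w).re := by
    intro w hw
    have hw' : ‖w‖ < 1 := by simpa using hw
    have h1 : Complex.normSq w < 1 := by
      rw [Complex.normSq_eq_norm_sq]; nlinarith [norm_nonneg w]
    have h2 : 0 < Complex.normSq (1 - w) := Complex.normSq_pos.2 (hne w hw)
    have h3 : ((1 + w) / (1 - w)).re = (1 - Complex.normSq w) / Complex.normSq (1 - w) := by
      rw [Complex.div_re]
      simp [Complex.normSq_apply]
      ring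
    have := mul_pos hx (div_pos (sub_pos.2 h1) h2)
    simp only [hφ, Complex.add_re, Complex.sub_re, Complex.ofReal_re, Complex.re_ofReal_mul, h3]
    simp only [x] at this ⊢
    linarith
  have hφd : ∀ w ∈ Metric.ball (0 : ℂ) 1, HasDerivAt φ (x * (2 / (1 - w) ^ 2)) w := by
    intro w hw
    have := ((((hasDerivAt_id w).const_add 1).div ((hasDerivAt_id w).const_sub 1)
      (hne w hw)).const_mul (x : ℂ)).const_add (s - x)
    refine this.congr_deriv ?_
    simp only [id]
    congr 2
    ring
  have hφ0 : φ 0 = s := by simp [hφ]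
  have h0 : (0 : ℂ) ∈ Metric.ball (0 : ℂ) 1 := by simp
  set p0 := p s with hp0
  have hp0re : 0 < p0.re := hpre s hs
  have hden : ∀ z : ℂ, c < z.re → p z + (starRingEnd ℂ) p0 ≠ 0 := by
    intro z hz h
    have := congrArg Complex.re h
    simp at this
    linarith [hpre z hz]
  have hpd : ∀ z : ℂ, c < z.re → DifferentiableAt ℂ p z := fun z hz =>
    (hf.differentiableAt (hopen.mem_nhds hz)).add_const _
  -- A self-map of the disc fixing 0. Schwarz's lemma at 0, where φ' = 2x, is the inequality sought.
  set h : ℂ → ℂ := fun w => (p (φ w) - p0) / (p (φ w) + (starRingEnd ℂ) p0) with hh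
  have hcomp : ∀ w ∈ Metric.ball (0 : ℂ) 1, HasDerivAt (fun w => p (φ w))
      (deriv p (φ w) * (x * (2 / (1 - w) ^ 2))) w := fun w hw =>
    (hpd _ (hφre w hw)).hasDerivAt.comp w (hφd w hw)
  have hhd : DifferentiableOn ℂ h (Metric.ball 0 1) := by
    intro w hw
    have h1 := (hcomp w hw).differentiableAt
    exact ((h1.sub_const p0).div (h1.add_const _) (hden _ (hφre w hw))).differentiableWithinAt
  have hh0 : h 0 = 0 := by simp [hh, hφ0, hp0]
  have hmaps : Set.MapsTo h (Metric.ball 0 1) (Metric.closedBall (h 0) 1) := by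
    intro w hw
    rw [hh0, mem_closedBall_zero_iff, hh]
    have hd := hden _ (hφre w hw)
    simp only
    rw [norm_div, div_le_one (norm_pos_iff.2 hd), ← sq_le_sq₀ (norm_nonneg _) (norm_nonneg _),
      ← Complex.normSq_eq_norm_sq, ← Complex.normSq_eq_norm_sq, Complex.normSq_apply,
      Complex.normSq_apply]
    simp
    nlinarith [hpre _ (hφre w hw)]
  have hder := Complex.norm_deriv_le_div_of_mapsTo_ball hhd hmaps one_pos
  have h1 : HasDerivAt (fun w => p (φ w)) (deriv p s * (x * 2)) 0 := by
    have := hcomp 0 h0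
    simpa [hφ0] using this
  have h2 := ((h1.sub_const p0).div (h1.add_const ((starRingEnd ℂ) p0))
    (hden _ (hφre 0 h0)))
  have h3 : deriv h 0 = deriv p s * (x / p0.re) := by
    have e : p0 + (starRingEnd ℂ) p0 = 2 * p0.re := by
      rw [Complex.add_conj]; push_cast; ring
    have hp0' : (p0.re : ℂ) ≠ 0 := by exact_mod_cast hp0re.ne'
    rw [show deriv h 0 = _ from h2.deriv]
    simp only [hφ0, ← hp0, sub_self, e]
    field_simp
    ring
  have h4 : deriv p s = deriv f s := by simp [hp]
  rw [h3, h4, norm_mul, norm_div, Complex.norm_real, Complex.norm_real, Real.norm_of_nonneg hx.le,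
    Real.norm_of_nonneg hp0re.le, div_one] at hder
  have h5 : ‖deriv f s‖ ≤ p0.re / x := by
    rw [le_div_iff₀ hx]
    calc ‖deriv f s‖ * x = (‖deriv f s‖ * (x / p0.re)) * p0.re := by field_simp
      _ ≤ 1 * p0.re := by gcongr
      _ = p0.re := one_mul _
  refine h5.trans_eq ?_
  simp only [hp0, hp, Complex.add_re, Complex.ofReal_re]
  rw [add_div, hη]
  congr 1
  field_simp

/-- The derivative of a holomorphic function along a horizontal line. -/
theorem hasDerivAt_horizontal {f : ℂ → ℂ} {f' : ℂ} {σ t : ℝ} (h : HasDerivAt f f' ⟨σ, t⟩) :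
    HasDerivAt (fun x : ℝ => f ⟨x, t⟩) f' σ := by
  have h2 : HasDerivAt (fun x : ℝ => (⟨x, t⟩ : ℂ)) 1 σ := by
    have := ((hasDerivAt_id σ).ofReal_comp.const_add (t * Complex.I))
    refine (this.congr_of_eventuallyEq (Eventually.of_forall fun b => ?_)).congr_deriv (by simp)
    apply Complex.ext <;> simp
  exact (h.comp_of_eq σ h2 rfl).congr_deriv (mul_one _)

/-- The derivative of a holomorphic function along a vertical line. -/
theorem hasDerivAt_vertical {f : ℂ → ℂ} {f' : ℂ} {σ t : ℝ} (h : HasDerivAt f f' ⟨σ, t⟩) :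
    HasDerivAt (fun y : ℝ => f ⟨σ, y⟩) (f' * Complex.I) t := by
  have h2 : HasDerivAt (fun y : ℝ => (⟨σ, y⟩ : ℂ)) Complex.I t := by
    have := ((hasDerivAt_id t).ofReal_comp.mul_const Complex.I).const_add (σ : ℂ)
    refine (this.congr_of_eventuallyEq (Eventually.of_forall fun b => ?_)).congr_deriv (by simp)
    apply Complex.ext <;> simp
  exact h.comp_of_eq t h2 rfl

theorem hasDerivAt_re_of_hasDerivAt {g : ℝ → ℂ} {g' : ℂ} {x : ℝ} (h : HasDerivAt g g' x) :
    HasDerivAt (fun x => (g x).re) g'.re x :=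
  (Complex.reCLM.hasFDerivAt (x := g x)).comp_hasDerivAt x h

theorem hasDerivAt_im_of_hasDerivAt {g : ℝ → ℂ} {g' : ℂ} {x : ℝ} (h : HasDerivAt g g' x) :
    HasDerivAt (fun x => (g x).im) g'.im x :=
  (Complex.imCLM.hasFDerivAt (x := g x)).comp_hasDerivAt x h

theorem hasDerivAt_re_horizontal {f : ℂ → ℂ} {f' : ℂ} {σ t : ℝ} (h : HasDerivAt f f' ⟨σ, t⟩) :
    HasDerivAt (fun x : ℝ => (f ⟨x, t⟩).re) f'.re σ :=
  hasDerivAt_re_of_hasDerivAt (hasDerivAt_horizontal h)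

/-- A positive harmonic function on a right half-plane, multiplied by the distance to the boundary,
increases along horizontal lines. -/
theorem monotoneOn_mul_re_of_re_nonneg {c : ℝ} {f : ℂ → ℂ}
    (hf : DifferentiableOn ℂ f {s : ℂ | c < s.re}) (hre : ∀ s : ℂ, c < s.re → 0 ≤ (f s).re)
    (t : ℝ) : MonotoneOn (fun a : ℝ => a * (f ⟨c + a, t⟩).re) (Set.Ioi 0) := by
  have hopen : IsOpen {s : ℂ | c < s.re} := isOpen_lt continuous_const Complex.continuous_re
  have hd : ∀ a : ℝ, 0 < a → HasDerivAt (fun a : ℝ => a * (f ⟨c + a, t⟩).re)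
      (1 * (f ⟨c + a, t⟩).re + a * (deriv f ⟨c + a, t⟩).re) a := by
    intro a ha
    have h1 : DifferentiableAt ℂ f ⟨c + a, t⟩ :=
      hf.differentiableAt (hopen.mem_nhds (by simpa using ha))
    have h4 := (hasDerivAt_re_horizontal h1.hasDerivAt).comp_const_add c a
    exact (hasDerivAt_id a).mul h4
  refine monotoneOn_of_deriv_nonneg (convex_Ioi 0) (fun a ha => (hd a ha).continuousAt.continuousWithinAt)
    (fun a ha => ?_) (fun a ha => ?_)
  · rw [interior_Ioi] at ha; exact (hd a ha).differentiableAt.differentiableWithinAt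
  · rw [interior_Ioi] at ha
    have ha : 0 < a := ha
    rw [(hd a ha).deriv]
    have hs : c < (⟨c + a, t⟩ : ℂ).re := by simpa using ha
    have h1 := norm_deriv_le_re_div_of_re_nonneg hf hre hs
    have h2 := (abs_le.1 ((Complex.abs_re_le_norm _).trans h1)).1
    simp only [add_sub_cancel_left] at h2
    rw [← neg_div, div_le_iff₀ ha] at h2
    linarith

/-- **Borel–Carathéodory** between two points of a diameter, none of which has to be the centre. -/
theorem norm_sub_le_of_re_le_on_ball {f : ℂ → ℂ} {c : ℂ} {R a b A : ℝ}
    (hf : DifferentiableOn ℂ f (Metric.ball c R)) (hA : ∀ s ∈ Metric.ball c R, (f s).re ≤ A)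
    (hb : 0 < b) (hab : b < a) (haR : a ≤ R) (hlt : (f (c - R + a)).re < A) :
    ‖f (c - R + b) - f (c - R + a)‖ ≤
      2 * (A - (f (c - R + a)).re) * ((a - b) * R / (b * (2 * R - a))) := by
  have hR : 0 < R := by linarith
  -- A disc automorphism moves the base point, at distance a from the left end of the diameter, to
  -- the origin. The target point then becomes -w0, and the classical Borel–Carathéodory factor is
  -- w0 / (1 - w0).
  set α : ℝ := (R - a) / R with hα
  have hα0 : 0 ≤ α := div_nonneg (by linarith) hR.le
  have hα1 : α < 1 := by rw [hα, div_lt_one hR]; linarith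
  set φ : ℂ → ℂ := fun w => c + R * ((w - α) / (1 - α * w)) with hφ
  have hne : ∀ w ∈ Metric.ball (0 : ℂ) 1, (1 : ℂ) - α * w ≠ 0 := by
    intro w hw h
    have hw' : ‖w‖ < 1 := by simpa using hw
    have h1 : (α : ℂ) * w = 1 := by linear_combination -h
    have h2 := congrArg norm h1
    rw [norm_mul, Complex.norm_real, Real.norm_of_nonneg hα0, norm_one] at h2
    nlinarith [norm_nonneg w]
  have hmaps : ∀ w ∈ Metric.ball (0 : ℂ) 1, φ w ∈ Metric.ball c R := by
    intro w hw
    have hw' : ‖w‖ < 1 := by simpa using hw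
    have h1 : Complex.normSq w < 1 := by
      rw [Complex.normSq_eq_norm_sq]; nlinarith [norm_nonneg w]
    rw [mem_ball_iff_norm, hφ]
    simp only [add_sub_cancel_left]
    rw [norm_mul, Complex.norm_real, Real.norm_of_nonneg hR.le, norm_div]
    have : ‖w - α‖ / ‖1 - α * w‖ < 1 := by
      rw [div_lt_one (norm_pos_iff.2 (hne w hw)), ← sq_lt_sq₀ (norm_nonneg _) (norm_nonneg _),
        ← Complex.normSq_eq_norm_sq, ← Complex.normSq_eq_norm_sq]
      rw [Complex.normSq_apply] at h1 ⊢
      rw [Complex.normSq_apply]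
      simp
      have : 0 < (1 - α ^ 2) * (1 - (w.re * w.re + w.im * w.im)) :=
        mul_pos (by nlinarith) (by linarith)
      nlinarith
    nlinarith
  have hφd : ∀ w ∈ Metric.ball (0 : ℂ) 1, DifferentiableAt ℂ φ w := by
    intro w hw
    have := hne w hw
    fun_prop (disch := assumption)
  have hφ0 : φ 0 = c - R + a := by
    have : (R : ℂ) ≠ 0 := by exact_mod_cast hR.ne'
    have e : (R : ℂ) * α = R - a := by rw [hα]; push_cast; field_simp
    simp only [hφ, mul_zero, sub_zero, zero_sub, div_one]
    linear_combination -e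
  set A' := A - (f (c - R + a)).re
  have hA' : 0 < A' := sub_pos.2 hlt
  set β : ℝ := (R - b) / R with hβ
  have hβα : 0 < 1 - α * β := by
    have : β ≤ 1 := by rw [hβ, div_le_one hR]; linarith
    nlinarith
  set w0 : ℝ := (β - α) / (1 - α * β) with hw0
  have e1 : β - α = (a - b) / R := by rw [hα, hβ]; field_simp; ring
  have hw0nn : 0 ≤ w0 := div_nonneg (by rw [e1]; exact div_nonneg (by linarith) hR.le) hβα.le
  have e2 : 1 - w0 = (b / R) * ((2 * R - a) / R) / (1 - α * β) := by
    rw [hw0, eq_div_iff hβα.ne', sub_mul, div_mul_cancel₀ _ hβα.ne', hα, hβ]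
    field_simp
    ring
  have e2' : 0 < 1 - w0 := by
    rw [e2]
    exact div_pos (mul_pos (div_pos hb hR) (div_pos (by linarith) hR)) hβα
  have hφw : φ (-(w0 : ℂ)) = c - R + b := by
    have h1 : (R : ℂ) ≠ 0 := by exact_mod_cast hR.ne'
    have h2 : (1 : ℂ) - α * β ≠ 0 := by exact_mod_cast hβα.ne'
    have h4 : (1 : ℝ) - α ^ 2 ≠ 0 := by nlinarith
    have h4' : (1 : ℂ) - α ^ 2 ≠ 0 := by exact_mod_cast h4
    have e0 : (w0 : ℂ) * (1 - α * β) = β - α := by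
      rw [hw0]; push_cast; exact div_mul_cancel₀ _ h2
    have e3 : (-(w0 : ℂ) - α) = -(β * (1 - α ^ 2)) / (1 - α * β) := by
      rw [eq_div_iff h2]; linear_combination -e0
    have e4 : (1 : ℂ) - α * (-(w0 : ℂ)) = (1 - α ^ 2) / (1 - α * β) := by
      rw [eq_div_iff h2]; linear_combination α * e0
    have e5 : (-(w0 : ℂ) - α) / (1 - α * (-(w0 : ℂ))) = -β := by
      rw [e3, e4, div_div_div_cancel_right₀ h2]; field_simp
    simp only [hφ]
    rw [e5, hβ]
    push_cast
    field_simp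
    ring
  have hmem : -(w0 : ℂ) ∈ Metric.ball (0 : ℂ) 1 := by
    rw [mem_ball_zero_iff, norm_neg, Complex.norm_real, Real.norm_of_nonneg hw0nn]; linarith
  have key := Complex.borelCaratheodory_zero (f := fun w => f (φ w) - f (φ 0)) (M := A') (R := 1)
    (z := -(w0 : ℂ)) hA'
    ((hf.comp (fun w hw => (hφd w hw).differentiableWithinAt) hmaps).sub_const _)
    (fun w hw => by
      have := hA _ (hmaps w hw)
      simp only [Set.mem_ofPred_eq, Complex.sub_re, hφ0, A']
      linarith) one_pos hmem (by simp)
  rw [hφw, hφ0, norm_neg, Complex.norm_real, Real.norm_of_nonneg hw0nn] at key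
  refine key.trans_eq ?_
  rw [mul_div_assoc]
  congr 1
  rw [e2, hw0, e1]
  have : 2 * R - a ≠ 0 := by linarith
  field_simp

/-! ### Dirichlet L-functions: partial summation and conjugation -/

theorem ZMod.sum_range_natCast {q : ℕ} [NeZero q] (g : ZMod q → ℂ) :
    ∑ i ∈ Finset.range q, g i = ∑ x : ZMod q, g x := by
  refine Finset.sum_bij' (fun i _ => (i : ZMod q)) (fun x _ => x.val) (fun _ _ => Finset.mem_univ _)
    (fun x _ => Finset.mem_range.2 x.val_lt) (fun i hi => ZMod.val_cast_of_lt (Finset.mem_range.1 hi))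
    (fun x _ => ZMod.natCast_zmod_val x) (fun _ _ => rfl)

namespace DirichletCharacter

variable {q : ℕ} [NeZero q]

/-- Complete periods sum to zero, so fewer than q terms survive, each of modulus at most 1. -/
theorem norm_sum_range_le {χ : DirichletCharacter ℂ q} (hχ : χ ≠ 1) (n : ℕ) :
    ‖∑ k ∈ Finset.range n, χ (k : ZMod q)‖ ≤ q := by
  induction n using Nat.strong_induction_on with
  | _ n ih =>
    rcases lt_or_ge n q with h | h
    · calc ‖∑ k ∈ Finset.range n, χ (k : ZMod q)‖ ≤ ∑ k ∈ Finset.range n, ‖χ (k : ZMod q)‖ :=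
            norm_sum_le _ _
        _ ≤ ∑ k ∈ Finset.range n, 1 := Finset.sum_le_sum fun k _ => χ.norm_le_one _
        _ ≤ q := by simp; exact_mod_cast h.le
    · obtain ⟨m, rfl⟩ := Nat.exists_eq_add_of_le' h
      rw [Finset.sum_range_add]
      have : ∑ x ∈ Finset.range q, χ ((m + x : ℕ) : ZMod q) = 0 := by
        push_cast
        rw [ZMod.sum_range_natCast (fun x : ZMod q => χ ((m : ZMod q) + x))]
        rw [← χ.sum_eq_zero_of_ne_one hχ]
        exact Fintype.sum_equiv (Equiv.addLeft (m : ZMod q)) _ _ fun _ => rfl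
      rw [this, add_zero]
      exact ih m (by have := NeZero.pos q; omega)

theorem norm_sum_Icc_le {χ : DirichletCharacter ℂ q} (hχ : χ ≠ 1) (hq : 1 < q) (n : ℕ) :
    ‖∑ k ∈ Finset.Icc 1 n, χ (k : ZMod q)‖ ≤ q := by
  have h := norm_sum_range_le hχ (n + 1)
  rw [Finset.sum_range_eq_add_Ico _ (Nat.succ_pos n)] at h
  have h0 : χ ((0 : ℕ) : ZMod q) = 0 := by
    simpa using χ.map_zero' hq.ne'
  rw [h0, zero_add] at h
  exact h

theorem ne_one_of_isPrimitive {χ : DirichletCharacter ℂ q} (hχ : χ.IsPrimitive) (hq : 1 < q) :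
    χ ≠ 1 := by
  rintro rfl
  rw [IsPrimitive, conductor_one] at hχ
  omega

/-- The bound for `L(s, χ)` obtained by partial summation. -/
theorem norm_LFunction_le {χ : DirichletCharacter ℂ q} (hχ : χ ≠ 1) (hq : 1 < q) {s : ℂ}
    (hs : 0 < s.re) : ‖LFunction χ s‖ ≤ ‖s‖ * (q / s.re) := by
  set A : ℝ → ℂ := fun t => ∑ k ∈ Finset.Icc 1 ⌊t⌋₊, χ (k : ZMod q) with hA
  have hAle : ∀ t, ‖A t‖ ≤ q := fun t => norm_sum_Icc_le hχ hq _
  have hAm : Measurable A := by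
    have : A = (fun n : ℕ => ∑ k ∈ Finset.Icc 1 n, χ (k : ZMod q)) ∘ (fun t : ℝ => ⌊t⌋₊) := rfl
    rw [this]
    exact (measurable_from_top).comp Nat.measurable_floor
  -- Cutting off below 1 turns the partial summation integral into a Mellin transform. Boundedness
  -- of B makes it holomorphic for Re s > 0, and the identity theorem extends the formula from Re s
  -- > 1.
  set B : ℝ → ℂ := (Set.Ioi (1 : ℝ)).indicator A with hB
  have hBle : ∀ t, ‖B t‖ ≤ q := fun t => (norm_indicator_le_norm_self _ _).trans (hAle t)
  have hBm : Measurable B := hAm.indicator measurableSet_Ioi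
  have hBint : ∀ s : ℂ, ∫ t in Set.Ioi (1 : ℝ), A t * (t : ℂ) ^ (-(s + 1)) = mellin B (-s) := by
    intro s
    rw [mellin, ← MeasureTheory.integral_indicator measurableSet_Ioi,
      ← MeasureTheory.integral_indicator measurableSet_Ioi]
    congr 1
    ext t
    by_cases ht : 1 < t
    · have ht' : (0 : ℝ) < t := by linarith
      simp only [hB, Set.indicator, Set.mem_Ioi, ht, ht', if_true, smul_eq_mul]
      rw [mul_comm]
      congr 2
      ring
    · simp [hB, Set.indicator, ht]
  have hdiff : ∀ s : ℂ, 0 < s.re → DifferentiableAt ℂ (mellin B) (-s) := by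
    intro s hs
    refine mellin_differentiableAt_of_isBigO_rpow (a := 0) (b := -s.re - 1) ?_ ?_ (by simpa using hs)
      ?_ (by simp)
    · refine (MeasureTheory.LocallyIntegrable.locallyIntegrableOn ?_ _)
      have : MeasureTheory.LocallyIntegrable (fun _ : ℝ => (q : ℝ)) MeasureTheory.volume :=
        MeasureTheory.locallyIntegrable_const _
      exact this.mono hBm.aestronglyMeasurable (Eventually.of_forall fun t => by simpa using hBle t)
    · refine Asymptotics.IsBigO.of_bound q (Eventually.of_forall fun t => ?_)
      simpa using hBle t
    · refine Asymptotics.IsBigO.of_bound 1 ?_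
      filter_upwards [Ioo_mem_nhdsGT (zero_lt_one' ℝ)] with t ht
      have : B t = 0 := by
        simp only [hB, Set.indicator, Set.mem_Ioi, not_lt.2 ht.2.le, if_false]
      rw [this]; simp
  have hopen : IsOpen {s : ℂ | 0 < s.re} := isOpen_lt continuous_const Complex.continuous_re
  have hEq : Set.EqOn (LFunction χ) (fun s => s * mellin B (-s)) {s : ℂ | 0 < s.re} := by
    refine AnalyticOnNhd.eqOn_of_preconnected_of_eventuallyEq (𝕜 := ℂ) (z₀ := 2) ?_ ?_ ?_ (by simp) ?_
    · exact ((differentiable_LFunction hχ).differentiableOn).analyticOnNhd hopen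
    · refine DifferentiableOn.analyticOnNhd (fun s hs => ?_) hopen
      have h1 := (hdiff s hs).comp s differentiable_neg.differentiableAt
      exact (differentiableAt_id.mul h1).differentiableWithinAt
    · exact (convex_halfSpace_re_gt 0).isPreconnected
    · have : {s : ℂ | 1 < s.re} ∈ 𝓝 (2 : ℂ) :=
        (isOpen_lt continuous_const Complex.continuous_re).mem_nhds (by simp)
      filter_upwards [this] with s hs
      rw [LFunction_eq_LSeries χ hs, ← hBint]
      refine LSeries_eq_mul_integral _ le_rfl (by linarith [show 1 < s.re from hs])
        (LSeriesSummable_of_one_lt_re χ hs) ?_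
      refine Asymptotics.IsBigO.of_bound q (Eventually.of_forall fun n => ?_)
      simpa using norm_sum_Icc_le hχ hq n
  rw [hEq hs]
  simp only [norm_mul]
  gcongr
  rw [← hBint]
  have hInt : MeasureTheory.IntegrableOn (fun t : ℝ => (q : ℝ) * t ^ (-s.re - 1)) (Set.Ioi 1) :=
    (integrableOn_Ioi_rpow_of_lt (by linarith) one_pos).const_mul _
  refine (MeasureTheory.norm_integral_le_of_norm_le hInt ?_).trans_eq ?_
  · filter_upwards [MeasureTheory.ae_restrict_mem measurableSet_Ioi] with t ht
    have ht' : (0 : ℝ) < t := by linarith [show (1 : ℝ) < t from ht]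
    rw [norm_mul, Complex.norm_cpow_eq_rpow_re_of_pos ht']
    have : (-(s + 1)).re = -s.re - 1 := by simp; ring
    rw [this]
    gcongr
    exact hAle t
  · rw [MeasureTheory.integral_const_mul, integral_Ioi_rpow_of_lt (by linarith) one_pos]
    simp
    field_simp

/-- Both sides are entire and agree as Dirichlet series. This turns the functional equation, which
links χ with χ⁻¹, into a statement about the modulus of one completed function. -/
theorem conj_LFunction {χ : DirichletCharacter ℂ q} (hχ : χ ≠ 1) (s : ℂ) :
    (starRingEnd ℂ) (LFunction χ ((starRingEnd ℂ) s)) = LFunction χ⁻¹ s := by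
  have hχ' : χ⁻¹ ≠ 1 := inv_ne_one.2 hχ
  have h1 : Differentiable ℂ (fun s => (starRingEnd ℂ) (LFunction χ ((starRingEnd ℂ) s))) :=
    fun s => by
      have := ((differentiable_LFunction hχ).differentiableAt
        (x := (starRingEnd ℂ) s)).conj_conj
      rwa [Complex.conj_conj] at this
  have : (fun s => (starRingEnd ℂ) (LFunction χ ((starRingEnd ℂ) s))) = LFunction χ⁻¹ := by
    refine AnalyticOnNhd.eq_of_eventuallyEq (z₀ := 2)
      (h1.differentiableOn.analyticOnNhd isOpen_univ)
      ((differentiable_LFunction hχ').differentiableOn.analyticOnNhd isOpen_univ) ?_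
    have : {s : ℂ | 1 < s.re} ∈ 𝓝 (2 : ℂ) :=
      (isOpen_lt continuous_const Complex.continuous_re).mem_nhds (by simp)
    filter_upwards [this] with s hs
    have hs' : 1 < s.re := hs
    rw [LFunction_eq_LSeries χ (by simpa using hs'), LFunction_eq_LSeries _ hs', LSeries, LSeries,
      Complex.conj_tsum]
    congr 1
    ext n
    rcases eq_or_ne n 0 with rfl | hn
    · simp
    · rw [LSeries.term_of_ne_zero hn, LSeries.term_of_ne_zero hn, map_div₀, ← MulChar.star_apply' χ]
      congr 1
      have := Complex.cpow_conj (n : ℂ) s (by simp [Complex.natCast_arg, Real.pi_ne_zero.symm])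
      rw [this, Complex.conj_conj]
      simp
  exact congrFun this s

end DirichletCharacter

/-! ### The branch of log L(s, χ) to the right of the critical line -/

theorem sum_range_rpow_neg_le {σ : ℝ} (hσ : 1 < σ) (N : ℕ) :
    ∑ n ∈ Finset.range N, ((n : ℝ) + 2) ^ (-σ) ≤ 1 / (σ - 1) := by
  have hanti : AntitoneOn (fun x : ℝ => x ^ (-σ)) (Set.Icc (1 : ℝ) (1 + N)) := by
    intro x hx y _ hxy
    exact Real.rpow_le_rpow_of_nonpos (by linarith [hx.1]) hxy (by linarith)
  have h := hanti.sum_le_integral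
  have h0 : (0 : ℝ) ∉ Set.uIcc (1 : ℝ) (1 + N) := by
    rw [Set.uIcc_of_le (by linarith [Nat.cast_nonneg (α := ℝ) N])]
    simp
  rw [integral_rpow (Or.inr ⟨by linarith, h0⟩)] at h
  have e : ∑ n ∈ Finset.range N, ((n : ℝ) + 2) ^ (-σ) =
      ∑ i ∈ Finset.range N, (1 + ((i + 1 : ℕ) : ℝ)) ^ (-σ) := by
    refine Finset.sum_congr rfl fun i _ => ?_
    push_cast; ring_nf
  rw [e]
  refine h.trans ?_
  have hpos : 0 < σ - 1 := by linarith
  have h1 : (0 : ℝ) ≤ (1 + (N : ℝ)) ^ (-σ + 1) := by positivity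
  rw [Real.one_rpow, show -σ + 1 = -(σ - 1) by ring, div_neg, ← neg_div]
  gcongr
  rw [show -(σ - 1) = -σ + 1 by ring]
  linarith

theorem summable_rpow_neg_shift {σ : ℝ} (hσ : 1 < σ) :
    Summable fun n : ℕ => ((n : ℝ) + 2) ^ (-σ) :=
  summable_of_sum_range_le (fun n => by positivity) (sum_range_rpow_neg_le hσ)

theorem tsum_rpow_neg_shift_le {σ : ℝ} (hσ : 1 < σ) :
    ∑' n : ℕ, ((n : ℝ) + 2) ^ (-σ) ≤ 1 / (σ - 1) :=
  Real.tsum_le_of_sum_range_le (fun n => by positivity) (sum_range_rpow_neg_le hσ)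

theorem tsum_rpow_neg_shift_le_two_rpow {σ : ℝ} (hσ : 2 ≤ σ) :
    ∑' n : ℕ, ((n : ℝ) + 2) ^ (-σ) ≤ 2 ^ (2 - σ) := by
  have h : ∀ n : ℕ, ((n : ℝ) + 2) ^ (-σ) ≤ 2 ^ (2 - σ) * ((n : ℝ) + 2) ^ (-(2 : ℝ)) := by
    intro n
    have h2 : (0 : ℝ) < (n : ℝ) + 2 := by positivity
    calc ((n : ℝ) + 2) ^ (-σ) = ((n : ℝ) + 2) ^ (2 - σ) * ((n : ℝ) + 2) ^ (-(2 : ℝ)) := by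
          rw [← Real.rpow_add h2]; ring_nf
      _ ≤ _ := by
          gcongr ?_ * _
          exact Real.rpow_le_rpow_of_nonpos (by norm_num) (by linarith [Nat.cast_nonneg (α := ℝ) n])
            (by linarith)
  have hs := summable_rpow_neg_shift (σ := 2) (by norm_num)
  calc ∑' n : ℕ, ((n : ℝ) + 2) ^ (-σ)
      ≤ ∑' n : ℕ, 2 ^ (2 - σ) * ((n : ℝ) + 2) ^ (-(2 : ℝ)) :=
        (summable_rpow_neg_shift (by linarith)).tsum_le_tsum h (hs.mul_left _)
    _ = 2 ^ (2 - σ) * ∑' n : ℕ, ((n : ℝ) + 2) ^ (-(2 : ℝ)) := tsum_mul_left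
    _ ≤ 2 ^ (2 - σ) * 1 := by
        gcongr
        have := tsum_rpow_neg_shift_le (σ := 2) (by norm_num)
        norm_num at this ⊢
        exact this
    _ = 2 ^ (2 - σ) := mul_one _

namespace DirichletCharacter

variable {q : ℕ}

/-- The coefficients of the Dirichlet series of `log L(s, χ)`. -/
noncomputable def logCoeff (χ : DirichletCharacter ℂ q) (n : ℕ) : ℂ :=
  χ (n : ZMod q) * ((ArithmeticFunction.vonMangoldt n / Real.log n : ℝ) : ℂ)

theorem norm_logCoeff_le (χ : DirichletCharacter ℂ q) (n : ℕ) : ‖logCoeff χ n‖ ≤ 1 := by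
  rw [logCoeff, norm_mul, Complex.norm_real, Real.norm_of_nonneg
    (div_nonneg ArithmeticFunction.vonMangoldt_nonneg (Real.log_natCast_nonneg n))]
  refine mul_le_one₀ (χ.norm_le_one _)
    (div_nonneg ArithmeticFunction.vonMangoldt_nonneg (Real.log_natCast_nonneg n)) ?_
  exact div_le_one_of_le₀ ArithmeticFunction.vonMangoldt_le_log (Real.log_natCast_nonneg n)

theorem norm_LSeries_logCoeff_le (χ : DirichletCharacter ℂ q) {s : ℂ} (hs : 1 < s.re) :
    ‖LSeries (logCoeff χ) s‖ ≤ ∑' n : ℕ, ((n : ℝ) + 2) ^ (-s.re) := by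
  have hsum : LSeriesSummable (logCoeff χ) s :=
    LSeriesSummable_of_bounded_of_one_lt_re (fun n _ => norm_logCoeff_le χ n) hs
  have hsum' : Summable (fun n => LSeries.term (logCoeff χ) s n) := hsum
  have h0 : LSeries.term (logCoeff χ) s 0 = 0 := by simp
  have h1 : LSeries.term (logCoeff χ) s 1 = 0 := by simp [logCoeff, LSeries.term]
  rw [LSeries, ← hsum'.sum_add_tsum_nat_add 2]
  simp only [Finset.sum_range_succ, Finset.sum_range_zero, h0, h1, zero_add]
  refine tsum_of_norm_bounded (summable_rpow_neg_shift hs).hasSum fun n => ?_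
  rw [LSeries.norm_term_eq, if_neg (by omega), Real.rpow_neg (by positivity), div_eq_mul_inv]
  push_cast
  calc _ ≤ 1 * (((n : ℝ) + 2) ^ s.re)⁻¹ := by gcongr; exact norm_logCoeff_le χ _
    _ = _ := one_mul _

variable [NeZero q]

theorem hasDerivAt_LSeries_logCoeff (χ : DirichletCharacter ℂ q) {s : ℂ} (hs : 1 < s.re) :
    HasDerivAt (LSeries (logCoeff χ)) (deriv (LFunction χ) s / LFunction χ s) s := by
  have habs : LSeries.abscissaOfAbsConv (logCoeff χ) < s.re := by
    refine lt_of_le_of_lt (LSeries.abscissaOfAbsConv_le_of_le_const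
      ⟨1, fun n _ => norm_logCoeff_le χ n⟩) ?_
    exact_mod_cast hs
  refine (LSeries_hasDerivAt habs).congr_deriv ?_
  rw [deriv_LFunction_eq_deriv_LSeries χ hs, LFunction_eq_LSeries χ hs]
  have h := LSeries_twist_vonMangoldt_eq χ hs
  rw [neg_div] at h
  rw [neg_eq_iff_eq_neg, ← h]
  refine LSeries_congr (fun {n} hn => ?_) s
  simp only [LSeries.logMul, logCoeff, Pi.mul_apply]
  -- At n = 1 the coefficient is 0/0 = 0, in agreement with Λ(1) = 0.
  rcases eq_or_ne n 1 with rfl | h1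
  · simp
  · have : Real.log n ≠ 0 := Real.log_ne_zero_of_pos_of_ne_one (by positivity) (by exact_mod_cast h1)
    have h2 : (Real.log n : ℂ) ≠ 0 := by exact_mod_cast this
    rw [Complex.natCast_log] at h2
    push_cast
    field_simp

/-- `ℓ` is the branch of `log L(s, χ)` on `Re s > 1/2` that tends to zero as `Re s → ∞`. -/
structure IsLogL (χ : DirichletCharacter ℂ q) (ℓ : ℂ → ℂ) : Prop where
  hasDerivAt : ∀ s : ℂ, 1 / 2 < s.re →
    HasDerivAt ℓ (deriv (LFunction χ) s / LFunction χ s) s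
  exp_eq : ∀ s : ℂ, 1 / 2 < s.re → Complex.exp (ℓ s) = LFunction χ s
  norm_le_inv : ∀ s : ℂ, 1 < s.re → ‖ℓ s‖ ≤ 1 / (s.re - 1)
  norm_le_two_rpow : ∀ s : ℂ, 2 ≤ s.re → ‖ℓ s‖ ≤ 2 ^ (2 - s.re)

theorem ne_zero_of_GRH (hGRH : GRH) {χ : DirichletCharacter ℂ q} (hχ : χ ≠ 1) {s : ℂ}
    (hs : 1 / 2 < s.re) : LFunction χ s ≠ 0 := by
  intro h
  rcases lt_or_ge s.re 1 with h1 | h1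
  · exact hs.ne' (hGRH q χ s (by linarith) h1 h)
  · exact LFunction_ne_zero_of_one_le_re χ (Or.inl hχ) h1 h

theorem tendsto_LFunction_atTop (χ : DirichletCharacter ℂ q) :
    Tendsto (fun x : ℝ => LFunction χ (x : ℂ)) atTop (𝓝 1) := by
  have h := LSeries.tendsto_atTop (f := fun n : ℕ => χ (n : ZMod q)) (by
    rw [absicssaOfAbsConv_eq_one (NeZero.ne q)]; exact EReal.coe_lt_top 1)
  simp only [Nat.cast_one, map_one] at h
  refine h.congr' ?_
  filter_upwards [eventually_gt_atTop 1] with x hx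
  exact (LFunction_eq_LSeries χ (by simpa using hx)).symm

/-- A primitive of L'/L is normalised at s = 2 to agree with the Dirichlet series of log L on Re s >
1, which yields the size bounds. Then e^{-ℓ} L has zero derivative and tends to 1 along the real
axis, so it is identically 1. -/
theorem exists_isLogL {χ : DirichletCharacter ℂ q} (hχ : χ ≠ 1)
    (hne : ∀ s : ℂ, 1 / 2 < s.re → LFunction χ s ≠ 0) : ∃ ℓ, IsLogL χ ℓ := by
  have hopen : ∀ c : ℝ, IsOpen {s : ℂ | c < s.re} := fun c =>
    isOpen_lt continuous_const Complex.continuous_re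
  have hL := differentiable_LFunction hχ
  have hdiff : DifferentiableOn ℂ (fun s => deriv (LFunction χ) s / LFunction χ s)
      {s : ℂ | 1 / 2 < s.re} :=
    (hL.differentiableOn.deriv (hopen _)).div hL.differentiableOn fun s hs => hne s hs
  obtain ⟨g, hg⟩ := exists_primitive_on_halfPlane hdiff
  set ℓ : ℂ → ℂ := fun s => g s - g 2 + LSeries (logCoeff χ) 2 with hℓ
  have hℓd : ∀ s : ℂ, 1 / 2 < s.re → HasDerivAt ℓ (deriv (LFunction χ) s / LFunction χ s) s :=
    fun s hs => ((hg s hs).sub_const _).add_const _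
  have heq : ∀ s : ℂ, 1 < s.re → ℓ s = LSeries (logCoeff χ) s := by
    have key : Set.EqOn ℓ (LSeries (logCoeff χ)) {s : ℂ | 1 < s.re} := by
      refine (hopen 1).eqOn_of_deriv_eq (convex_halfSpace_re_gt 1).isPreconnected (x := 2)
        (fun s hs => ?_) (fun s hs => ?_) (fun s hs => ?_) (by simp) (by simp [hℓ])
      · exact (hℓd s (by linarith [show 1 < s.re from hs])).differentiableAt.differentiableWithinAt
      · exact (hasDerivAt_LSeries_logCoeff χ hs).differentiableAt.differentiableWithinAt
      · rw [(hℓd s (by linarith [show 1 < s.re from hs])).deriv,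
          (hasDerivAt_LSeries_logCoeff χ hs).deriv]
    exact fun s hs => key hs
  have hbound : ∀ s : ℂ, 2 ≤ s.re → ‖ℓ s‖ ≤ 2 ^ (2 - s.re) := fun s hs => by
    rw [heq s (by linarith)]
    exact (norm_LSeries_logCoeff_le χ (by linarith)).trans (tsum_rpow_neg_shift_le_two_rpow hs)
  refine ⟨ℓ, hℓd, ?_, fun s hs => ?_, hbound⟩
  · set F : ℂ → ℂ := fun s => Complex.exp (-ℓ s) * LFunction χ s with hF
    have hFd : ∀ s : ℂ, 1 / 2 < s.re → HasDerivAt F 0 s := by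
      intro s hs
      refine ((hℓd s hs).neg.cexp.mul (hL s).hasDerivAt).congr_deriv ?_
      have := hne s hs
      field_simp
      ring
    have hconst : ∀ s : ℂ, 1 / 2 < s.re → ∀ z : ℂ, 1 / 2 < z.re → F s = F z := by
      intro s hs z hz
      refine (hopen (1 / 2)).eqOn_of_deriv_eq (f := F) (g := fun _ => F z)
        (convex_halfSpace_re_gt (1 / 2)).isPreconnected (x := z)
        (fun s hs => (hFd s hs).differentiableAt.differentiableWithinAt)
        (differentiableOn_const _) (fun s hs => ?_) hz rfl hs
      rw [(hFd s hs).deriv]; simp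
    have hlim : Tendsto (fun x : ℝ => F (x : ℂ)) atTop (𝓝 1) := by
      have h1 : Tendsto (fun x : ℝ => ℓ (x : ℂ)) atTop (𝓝 0) := by
        refine squeeze_zero_norm' (a := fun x : ℝ => (2 : ℝ) ^ (2 - x)) ?_ ?_
        · filter_upwards [eventually_ge_atTop 2] with x hx
          simpa using hbound (x : ℂ) (by simpa using hx)
        · exact (tendsto_rpow_atBot_of_base_gt_one 2 (by norm_num)).comp
            (tendsto_atBot_add_const_left _ (2 : ℝ) tendsto_neg_atTop_atBot)
      have h2 := ((h1.neg.cexp).mul (tendsto_LFunction_atTop χ))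
      simpa using h2
    intro s hs
    have h1 : F s = 1 := by
      refine tendsto_nhds_unique (tendsto_const_nhds.congr' ?_) hlim
      filter_upwards [eventually_gt_atTop 1] with x hx
      exact hconst s hs x (by simp; linarith)
    have h2 : LFunction χ s = Complex.exp (ℓ s) * F s := by
      simp only [hF]; rw [← mul_assoc, ← Complex.exp_add]; simp
    rw [h2, h1, mul_one]
  · rw [heq s hs]
    exact (norm_LSeries_logCoeff_le χ hs).trans (tsum_rpow_neg_shift_le hs)

end DirichletCharacter

/-! ### Estimates for Γ and its logarithmic derivative -/

theorem hasDerivAt_log_norm_add {z : ℂ} {x : ℝ} (h : 0 < z.re + x) :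
    HasDerivAt (fun x : ℝ => Real.log ‖z + x‖) ((z + x)⁻¹).re x := by
  have h1 : HasDerivAt (fun x : ℝ => z + (x : ℂ)) 1 x := by
    simpa using (hasDerivAt_id x).ofReal_comp.const_add z
  have h2 : z + (x : ℂ) ∈ Complex.slitPlane := Or.inl (by simpa using h)
  have h3 := hasDerivAt_re_of_hasDerivAt (h1.clog_real h2)
  simpa [Complex.log_re] using h3

theorem norm_add_ge_re {z : ℂ} {x : ℝ} : z.re + x ≤ ‖z + x‖ := by
  simpa using Complex.re_le_norm (z + x)

theorem abs_log_norm_add_sub_le {z : ℂ} (hz : 1 / 4 ≤ z.re) {δ : ℝ} (hδ : 0 ≤ δ) :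
    |Real.log ‖z + δ‖ - Real.log ‖z‖| ≤ 4 * δ := by
  have h := (convex_Icc (0 : ℝ) δ).norm_image_sub_le_of_norm_hasDerivWithin_le (C := 4)
    (f := fun x : ℝ => Real.log ‖z + x‖) (f' := fun x : ℝ => ((z + x)⁻¹).re) (x := 0) (y := δ)
    (fun x hx => (hasDerivAt_log_norm_add (by linarith [hx.1])).hasDerivWithinAt) (fun x hx => by
      have h1 : 1 / 4 ≤ ‖z + x‖ := le_trans (by linarith [hx.1]) norm_add_ge_re
      rw [Real.norm_eq_abs]
      refine (Complex.abs_re_le_norm _).trans ?_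
      rw [norm_inv]
      calc ‖z + x‖⁻¹ ≤ (1 / 4)⁻¹ := by gcongr
        _ = 4 := by norm_num) (Set.left_mem_Icc.2 hδ) (Set.right_mem_Icc.2 hδ)
  simpa [abs_of_nonneg hδ] using h

/-- By the mean value theorem the logarithmic increment is Re 1/(w + θ) with 0 < θ < 1, and 1/w -
1/(w + θ) = θ/(w(w + θ)). -/
theorem abs_re_inv_sub_log_norm_le {w : ℂ} (hw : 0 < w.re) :
    |(w⁻¹).re - (Real.log ‖w + 1‖ - Real.log ‖w‖)| ≤ 1 / w.re ^ 2 := by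
  obtain ⟨θ, hθ, h⟩ := exists_hasDerivAt_eq_slope (fun x : ℝ => Real.log ‖w + x‖)
    (fun x : ℝ => ((w + x)⁻¹).re) zero_lt_one
    (fun x hx => (hasDerivAt_log_norm_add (by linarith [hx.1])).continuousAt.continuousWithinAt)
    (fun x hx => hasDerivAt_log_norm_add (by linarith [hx.1]))
  simp only [Complex.ofReal_one, Complex.ofReal_zero, add_zero, sub_zero, div_one] at h
  rw [← h, ← Complex.sub_re]
  refine (Complex.abs_re_le_norm _).trans ?_
  have h0 : w ≠ 0 := fun h => by simp [h] at hw
  have h1 : w + θ ≠ 0 := fun h => by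
    have := congrArg Complex.re h
    simp at this
    linarith [hθ.1]
  rw [inv_sub_inv h0 h1, add_sub_cancel_left, norm_div, norm_mul, Complex.norm_real,
    Real.norm_of_nonneg hθ.1.le, sq]
  have h2 : w.re ≤ ‖w‖ := Complex.re_le_norm w
  have h3 : w.re ≤ ‖w + θ‖ := le_trans (by linarith [hθ.1]) norm_add_ge_re
  gcongr
  exact hθ.2.le

/-- The logarithms telescope, and the termwise errors are at most 1/(j + 1/4)², a summable bound
independent of w. -/
theorem exists_abs_sum_re_inv_sub_log_le : ∃ C : ℝ, 0 ≤ C ∧ ∀ (w : ℂ), 1 / 4 ≤ w.re → ∀ n : ℕ,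
    |∑ j ∈ Finset.range (n + 1), ((w + j)⁻¹).re - (Real.log ‖w + (n + 1)‖ - Real.log ‖w‖)| ≤ C := by
  have hsum : Summable fun n : ℕ => 1 / ((n : ℝ) + 1 / 4) ^ 2 := by
    have := (Real.summable_one_div_nat_add_rpow (1 / 4) 2).2 (by norm_num)
    refine this.congr fun n => ?_
    rw [abs_of_nonneg (by positivity)]
    norm_num
  refine ⟨∑' n : ℕ, 1 / ((n : ℝ) + 1 / 4) ^ 2, tsum_nonneg fun n => by positivity,
    fun w hw n => ?_⟩
  have htel : Real.log ‖w + (n + 1)‖ - Real.log ‖w‖ =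
      ∑ j ∈ Finset.range (n + 1), (Real.log ‖w + j + 1‖ - Real.log ‖w + j‖) := by
    have := Finset.sum_range_sub (fun j : ℕ => Real.log ‖w + j‖) (n + 1)
    simp only [Nat.cast_add, Nat.cast_one, Nat.cast_zero, add_zero] at this
    rw [← this]
    refine Finset.sum_congr rfl fun j _ => by rw [add_assoc]
  rw [htel, ← Finset.sum_sub_distrib]
  refine (Finset.abs_sum_le_sum_abs _ _).trans ?_
  refine le_trans (Finset.sum_le_sum fun j _ => ?_) (hsum.sum_le_tsum _ fun n _ => by positivity)
  have h1 : 0 < (w + j).re := by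
    simp only [Complex.add_re, Complex.natCast_re]
    have := Nat.cast_nonneg (α := ℝ) j
    linarith
  refine (abs_re_inv_sub_log_norm_le h1).trans ?_
  have h2 : (j : ℝ) + 1 / 4 ≤ (w + j).re := by
    simp only [Complex.add_re, Complex.natCast_re]; linarith
  gcongr

theorem log_norm_GammaSeq {z : ℂ} (hz : 0 < z.re) {n : ℕ} (hn : n ≠ 0) :
    Real.log ‖Complex.GammaSeq z n‖ = z.re * Real.log n + Real.log (n.factorial) -
      ∑ j ∈ Finset.range (n + 1), Real.log ‖z + j‖ := by
  have hn' : (0 : ℝ) < n := by positivity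
  have hne : ∀ j : ℕ, z + j ≠ 0 := fun j h => by
    have := congrArg Complex.re h
    simp at this
    linarith [Nat.cast_nonneg (α := ℝ) j]
  rw [Complex.GammaSeq, norm_div, norm_mul, Complex.norm_natCast_cpow_of_pos (Nat.pos_of_ne_zero hn),
    Complex.norm_natCast, norm_prod, Real.log_div (by positivity)
      (Finset.prod_ne_zero_iff.2 fun j _ => norm_ne_zero_iff.2 (hne j)),
    Real.log_mul (by positivity) (by positivity), Real.log_rpow hn',
    Real.log_prod fun j _ => norm_ne_zero_iff.2 (hne j)]

/-- A weak substitute for Stirling's formula. In Euler's limit the δ-derivative of log |Γ_n(z + δ)|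
is log n - Σ Re 1/(z + δ + j), which equals log |z| up to a bounded error once n exceeds 1 + δ +
|z|; integrate and let n tend to infinity. -/
theorem exists_abs_log_norm_Gamma_sub_le : ∃ C : ℝ, ∀ (z : ℂ), 1 / 4 ≤ z.re → ∀ δ : ℝ, 0 ≤ δ →
    |Real.log ‖Complex.Gamma (z + δ)‖ - Real.log ‖Complex.Gamma z‖ - δ * Real.log ‖z‖| ≤
      (C + 4 * δ) * δ := by
  obtain ⟨C, hC0, hC⟩ := exists_abs_sum_re_inv_sub_log_le
  refine ⟨C + Real.log 2, fun z hz δ hδ => ?_⟩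
  have hlim : Tendsto (fun n : ℕ => Real.log ‖Complex.GammaSeq (z + δ) n‖ -
      Real.log ‖Complex.GammaSeq z n‖ - δ * Real.log ‖z‖) atTop
      (𝓝 (Real.log ‖Complex.Gamma (z + δ)‖ - Real.log ‖Complex.Gamma z‖ - δ * Real.log ‖z‖)) := by
    have h1 := (Complex.GammaSeq_tendsto_Gamma (z + δ)).norm.log
      (norm_ne_zero_iff.2 (Complex.Gamma_ne_zero_of_re_pos (by simp; linarith)))
    have h2 := (Complex.GammaSeq_tendsto_Gamma z).norm.log
      (norm_ne_zero_iff.2 (Complex.Gamma_ne_zero_of_re_pos (by linarith)))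
    exact (h1.sub h2).sub_const _
  refine le_of_tendsto hlim.abs ?_
  obtain ⟨N, hN⟩ := exists_nat_ge (1 + δ + ‖z‖)
  filter_upwards [eventually_ge_atTop N, eventually_ne_atTop 0] with n hnN hn
  have hn' : (0 : ℝ) < n := by positivity
  have hnN' : 1 + δ + ‖z‖ ≤ n := hN.trans (by exact_mod_cast hnN)
  set g : ℝ → ℝ := fun τ => τ * (Real.log n - Real.log ‖z‖) -
    ∑ j ∈ Finset.range (n + 1), Real.log ‖z + j + τ‖ with hg
  have hd : ∀ τ ∈ Set.Icc 0 δ, HasDerivAt g (Real.log n - Real.log ‖z‖ -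
      ∑ j ∈ Finset.range (n + 1), ((z + τ + j)⁻¹).re) τ := by
    intro τ hτ
    have h1 : HasDerivAt (fun τ : ℝ => ∑ j ∈ Finset.range (n + 1), Real.log ‖z + j + τ‖)
        (∑ j ∈ Finset.range (n + 1), ((z + j + τ)⁻¹).re) τ := by
      refine HasDerivAt.fun_sum fun j _ => hasDerivAt_log_norm_add ?_
      simp only [Complex.add_re, Complex.natCast_re]
      linarith [hτ.1, Nat.cast_nonneg (α := ℝ) j]
    have h2 := ((hasDerivAt_id τ).mul_const (Real.log n - Real.log ‖z‖)).sub h1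
    refine h2.congr_deriv ?_
    rw [one_mul]
    congr 1
    refine Finset.sum_congr rfl fun j _ => by rw [add_right_comm]
  have hb : ∀ τ ∈ Set.Icc 0 δ, ‖Real.log n - Real.log ‖z‖ -
      ∑ j ∈ Finset.range (n + 1), ((z + τ + j)⁻¹).re‖ ≤ C + Real.log 2 + 4 * δ := by
    intro τ hτ
    have h1 := hC (z + τ) (by simp; linarith [hτ.1]) n
    have h2 := abs_log_norm_add_sub_le hz hτ.1
    have h3 : Real.log n ≤ Real.log ‖z + τ + (n + 1)‖ := by
      refine Real.log_le_log hn' ?_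
      have := Complex.re_le_norm (z + τ + (n + 1))
      simp at this
      linarith [hτ.1]
    have h4 : Real.log ‖z + τ + (n + 1)‖ ≤ Real.log n + Real.log 2 := by
      rw [← Real.log_mul hn'.ne' two_ne_zero]
      refine Real.log_le_log (lt_of_lt_of_le hn' ?_) ?_
      · have := Complex.re_le_norm (z + τ + (n + 1))
        simp at this
        linarith [hτ.1]
      · calc ‖z + τ + (n + 1)‖ ≤ ‖z‖ + ‖(τ : ℂ)‖ + ‖(n + 1 : ℂ)‖ := norm_add₃_le
          _ = ‖z‖ + τ + (n + 1) := by
            rw [Complex.norm_real, Real.norm_of_nonneg hτ.1,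
              show (n + 1 : ℂ) = ((n + 1 : ℕ) : ℂ) by push_cast; rfl, Complex.norm_natCast]
            push_cast; rfl
          _ ≤ n * 2 := by linarith [hτ.2]
    have h5 := hτ.2
    rw [Real.norm_eq_abs]
    rw [abs_le] at h1 h2 ⊢
    constructor <;> linarith [h1.1, h1.2, h2.1, h2.2]
  have key := (convex_Icc (0 : ℝ) δ).norm_image_sub_le_of_norm_hasDerivWithin_le
    (fun τ hτ => (hd τ hτ).hasDerivWithinAt) hb (Set.left_mem_Icc.2 hδ) (Set.right_mem_Icc.2 hδ)
  rw [Real.norm_eq_abs, Real.norm_eq_abs, sub_zero, abs_of_nonneg hδ] at key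
  refine le_trans (le_of_eq ?_) key
  congr 1
  rw [log_norm_GammaSeq (by simp; linarith) hn, log_norm_GammaSeq (by linarith) hn]
  simp only [hg, Complex.add_re, Complex.ofReal_re, Complex.ofReal_zero, add_zero]
  have : ∑ j ∈ Finset.range (n + 1), Real.log ‖z + δ + j‖ =
      ∑ j ∈ Finset.range (n + 1), Real.log ‖z + j + δ‖ :=
    Finset.sum_congr rfl fun j _ => by rw [add_right_comm]
  rw [this]
  ring

theorem hasDerivAt_Gamma_of_re_pos {z : ℂ} (hz : 0 < z.re) :
    DifferentiableAt ℂ Complex.Gamma z := by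
  refine Complex.differentiableAt_Gamma _ fun m h => ?_
  rw [h] at hz
  simp at hz
  linarith [Nat.cast_nonneg (α := ℝ) m]

/-- The logarithmic derivative of a nonvanishing holomorphic function is the derivative of the
logarithm of the modulus. -/
theorem hasDerivAt_log_norm_horizontal {f : ℂ → ℂ} {f' : ℂ} {σ t : ℝ}
    (h : HasDerivAt f f' ⟨σ, t⟩) (hne : f ⟨σ, t⟩ ≠ 0) :
    HasDerivAt (fun x : ℝ => Real.log ‖f ⟨x, t⟩‖) (f' / f ⟨σ, t⟩).re σ := by
  have h1 := hasDerivAt_horizontal h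
  have h2 : HasDerivAt (fun x : ℝ => f ⟨x, t⟩ / f ⟨σ, t⟩) (f' / f ⟨σ, t⟩) σ := h1.div_const _
  have h3 : f ⟨σ, t⟩ / f ⟨σ, t⟩ ∈ Complex.slitPlane := by rw [div_self hne]; simp
  have h4 := hasDerivAt_re_of_hasDerivAt (h2.clog_real h3)
  rw [div_self hne, div_one] at h4
  have h5 := h4.const_add (Real.log ‖f ⟨σ, t⟩‖)
  refine h5.congr_of_eventuallyEq ?_
  filter_upwards [h1.continuousAt.eventually_ne hne] with x hx
  rw [Complex.log_re, norm_div, Real.log_div (norm_ne_zero_iff.2 hx) (norm_ne_zero_iff.2 hne)]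
  ring

/-- Divide the preceding estimate by δ and let δ tend to 0 from the right. -/
theorem exists_abs_re_digamma_sub_log_le : ∃ C : ℝ, ∀ (z : ℂ), 1 / 4 ≤ z.re →
    |(Complex.digamma z).re - Real.log ‖z‖| ≤ C := by
  obtain ⟨C, hC⟩ := exists_abs_log_norm_Gamma_sub_le
  refine ⟨C, fun z hz => ?_⟩
  have hpos : 0 < z.re := by linarith
  have h1 := hasDerivAt_log_norm_horizontal (σ := z.re) (t := z.im)
    (hasDerivAt_Gamma_of_re_pos hpos).hasDerivAt (Complex.Gamma_ne_zero_of_re_pos hpos)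
  have e : (deriv Complex.Gamma z / Complex.Gamma z).re = (Complex.digamma z).re := by
    rw [Complex.digamma_def, logDeriv_apply]
  rw [show (⟨z.re, z.im⟩ : ℂ) = z from rfl, e] at h1
  have h2 := h1.tendsto_slope_zero_right
  have h3 : Tendsto (fun δ : ℝ => |δ⁻¹ • (Real.log ‖Complex.Gamma ⟨z.re + δ, z.im⟩‖ -
      Real.log ‖Complex.Gamma ⟨z.re, z.im⟩‖) - Real.log ‖z‖| - 4 * δ) (𝓝[>] 0)
      (𝓝 (|(Complex.digamma z).re - Real.log ‖z‖| - 4 * 0)) := by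
    refine ((h2.sub_const _).abs).sub ?_
    exact (tendsto_id.const_mul 4).mono_left nhdsWithin_le_nhds
  rw [mul_zero, sub_zero] at h3
  refine le_of_tendsto h3 ?_
  filter_upwards [self_mem_nhdsWithin] with δ hδ
  have hδ : 0 < δ := hδ
  have h4 := hC z hz δ hδ.le
  have e2 : (⟨z.re + δ, z.im⟩ : ℂ) = z + δ := by apply Complex.ext <;> simp
  rw [e2, smul_eq_mul, show (⟨z.re, z.im⟩ : ℂ) = z from rfl]
  have e3 : δ⁻¹ * (Real.log ‖Complex.Gamma (z + δ)‖ - Real.log ‖Complex.Gamma z‖) - Real.log ‖z‖ =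
      δ⁻¹ * (Real.log ‖Complex.Gamma (z + δ)‖ - Real.log ‖Complex.Gamma z‖ - δ * Real.log ‖z‖) := by
    field_simp
  rw [e3, abs_mul, abs_of_pos (inv_pos.2 hδ)]
  have h5 : δ⁻¹ * |Real.log ‖Complex.Gamma (z + δ)‖ - Real.log ‖Complex.Gamma z‖ -
      δ * Real.log ‖z‖| ≤ δ⁻¹ * ((C + 4 * δ) * δ) := by gcongr
  have h6 : δ⁻¹ * ((C + 4 * δ) * δ) = C + 4 * δ := by field_simp
  linarith

/-- Comparison of `Γ(z)` with `Γ(z + δ)`, uniformly on right half-planes. -/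
theorem exists_norm_Gamma_le_mul_norm_Gamma_add {x₀ δ : ℝ} (hx₀ : 0 < x₀) (hδ : 0 < δ) :
    ∃ C : ℝ, 0 ≤ C ∧ ∀ z : ℂ, x₀ ≤ z.re → ‖Complex.Gamma z‖ ≤ C * ‖Complex.Gamma (z + δ)‖ := by
  -- Γ(z) Γ(δ) = Γ(z + δ) B(z, δ), and the Beta integrand is largest in modulus when Re z takes its
  -- least value x₀.
  set J : ℝ := ∫ x : ℝ in (0 : ℝ)..1, ‖(x : ℂ) ^ ((x₀ : ℂ) - 1) * (1 - (x : ℂ)) ^ ((δ : ℂ) - 1)‖ with hJ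
  have hJint := (Complex.betaIntegral_convergent (u := x₀) (v := δ) (by simpa) (by simpa)).norm
  have hJ0 : 0 ≤ J := intervalIntegral.integral_nonneg zero_le_one fun x _ => norm_nonneg _
  have hG : 0 < ‖Complex.Gamma δ‖ :=
    norm_pos_iff.2 (Complex.Gamma_ne_zero_of_re_pos (by simpa))
  refine ⟨J / ‖Complex.Gamma δ‖, by positivity, fun z hz => ?_⟩
  have h := Complex.Gamma_mul_Gamma_eq_betaIntegral (s := z) (t := δ) (by linarith) (by simpa)
  have hb : ‖Complex.betaIntegral z δ‖ ≤ J := by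
    refine intervalIntegral.norm_integral_le_of_norm_le zero_le_one ?_ hJint
    filter_upwards [MeasureTheory.Measure.ae_ne MeasureTheory.volume (1 : ℝ)] with x hx1 hx
    have hx0 : 0 < x := hx.1
    have hx1 : 0 < 1 - x := sub_pos.2 (lt_of_le_of_ne hx.2 hx1)
    rw [norm_mul, norm_mul, Complex.norm_cpow_eq_rpow_re_of_pos hx0,
      Complex.norm_cpow_eq_rpow_re_of_pos hx0]
    refine mul_le_mul_of_nonneg_right ?_ (norm_nonneg _)
    refine Real.rpow_le_rpow_of_exponent_ge hx0 hx.2 ?_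
    simpa using hz
  have h2 := congrArg norm h
  rw [norm_mul, norm_mul] at h2
  rw [div_mul_eq_mul_div, le_div_iff₀ hG, h2, mul_comm]
  gcongr

/-! ### The archimedean factor, the functional equation and ξ -/

namespace DirichletCharacter

variable {q : ℕ}

open Classical in
/-- The parity of a Dirichlet character: `0` if it is even, `1` if it is odd. -/
noncomputable def parity (χ : DirichletCharacter ℂ q) : ℝ := if χ.Even then 0 else 1

theorem parity_nonneg (χ : DirichletCharacter ℂ q) : 0 ≤ parity χ := by
  unfold parity; split_ifs <;> norm_num

theorem parity_le_one (χ : DirichletCharacter ℂ q) : parity χ ≤ 1 := by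
  unfold parity; split_ifs <;> norm_num

theorem gammaFactor_eq (χ : DirichletCharacter ℂ q) (s : ℂ) :
    gammaFactor χ s = Complex.Gammaℝ (s + parity χ) := by
  unfold gammaFactor parity; split_ifs <;> simp

theorem gammaFactor_inv (χ : DirichletCharacter ℂ q) (s : ℂ) :
    gammaFactor χ⁻¹ s = gammaFactor χ s := by
  have h : χ⁻¹ (-1) = χ (-1) := by
    rw [← MulChar.star_apply' χ]
    rcases χ.even_or_odd with h | h <;> rw [h] <;> simp
  rcases χ.even_or_odd with he | ho
  · rw [he.gammaFactor_def, Even.gammaFactor_def (h.trans he)]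
  · rw [ho.gammaFactor_def, Odd.gammaFactor_def (h.trans ho)]

/-- The archimedean factor, including the conductor, of the completed `L`-function. -/
noncomputable def archFactor (χ : DirichletCharacter ℂ q) (s : ℂ) : ℂ :=
  (q : ℂ) ^ (s / 2) * gammaFactor χ s

theorem norm_gammaFactor_conj (χ : DirichletCharacter ℂ q) (s : ℂ) :
    ‖gammaFactor χ ((starRingEnd ℂ) s)‖ = ‖gammaFactor χ s‖ := by
  have e : (starRingEnd ℂ) s / 2 + parity χ / 2 = (starRingEnd ℂ) ((s + parity χ) / 2) := by
    simp [add_div, map_ofNat]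
  rw [gammaFactor_eq, gammaFactor_eq, Complex.Gammaℝ_def, Complex.Gammaℝ_def, norm_mul, norm_mul,
    add_div, e, Complex.Gamma_conj, Complex.norm_conj, Complex.norm_cpow_eq_rpow_re_of_pos Real.pi_pos,
    Complex.norm_cpow_eq_rpow_re_of_pos Real.pi_pos]
  simp

theorem gammaFactor_ne_zero (χ : DirichletCharacter ℂ q) {s : ℂ} (hs : 0 < s.re) :
    gammaFactor χ s ≠ 0 := by
  rw [gammaFactor_eq]
  refine Complex.Gammaℝ_ne_zero_of_re_pos ?_
  simp
  linarith [parity_nonneg χ]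

theorem one_le_log (hq : 1 < q) (t : ℝ) : 1 ≤ Real.log (q * (|t| + 3)) := by
  have hq' : (2 : ℝ) ≤ q := by exact_mod_cast hq
  rw [Real.le_log_iff_exp_le (by positivity)]
  nlinarith [Real.exp_one_lt_d9, abs_nonneg t]

variable [NeZero q]

/-- The completed `L`-function, normalised so that its functional equation preserves the modulus. -/
noncomputable def xi (χ : DirichletCharacter ℂ q) (s : ℂ) : ℂ := archFactor χ s * LFunction χ s

theorem natCast_cpow_ne_zero (s : ℂ) : (q : ℂ) ^ s ≠ 0 := by
  rw [Complex.cpow_def_of_ne_zero (NeZero.ne _)]; exact Complex.exp_ne_zero _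

theorem archFactor_ne_zero (χ : DirichletCharacter ℂ q) {s : ℂ} (hs : 0 < s.re) :
    archFactor χ s ≠ 0 :=
  mul_ne_zero (natCast_cpow_ne_zero _) (gammaFactor_ne_zero χ hs)

theorem hasDerivAt_archFactor (χ : DirichletCharacter ℂ q) {s : ℂ} (hs : 0 < s.re) :
    HasDerivAt (archFactor χ) (archFactor χ s * ((Real.log q - Real.log Real.pi : ℝ) / 2 +
      Complex.digamma ((s + parity χ) / 2) / 2)) s := by
  have hpos : 0 < ((s + parity χ) / 2).re := by
    simp only [Complex.div_ofNat_re, Complex.add_re, Complex.ofReal_re]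
    linarith [parity_nonneg χ]
  have h1 : HasDerivAt (fun s : ℂ => (q : ℂ) ^ (s / 2)) ((q : ℂ) ^ (s / 2) * Complex.log q * (1 / 2)) s :=
    ((hasDerivAt_id s).div_const 2).const_cpow (Or.inl (NeZero.ne _))
  have h2 : HasDerivAt (fun s : ℂ => (Real.pi : ℂ) ^ (-(s + parity χ) / 2))
      ((Real.pi : ℂ) ^ (-(s + parity χ) / 2) * Complex.log Real.pi * (-1 / 2)) s :=
    ((((hasDerivAt_id s).add_const _).fun_neg).div_const 2).const_cpow
      (Or.inl (by exact_mod_cast Real.pi_ne_zero))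
  have h3 : HasDerivAt (fun s : ℂ => Complex.Gamma ((s + parity χ) / 2))
      (deriv Complex.Gamma ((s + parity χ) / 2) * (1 / 2)) s :=
    (hasDerivAt_Gamma_of_re_pos hpos).hasDerivAt.comp s
      (((hasDerivAt_id s).add_const (parity χ : ℂ)).div_const 2)
  have h4 : archFactor χ = fun s : ℂ => (q : ℂ) ^ (s / 2) * ((Real.pi : ℂ) ^ (-(s + parity χ) / 2) *
      Complex.Gamma ((s + parity χ) / 2)) := by
    ext s; rw [archFactor, gammaFactor_eq, Complex.Gammaℝ_def]
  rw [h4]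
  refine (h1.fun_mul (h2.fun_mul h3)).congr_deriv ?_
  have hG := Complex.Gamma_ne_zero_of_re_pos hpos
  rw [Complex.digamma_def, logDeriv_apply]
  push_cast
  rw [Complex.ofReal_log Real.pi_pos.le]
  field_simp
  ring

/-- Moving s by 2δ moves the argument of Γ by δ, so the Beta integral comparison applies; the power
of q goes in the favourable direction and that of π costs π^δ. This controls the quotient of shifted
ξ-functions in the Phragmén–Lindelöf argument. -/
theorem exists_norm_archFactor_le {δ : ℝ} (hδ : 0 < δ) (hδ' : δ ≤ 1 / 8) :
    ∃ C : ℝ, 0 ≤ C ∧ ∀ (q : ℕ) [NeZero q] (χ : DirichletCharacter ℂ q) (s : ℂ), 1 / 2 ≤ s.re →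
      ‖archFactor χ (s - δ)‖ ≤ C * ‖archFactor χ (s + δ)‖ := by
  obtain ⟨C, hC0, hC⟩ := exists_norm_Gamma_le_mul_norm_Gamma_add (x₀ := 1 / 8) (by norm_num) hδ
  refine ⟨Real.pi ^ δ * C, by positivity, fun q _ χ s hs => ?_⟩
  have hq : (0 : ℝ) < q := by exact_mod_cast NeZero.pos q
  have hq1 : (1 : ℝ) ≤ q := by exact_mod_cast NeZero.one_le
  have e1 : (s + δ + parity χ) / 2 = (s - δ + parity χ) / 2 + δ := by ring
  have h1 := hC ((s - δ + parity χ) / 2) (by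
    simp only [Complex.div_ofNat_re, Complex.add_re, Complex.sub_re, Complex.ofReal_re]
    linarith [parity_nonneg χ])
  rw [← e1] at h1
  rw [archFactor, archFactor, norm_mul, norm_mul, gammaFactor_eq, gammaFactor_eq,
    Complex.Gammaℝ_def, Complex.Gammaℝ_def, norm_mul, norm_mul,
    Complex.norm_cpow_eq_rpow_re_of_pos Real.pi_pos, Complex.norm_cpow_eq_rpow_re_of_pos Real.pi_pos,
    Complex.norm_natCast_cpow_of_pos (NeZero.pos q), Complex.norm_natCast_cpow_of_pos (NeZero.pos q)]
  have h2 : (q : ℝ) ^ ((s - δ) / 2).re ≤ (q : ℝ) ^ ((s + δ) / 2).re := by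
    refine Real.rpow_le_rpow_of_exponent_le hq1 ?_
    simp only [Complex.div_ofNat_re, Complex.add_re, Complex.sub_re, Complex.ofReal_re]
    linarith
  have h3 : Real.pi ^ (-(s - δ + parity χ) / 2 : ℂ).re =
      Real.pi ^ δ * Real.pi ^ (-(s + δ + parity χ) / 2 : ℂ).re := by
    rw [← Real.rpow_add Real.pi_pos]
    congr 1
    simp only [Complex.div_ofNat_re, Complex.add_re, Complex.sub_re, Complex.ofReal_re,
      Complex.neg_re]
    ring
  rw [h3]
  calc _ ≤ (q : ℝ) ^ ((s + δ) / 2).re * (Real.pi ^ δ * Real.pi ^ (-(s + δ + parity χ) / 2 : ℂ).re *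
        (C * ‖Complex.Gamma ((s + δ + parity χ) / 2)‖)) := by gcongr
    _ = _ := by ring

/-- The logarithmic derivative of the archimedean factor in the strip `1/2 ≤ Re s ≤ 3`. -/
theorem exists_abs_re_logDeriv_archFactor_le : ∃ C : ℝ, 0 ≤ C ∧ ∀ (q : ℕ) [NeZero q]
    (χ : DirichletCharacter ℂ q) (σ t : ℝ), 1 / 2 ≤ σ → σ ≤ 3 →
      |(logDeriv (archFactor χ) ⟨σ, t⟩).re - Real.log (q * (|t| + 3)) / 2| ≤ C := by
  obtain ⟨C, hC⟩ := exists_abs_re_digamma_sub_log_le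
  have hC0 : 0 ≤ C := (abs_nonneg _).trans (hC 1 (by norm_num))
  refine ⟨Real.log Real.pi / 2 + C / 2 + Real.log 16 / 2, by
    have h1 : 0 ≤ Real.log Real.pi := Real.log_nonneg (by linarith [Real.pi_gt_three])
    have h2 : 0 ≤ Real.log 16 := Real.log_nonneg (by norm_num)
    positivity, fun q _ χ σ t h1 h2 => ?_⟩
  have hq : (0 : ℝ) < q := by exact_mod_cast NeZero.pos q
  set s : ℂ := ⟨σ, t⟩
  have hs : 0 < s.re := by simp [s]; linarith
  have h3 : logDeriv (archFactor χ) s = ((Real.log q - Real.log Real.pi : ℝ) / 2 +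
      Complex.digamma ((s + parity χ) / 2) / 2) := by
    rw [logDeriv_apply, (hasDerivAt_archFactor χ hs).deriv]
    exact mul_div_cancel_left₀ _ (archFactor_ne_zero χ hs)
  set z : ℂ := (s + parity χ) / 2 with hz
  have hzre : z.re = (σ + parity χ) / 2 := by
    simp [hz, s]
  have hzim : z.im = t / 2 := by
    simp [hz, s]
  have h4 := hC z (by rw [hzre]; linarith [parity_nonneg χ])
  have h5 : Real.log ‖z‖ ≤ Real.log (|t| + 3) := by
    refine Real.log_le_log (norm_pos_iff.2 fun h => by
      rw [h, Complex.zero_re] at hzre; linarith [parity_nonneg χ]) ?_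
    refine (Complex.norm_le_abs_re_add_abs_im z).trans ?_
    have h0 : 0 ≤ (σ + parity χ) / 2 := by linarith [parity_nonneg χ]
    rw [hzre, hzim, abs_of_nonneg h0, abs_div, abs_two]
    linarith [parity_le_one χ, abs_nonneg t]
  have h6 : Real.log (|t| + 3) ≤ Real.log 16 + Real.log ‖z‖ := by
    have h8 : 1 / 4 ≤ ‖z‖ := le_trans (by rw [hzre]; linarith [parity_nonneg χ]) (Complex.re_le_norm z)
    have h9 : |t| / 2 ≤ ‖z‖ := by
      have := Complex.abs_im_le_norm z
      rwa [hzim, abs_div, abs_two] at this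
    rw [← Real.log_mul (by norm_num) (by positivity)]
    exact Real.log_le_log (by positivity) (by linarith)
  have h7 : 0 ≤ Real.log Real.pi := Real.log_nonneg (by linarith [Real.pi_gt_three])
  rw [h3, Real.log_mul hq.ne' (by positivity)]
  simp only [Complex.add_re, Complex.div_ofNat_re, Complex.ofReal_re]
  rw [abs_le] at h4 ⊢
  constructor <;> linarith [h4.1, h4.2]

theorem completedLFunction_eq {χ : DirichletCharacter ℂ q} {s : ℂ} (hs : 0 < s.re) :
    completedLFunction χ s = gammaFactor χ s * LFunction χ s := by
  rw [LFunction_eq_completed_div_gammaFactor χ s (Or.inl fun h => by simp [h] at hs)]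
  field_simp [gammaFactor_ne_zero χ hs]

theorem norm_completedLFunction_one_sub {χ : DirichletCharacter ℂ q} (hχ : χ.IsPrimitive)
    (hq : 1 < q) {s : ℂ} (hs : 0 < s.re) : ‖completedLFunction χ (1 - s)‖ =
      (q : ℝ) ^ (s.re - 1 / 2) * ‖rootNumber χ‖ * ‖completedLFunction χ ((starRingEnd ℂ) s)‖ := by
  rw [hχ.completedLFunction_one_sub, norm_mul, norm_mul,
    Complex.norm_natCast_cpow_of_pos (NeZero.pos q), completedLFunction_eq hs,
    completedLFunction_eq (by simpa using hs), norm_mul, norm_mul, norm_gammaFactor_conj,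
    gammaFactor_inv, ← conj_LFunction (ne_one_of_isPrimitive hχ hq), Complex.norm_conj]
  simp

/-- The functional equation at 3/4 and at 1/4, composed, multiplies |Λ(3/4)| by the square of the
root number's modulus. As Λ(3/4) ≠ 0, that square is 1; no Gauss sum is evaluated. -/
theorem norm_rootNumber {χ : DirichletCharacter ℂ q} (hχ : χ.IsPrimitive) (hq : 1 < q)
    (hne : ∀ s : ℂ, 1 / 2 < s.re → LFunction χ s ≠ 0) : ‖rootNumber χ‖ = 1 := by
  have h1 := norm_completedLFunction_one_sub hχ hq (s := (3 / 4 : ℝ)) (by simp)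
  have h2 := norm_completedLFunction_one_sub hχ hq (s := (1 / 4 : ℝ)) (by simp)
  have e1 : (1 : ℂ) - ((3 / 4 : ℝ) : ℂ) = ((1 / 4 : ℝ) : ℂ) := by push_cast; norm_num
  have e2 : (1 : ℂ) - ((1 / 4 : ℝ) : ℂ) = ((3 / 4 : ℝ) : ℂ) := by push_cast; norm_num
  rw [e1, Complex.conj_ofReal] at h1
  rw [e2, Complex.conj_ofReal, h1] at h2
  have hq0 : (0 : ℝ) < q := by exact_mod_cast NeZero.pos q
  have h3 : completedLFunction χ ((3 / 4 : ℝ) : ℂ) ≠ 0 := by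
    rw [completedLFunction_eq (by simp)]
    exact mul_ne_zero (gammaFactor_ne_zero χ (by simp)) (hne _ (by simp; norm_num))
  have h4 : (q : ℝ) ^ ((1 / 4 : ℝ) - 1 / 2) * (q : ℝ) ^ ((3 / 4 : ℝ) - 1 / 2) = 1 := by
    rw [← Real.rpow_add hq0]; norm_num
  simp only [Complex.ofReal_re] at h2
  have h5 : ‖rootNumber χ‖ ^ 2 = 1 := by
    have h6 := norm_ne_zero_iff.2 h3
    refine mul_right_cancel₀ h6 ?_
    calc _ = (q : ℝ) ^ ((1 / 4 : ℝ) - 1 / 2) * (q : ℝ) ^ ((3 / 4 : ℝ) - 1 / 2) *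
          ‖rootNumber χ‖ ^ 2 * ‖completedLFunction χ ((3 / 4 : ℝ) : ℂ)‖ := by rw [h4, one_mul]
      _ = 1 * ‖completedLFunction χ ((3 / 4 : ℝ) : ℂ)‖ := by
          rw [one_mul]; conv_rhs => rw [h2]
          ring
  exact (pow_eq_one_iff_of_nonneg (norm_nonneg _) two_ne_zero).1 h5

/-- The functional equation preserves the modulus of the completed `L`-function. -/
theorem norm_xi_one_sub_conj {χ : DirichletCharacter ℂ q} (hχ : χ.IsPrimitive) (hq : 1 < q)
    (hne : ∀ s : ℂ, 1 / 2 < s.re → LFunction χ s ≠ 0) {s : ℂ} (hs : 0 < s.re) (hs' : s.re < 1) :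
    ‖xi χ (1 - (starRingEnd ℂ) s)‖ = ‖xi χ s‖ := by
  have hq0 : (0 : ℝ) < q := by exact_mod_cast NeZero.pos q
  have h := norm_completedLFunction_one_sub hχ hq (s := (starRingEnd ℂ) s) (by simpa using hs)
  rw [norm_rootNumber hχ hq hne, mul_one, Complex.conj_conj] at h
  have e : ∀ z : ℂ, 0 < z.re → ‖xi χ z‖ = (q : ℝ) ^ (z.re / 2) * ‖completedLFunction χ z‖ := by
    intro z hz
    rw [xi, archFactor, mul_assoc, ← completedLFunction_eq hz, norm_mul,
      Complex.norm_natCast_cpow_of_pos (NeZero.pos q)]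
    simp
  rw [e _ (by simpa using hs'), e _ hs, h, ← mul_assoc, ← Real.rpow_add hq0]
  congr 2
  simp
  ring

theorem hasDerivAt_xi {χ : DirichletCharacter ℂ q} (hχ : χ ≠ 1) {s : ℂ} (hs : 0 < s.re) :
    HasDerivAt (xi χ) (deriv (archFactor χ) s * LFunction χ s + archFactor χ s * deriv (LFunction χ) s)
      s :=
  (hasDerivAt_archFactor χ hs).differentiableAt.hasDerivAt.mul
    (differentiable_LFunction hχ s).hasDerivAt

/-! ### Borel–Carathéodory for log L, and monotonicity of |ξ| -/

namespace IsLogL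

variable {χ : DirichletCharacter ℂ q} {ℓ : ℂ → ℂ}

theorem re_eq (h : IsLogL χ ℓ) {s : ℂ} (hs : 1 / 2 < s.re) :
    (ℓ s).re = Real.log ‖LFunction χ s‖ := by
  rw [← h.exp_eq s hs, Complex.norm_exp, Real.log_exp]

theorem ne_zero (h : IsLogL χ ℓ) {s : ℂ} (hs : 1 / 2 < s.re) : LFunction χ s ≠ 0 := by
  rw [← h.exp_eq s hs]; exact Complex.exp_ne_zero _

theorem differentiableOn (h : IsLogL χ ℓ) : DifferentiableOn ℂ ℓ {s : ℂ | 1 / 2 < s.re} :=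
  fun s hs => (h.hasDerivAt s hs).differentiableAt.differentiableWithinAt

theorem norm_le_one (h : IsLogL χ ℓ) {s : ℂ} (hs : 2 ≤ s.re) : ‖ℓ s‖ ≤ 1 :=
  (h.norm_le_two_rpow s hs).trans (Real.rpow_le_one_of_one_le_of_nonpos one_le_two (by linarith))

/-- The Borel–Carathéodory bound for `log L(s, χ)` to the right of the critical line. -/
theorem norm_le_log (h : IsLogL χ ℓ) (hχ : χ ≠ 1) (hq : 1 < q) {δ : ℝ} (hδ : 0 < δ) (hδ' : δ ≤ 1)
    {s : ℂ} (hs : 1 / 2 + δ ≤ s.re) : ‖ℓ s‖ ≤ 12 / δ * Real.log (q * (|s.im| + 3)) := by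
  have hq' : (2 : ℝ) ≤ q := by exact_mod_cast hq
  set X := Real.log (q * (|s.im| + 3)) with hX
  have hX1 : 1 ≤ X := one_le_log hq _
  have h12 : 12 ≤ 12 / δ := by rw [le_div_iff₀ hδ]; linarith
  rcases le_or_gt 2 s.re with h2 | h2
  · calc ‖ℓ s‖ ≤ 1 := h.norm_le_one h2
      _ ≤ 12 / δ * X := by nlinarith
  -- The disc of radius 3/2 about 2 + it is tangent to the critical line. On it partial summation
  -- gives log |L| ≤ 3X, and s lies at distance at least δ from its boundary circle.
  · set c : ℂ := ⟨2, s.im⟩ with hc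
    have hre : ∀ w ∈ Metric.ball (0 : ℂ) (3 / 2), 1 / 2 < (c + w).re := by
      intro w hw
      have h1 : ‖w‖ < 3 / 2 := by simpa using hw
      have := (abs_le.1 (Complex.abs_re_le_norm w)).1
      simp [hc]
      linarith
    have hd : DifferentiableOn ℂ (fun w => ℓ (c + w)) (Metric.ball 0 (3 / 2)) :=
      h.differentiableOn.comp (by fun_prop) hre
    have hz : s - c ∈ Metric.ball (0 : ℂ) (3 / 2) := by
      have : s - c = ((s.re - 2 : ℝ) : ℂ) := by apply Complex.ext <;> simp [hc]
      rw [mem_ball_zero_iff, this, Complex.norm_real, Real.norm_eq_abs, abs_lt]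
      constructor <;> linarith
    have hnorm : ‖s - c‖ = 2 - s.re := by
      have : s - c = ((s.re - 2 : ℝ) : ℂ) := by apply Complex.ext <;> simp [hc]
      rw [this, Complex.norm_real, Real.norm_of_nonpos (by linarith)]
      ring
    have key := Complex.borelCaratheodory (M := 3 * X) (by linarith) hd (fun w hw => ?_)
      (by norm_num) hz
    · have e : c + (s - c) = s := by ring
      simp only [e, hnorm, add_zero] at key
      have hc1 : ‖ℓ c‖ ≤ 1 := h.norm_le_one le_rfl
      have hD : δ ≤ 3 / 2 - (2 - s.re) := by linarith
      refine key.trans ?_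
      calc 2 * (3 * X) * (2 - s.re) / (3 / 2 - (2 - s.re)) +
            ‖ℓ c‖ * (3 / 2 + (2 - s.re)) / (3 / 2 - (2 - s.re))
          ≤ 2 * (3 * X) * (3 / 2) / δ + 1 * 3 / δ := by
            gcongr
            · linarith
            · linarith
        _ = (9 * X + 3) / δ := by ring
        _ ≤ (12 * X) / δ := by gcongr; linarith
        _ = 12 / δ * X := by ring
    · have h1 := hre w hw
      have hw' : ‖w‖ < 3 / 2 := by simpa using hw
      simp only [Set.mem_ofPred_eq]
      rw [h.re_eq h1]
      have h2 : ‖LFunction χ (c + w)‖ ≤ 4 * (q * (|s.im| + 3)) := by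
        refine (norm_LFunction_le hχ hq (by linarith)).trans ?_
        have h3 : ‖c + w‖ ≤ 2 + |s.im| + 3 / 2 := by
          refine (norm_add_le _ _).trans ?_
          have := Complex.norm_le_abs_re_add_abs_im c
          simp [hc] at this
          linarith
        calc ‖c + w‖ * (q / (c + w).re) ≤ (2 + |s.im| + 3 / 2) * (q / (1 / 2)) := by gcongr
          _ ≤ _ := by nlinarith [abs_nonneg s.im]
      calc Real.log ‖LFunction χ (c + w)‖ ≤ Real.log (4 * (q * (|s.im| + 3))) :=
            Real.log_le_log (norm_pos_iff.2 (h.ne_zero h1)) h2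
        _ ≤ Real.log ((q * (|s.im| + 3)) ^ 3) := by
            refine Real.log_le_log (by positivity) ?_
            set y := (q : ℝ) * (|s.im| + 3)
            have : 6 ≤ y := by simp only [y]; nlinarith [abs_nonneg s.im]
            nlinarith [mul_nonneg (by linarith : 0 ≤ y) (by nlinarith : 0 ≤ y ^ 2 - 4)]
        _ = 3 * X := by rw [Real.log_pow, hX]; norm_num

end IsLogL

end DirichletCharacter

namespace DirichletCharacter

variable {q : ℕ} [NeZero q]

/-- The logarithmic derivative of the completed `L`-function. -/
noncomputable def logDerivXi (χ : DirichletCharacter ℂ q) (s : ℂ) : ℂ :=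
  deriv (LFunction χ) s / LFunction χ s + logDeriv (archFactor χ) s

theorem differentiableOn_logDerivXi {χ : DirichletCharacter ℂ q} (hχ : χ ≠ 1)
    (hne : ∀ s : ℂ, 1 / 2 < s.re → LFunction χ s ≠ 0) :
    DifferentiableOn ℂ (logDerivXi χ) {s : ℂ | 1 / 2 < s.re} := by
  have hopen : IsOpen {s : ℂ | 1 / 2 < s.re} := isOpen_lt continuous_const Complex.continuous_re
  have hL := differentiable_LFunction hχ
  have hA : DifferentiableOn ℂ (archFactor χ) {s : ℂ | 1 / 2 < s.re} := fun s hs =>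
    (hasDerivAt_archFactor χ (by linarith [show 1 / 2 < s.re from hs])).differentiableAt.differentiableWithinAt
  exact ((hL.differentiableOn.deriv hopen).div hL.differentiableOn fun s hs => hne s hs).add
    ((hA.deriv hopen).div hA fun s hs => archFactor_ne_zero χ (by linarith [show 1 / 2 < s.re from hs]))

namespace IsLogL

variable {χ : DirichletCharacter ℂ q} {ℓ : ℂ → ℂ}

/-- For Re s = 1/2 the points s - δ and s + δ are mirror images in the critical line, so the two
moduli agree there. The quotient is holomorphic to the right because the denominator stays where ξ ≠
0, and Phragmén–Lindelöf in the half-plane finishes. -/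
theorem norm_xi_sub_le_norm_xi_add (h : IsLogL χ ℓ) (hχ : χ.IsPrimitive) (hq : 1 < q) {δ : ℝ}
    (hδ : 0 < δ) (hδ' : δ ≤ 1 / 8) {s : ℂ} (hs : 1 / 2 ≤ s.re) :
    ‖xi χ (s - δ)‖ ≤ ‖xi χ (s + δ)‖ := by
  have hχ1 := ne_one_of_isPrimitive hχ hq
  have hq0 : (0 : ℝ) < q := by exact_mod_cast NeZero.pos q
  obtain ⟨C, hC0, hC⟩ := exists_norm_archFactor_le hδ hδ'
  have hne : ∀ z : ℂ, 1 / 2 < z.re → xi χ z ≠ 0 := fun z hz =>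
    mul_ne_zero (archFactor_ne_zero χ (by linarith)) (h.ne_zero hz)
  set G : ℂ → ℂ := fun z => xi χ (z + 1 / 2 - δ) / xi χ (z + 1 / 2 + δ) with hG
  have hre1 : ∀ z : ℂ, (z + 1 / 2 - δ).re = z.re + 1 / 2 - δ := fun z => by simp
  have hre2 : ∀ z : ℂ, (z + 1 / 2 + δ).re = z.re + 1 / 2 + δ := fun z => by simp
  have hGd : DifferentiableOn ℂ G {z : ℂ | 0 ≤ z.re} := by
    intro z hz
    have hz : 0 ≤ z.re := hz
    have h1 : DifferentiableAt ℂ (fun z => xi χ (z + 1 / 2 - δ)) z :=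
      DifferentiableAt.comp (g := xi χ) (f := fun z : ℂ => z + 1 / 2 - δ) z
        (hasDerivAt_xi hχ1 (by rw [hre1]; linarith)).differentiableAt (by fun_prop)
    have h2 : DifferentiableAt ℂ (fun z => xi χ (z + 1 / 2 + δ)) z :=
      DifferentiableAt.comp (g := xi χ) (f := fun z : ℂ => z + 1 / 2 + δ) z
        (hasDerivAt_xi hχ1 (by rw [hre2]; linarith)).differentiableAt (by fun_prop)
    exact (h1.div h2 (hne _ (by rw [hre2]; linarith))).differentiableWithinAt
  have hbound : ∀ z : ℂ, 0 ≤ z.re → ‖G z‖ ≤ C * (‖LFunction χ (z + 1 / 2 - δ)‖ *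
      Real.exp ‖ℓ (z + 1 / 2 + δ)‖) := by
    intro z hz
    have hz2 : 1 / 2 < (z + 1 / 2 + δ).re := by rw [hre2]; linarith
    have ha := norm_pos_iff.2 (archFactor_ne_zero χ (s := z + 1 / 2 + δ) (by linarith))
    have hl := norm_pos_iff.2 (h.ne_zero hz2)
    have h1 := hC q χ (z + 1 / 2) (by simpa using hz)
    have h2 : 1 ≤ ‖LFunction χ (z + 1 / 2 + δ)‖ * Real.exp ‖ℓ (z + 1 / 2 + δ)‖ := by
      rw [← h.exp_eq _ hz2, Complex.norm_exp, ← Real.exp_add]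
      refine Real.one_le_exp ?_
      linarith [(abs_le.1 (Complex.abs_re_le_norm (ℓ (z + 1 / 2 + δ)))).1]
    simp only [hG, xi]
    rw [norm_div, norm_mul, norm_mul, div_le_iff₀ (mul_pos ha hl)]
    calc ‖archFactor χ (z + 1 / 2 - δ)‖ * ‖LFunction χ (z + 1 / 2 - δ)‖
        ≤ (C * ‖archFactor χ (z + 1 / 2 + δ)‖) * ‖LFunction χ (z + 1 / 2 - δ)‖ * 1 := by
          rw [mul_one]; gcongr
      _ ≤ (C * ‖archFactor χ (z + 1 / 2 + δ)‖) * ‖LFunction χ (z + 1 / 2 - δ)‖ *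
          (‖LFunction χ (z + 1 / 2 + δ)‖ * Real.exp ‖ℓ (z + 1 / 2 + δ)‖) := by gcongr
      _ = _ := by ring
  have key : ‖G (s - 1 / 2)‖ ≤ 1 := by
    refine PhragmenLindelof.right_half_plane_of_bounded_on_real ?_ ?_ ?_ ?_ (by simpa using hs)
    · refine DifferentiableOn.diffContOnCl (hGd.mono ?_)
      rw [Complex.closure_setOfPred_lt_re]
    -- Growth of order 1 is below the critical order 2 of a half-plane argument with boundedness
    -- along the real axis. The reciprocal of L is controlled by exp |ℓ|, where |ℓ| grows at most
    -- linearly.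
    · refine ⟨1, by norm_num, 1 + 12 / δ * q, ?_⟩
      refine Asymptotics.IsBigO.of_bound (C * (4 * q * Real.exp (12 / δ * (q * 4)))) ?_
      rw [eventually_inf_principal]
      refine Eventually.of_forall fun z hz => ?_
      have hz : 0 < z.re := hz
      refine (hbound z hz.le).trans ?_
      have h1 : ‖LFunction χ (z + 1 / 2 - δ)‖ ≤ 4 * q * Real.exp ‖z‖ := by
        refine (norm_LFunction_le hχ1 hq (by rw [hre1]; linarith)).trans ?_
        have h2 : ‖z + 1 / 2 - δ‖ ≤ Real.exp ‖z‖ := by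
          have h3 : ‖(1 / 2 - δ : ℂ)‖ ≤ 1 := by
            rw [show (1 / 2 - δ : ℂ) = ((1 / 2 - δ : ℝ) : ℂ) by push_cast; rfl, Complex.norm_real,
              Real.norm_eq_abs, abs_le]
            constructor <;> linarith
          rw [add_sub_assoc]
          linarith [norm_add_le z (1 / 2 - δ), Real.add_one_le_exp ‖z‖]
        have h4 : (q : ℝ) / (z + 1 / 2 - δ).re ≤ 4 * q := by
          rw [hre1, div_le_iff₀ (by linarith)]
          nlinarith
        calc _ ≤ Real.exp ‖z‖ * (4 * q) :=
              mul_le_mul h2 h4 (div_nonneg hq0.le (by rw [hre1]; linarith)) (Real.exp_pos _).le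
          _ = _ := by ring
      have h2 : ‖ℓ (z + 1 / 2 + δ)‖ ≤ 12 / δ * (q * (‖z‖ + 4)) := by
        refine (h.norm_le_log hχ1 hq hδ (by linarith) (by rw [hre2]; linarith)).trans ?_
        gcongr
        have him : (z + 1 / 2 + δ).im = z.im := by simp
        rw [him]
        refine (Real.log_le_sub_one_of_pos (by positivity)).trans ?_
        have := Complex.abs_im_le_norm z
        nlinarith
      rw [Real.rpow_one, Real.norm_of_nonneg (Real.exp_pos _).le]
      calc C * (‖LFunction χ (z + 1 / 2 - δ)‖ * Real.exp ‖ℓ (z + 1 / 2 + δ)‖)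
          ≤ C * (4 * q * Real.exp ‖z‖ * Real.exp (12 / δ * (q * (‖z‖ + 4)))) := by gcongr
        _ = C * (4 * q * (Real.exp (12 / δ * (q * 4)) * Real.exp ((1 + 12 / δ * q) * ‖z‖))) := by
            rw [← Real.exp_add, mul_assoc, ← Real.exp_add]
            ring_nf
        _ = _ := by ring
    · refine ⟨C * (Real.exp 1 * Real.exp 1), ?_⟩
      rw [eventually_map]
      filter_upwards [eventually_ge_atTop 2] with x hx
      have hx0 : 0 ≤ (x : ℂ).re := by simp; linarith
      refine (hbound x hx0).trans ?_
      have h1 : 2 ≤ ((x : ℂ) + 1 / 2 - δ).re := by rw [hre1]; simp; linarith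
      have h2 : 2 ≤ ((x : ℂ) + 1 / 2 + δ).re := by rw [hre2]; simp; linarith
      rw [← h.exp_eq _ (by linarith : 1 / 2 < ((x : ℂ) + 1 / 2 - δ).re), Complex.norm_exp]
      gcongr
      · exact (Complex.re_le_norm _).trans (h.norm_le_one h1)
      · exact h.norm_le_one h2
    · intro x
      have e1 : (x : ℂ) * Complex.I + 1 / 2 - δ =
          1 - (starRingEnd ℂ) ((x : ℂ) * Complex.I + 1 / 2 + δ) := by
        apply Complex.ext <;> simp
        ring
      simp only [hG]
      rw [e1, norm_div, norm_xi_one_sub_conj hχ hq (fun z hz => h.ne_zero hz)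
        (by rw [hre2]; simp; linarith) (by rw [hre2]; simp; linarith)]
      exact div_self_le_one _
  have e : s - 1 / 2 + 1 / 2 = s := by ring
  simp only [hG, e] at key
  rw [norm_div] at key
  exact (div_le_one (norm_pos_iff.2 (hne _ (by simp; linarith)))).1 key

/-- The completed `L`-function increases in modulus to the right of the critical line. -/
theorem re_logDerivXi_nonneg (h : IsLogL χ ℓ) (hχ : χ.IsPrimitive) (hq : 1 < q) {s : ℂ}
    (hs : 1 / 2 < s.re) : 0 ≤ (logDerivXi χ s).re := by
  have hχ1 := ne_one_of_isPrimitive hχ hq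
  have hne : ∀ z : ℂ, 1 / 2 < z.re → xi χ z ≠ 0 := fun z hz =>
    mul_ne_zero (archFactor_ne_zero χ (by linarith)) (h.ne_zero hz)
  have h1 := hasDerivAt_log_norm_horizontal (σ := s.re) (t := s.im)
    (hasDerivAt_xi hχ1 (s := s) (by linarith)) (hne s hs)
  have e : (deriv (archFactor χ) s * LFunction χ s + archFactor χ s * deriv (LFunction χ) s) / xi χ s =
      logDerivXi χ s := by
    have := h.ne_zero hs
    have := archFactor_ne_zero χ (s := s) (by linarith)
    rw [xi, logDerivXi, logDeriv_apply]
    field_simp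
    ring
  rw [show (⟨s.re, s.im⟩ : ℂ) = s from rfl, e] at h1
  set φ : ℝ → ℝ := fun x => Real.log ‖xi χ ⟨x, s.im⟩‖
  have h2 : HasDerivAt (fun δ : ℝ => φ (s.re + δ)) (logDerivXi χ s).re 0 := by
    have : HasDerivAt φ (logDerivXi χ s).re (s.re + 0) := by simpa using h1
    exact this.comp_const_add s.re 0
  have h3 : HasDerivAt (fun δ : ℝ => φ (s.re - δ)) (-(logDerivXi χ s).re) 0 := by
    have : HasDerivAt φ (logDerivXi χ s).re (s.re - 0) := by simpa using h1
    exact this.comp_const_sub s.re 0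
  -- The symmetric difference of log |ξ| has derivative 2 Re ξ'/ξ at δ = 0, and its right difference
  -- quotients are nonnegative.
  have h4 := (h2.sub h3).tendsto_slope_zero_right
  have h5 : 0 ≤ (logDerivXi χ s).re - -(logDerivXi χ s).re := by
    refine ge_of_tendsto h4 ?_
    have hmem : Set.Ioo (0 : ℝ) (min (1 / 8) (s.re - 1 / 2)) ∈ 𝓝[>] (0 : ℝ) :=
      Ioo_mem_nhdsGT (lt_min (by norm_num) (by linarith))
    filter_upwards [hmem] with δ hδ
    have hδ1 : δ ≤ 1 / 8 := hδ.2.le.trans (min_le_left _ _)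
    have hδ2 : δ < s.re - 1 / 2 := hδ.2.trans_le (min_le_right _ _)
    have h6 := h.norm_xi_sub_le_norm_xi_add hχ hq hδ.1 hδ1 hs.le
    have e1 : (⟨s.re - δ, s.im⟩ : ℂ) = s - δ := by apply Complex.ext <;> simp
    have e2 : (⟨s.re + δ, s.im⟩ : ℂ) = s + δ := by apply Complex.ext <;> simp
    simp only [Pi.sub_apply, zero_add, add_zero, sub_zero, sub_self, smul_eq_mul, φ, e1, e2]
    refine mul_nonneg (inv_nonneg.2 hδ.1.le) (sub_nonneg.2 ?_)
    exact Real.log_le_log (norm_pos_iff.2 (hne _ (by simp; linarith))) h6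
  linarith

end IsLogL

end DirichletCharacter

/-! ### Weights on vertical lines and a localized three lines theorem -/

/-- A slowly growing weight on vertical lines, centred at height `T`. -/
noncomputable def logWeight (A T t : ℝ) : ℝ := A + Real.log (1 + |t - T|)

theorem log_one_add_abs_nonneg (x : ℝ) : 0 ≤ Real.log (1 + |x|) :=
  Real.log_nonneg (by linarith [abs_nonneg x])

theorem le_logWeight (A T t : ℝ) : A ≤ logWeight A T t := by
  unfold logWeight; linarith [log_one_add_abs_nonneg (t - T)]

theorem logWeight_add_le (A T t x : ℝ) : logWeight A T (t + x) ≤ logWeight A T t + |x| := by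
  unfold logWeight
  have h1 : 1 + |t + x - T| ≤ (1 + |t - T|) * (1 + |x|) := by
    have : |t + x - T| ≤ |t - T| + |x| := by
      rw [show t + x - T = (t - T) + x by ring]; exact abs_add_le _ _
    nlinarith [mul_nonneg (abs_nonneg (t - T)) (abs_nonneg x)]
  have h2 := Real.log_le_log (by positivity) h1
  rw [Real.log_mul (by positivity) (by positivity)] at h2
  have h3 := Real.log_le_sub_one_of_pos (show 0 < 1 + |x| by positivity)
  linarith

/-- Lets a Gaussian factor replace the weight at any height by the weight at the height of interest.
-/
theorem exp_neg_sq_mul_logWeight_le {A : ℝ} (hA : 0 ≤ A) (T t x : ℝ) :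
    Real.exp (-x ^ 2) * logWeight A T (t + x) ≤ logWeight A T t + 1 := by
  have h1 := logWeight_add_le A T t x
  have h0 : 0 ≤ logWeight A T t := hA.trans (le_logWeight A T t)
  have h2 : Real.exp (-x ^ 2) ≤ 1 := Real.exp_le_one_iff.2 (by nlinarith [sq_nonneg x])
  have h3 : Real.exp (-x ^ 2) * |x| ≤ 1 := by
    rw [Real.exp_neg, inv_mul_le_iff₀ (Real.exp_pos _), mul_one, ← sq_abs]
    nlinarith [Real.add_one_le_exp (|x| ^ 2), sq_nonneg (|x| - 1)]
  calc Real.exp (-x ^ 2) * logWeight A T (t + x)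
      ≤ Real.exp (-x ^ 2) * (logWeight A T t + |x|) := by gcongr
    _ = Real.exp (-x ^ 2) * logWeight A T t + Real.exp (-x ^ 2) * |x| := by ring
    _ ≤ 1 * logWeight A T t + 1 := by gcongr
    _ = _ := by ring

/-- A localized three lines theorem: exponential decay away from the left edge of a strip. -/
theorem norm_le_of_logWeight_bounds {f : ℂ → ℂ} {σL σR A T A₀ α β B y : ℝ} (hA : 0 ≤ A)
    (hα : 0 ≤ α) (hβ : 0 ≤ β) (hA₀ : 0 ≤ A₀) (hB : 0 ≤ B) (hy : 0 ≤ y) (hLR1 : σR - σL ≤ 1)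
    (hf : DiffContOnCl ℂ f (Complex.re ⁻¹' Set.Ioo σL σR))
    (hgrow : ∀ s : ℂ, σL < s.re → s.re < σR → ‖f s‖ ≤ A₀ * logWeight A T s.im)
    (hL : ∀ s : ℂ, s.re = σL → ‖f s‖ ≤ α * logWeight A T s.im + β)
    (hR : ∀ s : ℂ, s.re = σR → ‖f s‖ ≤ B) {s₀ : ℂ} (h₁ : σL ≤ s₀.re) (h₂ : s₀.re ≤ σR) :
    ‖f s₀‖ ≤ Real.exp (-y * (s₀.re - σL)) * (α * (logWeight A T s₀.im + 1) + β) +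
      Real.exp 2 * Real.exp (y * (σR - s₀.re)) * B := by
  -- The multiplier is 1 at s₀. The square gives Gaussian decay vertically, and the linear term
  -- trades the two edges against each other at rate y. The extra 1 in y + 1 absorbs the real part
  -- of the square on the left edge, because x² + x ≤ 0 for -1 ≤ x ≤ 0.
  set F : ℂ → ℂ := fun s => f s * Complex.exp ((s - s₀) ^ 2 + (y + 1 : ℝ) * (s - s₀)) with hF
  have hexp : ∀ s : ℂ, ‖Complex.exp ((s - s₀) ^ 2 + (y + 1 : ℝ) * (s - s₀))‖ =
      Real.exp ((s.re - s₀.re) ^ 2 + (y + 1) * (s.re - s₀.re)) *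
        Real.exp (-(s.im - s₀.im) ^ 2) := by
    intro s
    rw [Complex.norm_exp, ← Real.exp_add]
    congr 1
    simp [sq]
    ring
  have hw : ∀ s : ℂ, Real.exp (-(s.im - s₀.im) ^ 2) * logWeight A T s.im ≤
      logWeight A T s₀.im + 1 := by
    intro s
    have := exp_neg_sq_mul_logWeight_le hA T s₀.im (s.im - s₀.im)
    rwa [add_sub_cancel] at this
  have hw0 : 0 ≤ logWeight A T s₀.im := hA.trans (le_logWeight A T _)
  set E₁ := Real.exp (-y * (s₀.re - σL)) * (α * (logWeight A T s₀.im + 1) + β) with hE₁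
  set E₂ := Real.exp 2 * Real.exp (y * (σR - s₀.re)) * B with hE₂
  have hE₁0 : 0 ≤ E₁ := by positivity
  have hE₂0 : 0 ≤ E₂ := by positivity
  have hle1 : ∀ s : ℂ, Real.exp (-(s.im - s₀.im) ^ 2) ≤ 1 := fun s =>
    Real.exp_le_one_iff.2 (by nlinarith [sq_nonneg (s.im - s₀.im)])
  have key : ‖F s₀‖ ≤ E₁ + E₂ := by
    refine PhragmenLindelof.vertical_strip (f := F) ?_ ?_ ?_ ?_ h₁ h₂
    · have : Differentiable ℂ fun s : ℂ => Complex.exp ((s - s₀) ^ 2 + (y + 1 : ℝ) * (s - s₀)) := by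
        fun_prop
      exact hf.smul this.diffContOnCl
    · rcases le_or_gt σR σL with hle | hlt
      · have : Complex.re ⁻¹' Set.Ioo σL σR = ∅ := by
          rw [Set.Ioo_eq_empty (not_lt.2 hle), Set.preimage_empty]
        refine ⟨Real.pi / (σR - σL) - 1, by linarith, 0, ?_⟩
        rw [this, principal_empty, inf_bot_eq]
        exact Asymptotics.IsBigO.of_bound 0 eventually_bot
      · refine ⟨0, by have := sub_pos.2 hlt; positivity, 0, ?_⟩
        refine Asymptotics.IsBigO.of_bound
          (A₀ * Real.exp (1 + (y + 1)) * (logWeight A T s₀.im + 1)) ?_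
        rw [eventually_inf_principal]
        refine Eventually.of_forall fun s hs => ?_
        have hs1 : σL < s.re := hs.1
        have hs2 : s.re < σR := hs.2
        have hx : |s.re - s₀.re| ≤ 1 := by rw [abs_le]; constructor <;> linarith
        have h3 : (s.re - s₀.re) ^ 2 + (y + 1) * (s.re - s₀.re) ≤ 1 + (y + 1) := by
          have h4 : (s.re - s₀.re) ^ 2 ≤ 1 := by rw [← sq_abs]; nlinarith [abs_nonneg (s.re - s₀.re)]
          nlinarith [le_abs_self (s.re - s₀.re)]
        simp only [hF, norm_mul, hexp]
        simp only [zero_mul, Real.exp_zero, norm_one, mul_one]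
        calc ‖f s‖ * (Real.exp ((s.re - s₀.re) ^ 2 + (y + 1) * (s.re - s₀.re)) *
              Real.exp (-(s.im - s₀.im) ^ 2))
            ≤ (A₀ * logWeight A T s.im) * (Real.exp (1 + (y + 1)) *
              Real.exp (-(s.im - s₀.im) ^ 2)) := by
              gcongr
              · exact mul_nonneg hA₀ (hA.trans (le_logWeight A T _))
              · exact hgrow s hs1 hs2
          _ = A₀ * Real.exp (1 + (y + 1)) *
              (Real.exp (-(s.im - s₀.im) ^ 2) * logWeight A T s.im) := by ring
          _ ≤ _ := by gcongr; exact hw s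
    · intro s hs
      have h3 : (s.re - s₀.re) ^ 2 + (y + 1) * (s.re - s₀.re) ≤ -y * (s₀.re - σL) := by
        rw [hs]; nlinarith
      simp only [hF, norm_mul, hexp]
      calc ‖f s‖ * (Real.exp ((s.re - s₀.re) ^ 2 + (y + 1) * (s.re - s₀.re)) *
            Real.exp (-(s.im - s₀.im) ^ 2))
          ≤ (α * logWeight A T s.im + β) * (Real.exp (-y * (s₀.re - σL)) *
            Real.exp (-(s.im - s₀.im) ^ 2)) := by
            gcongr
            · exact (norm_nonneg _).trans (hL s hs)
            · exact hL s hs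
        _ = Real.exp (-y * (s₀.re - σL)) *
            (α * (Real.exp (-(s.im - s₀.im) ^ 2) * logWeight A T s.im) +
              β * Real.exp (-(s.im - s₀.im) ^ 2)) := by ring
        _ ≤ Real.exp (-y * (s₀.re - σL)) * (α * (logWeight A T s₀.im + 1) + β * 1) := by
            gcongr
            · exact hw s
            · exact hle1 s
        _ = E₁ := by rw [hE₁, mul_one]
        _ ≤ E₁ + E₂ := by linarith
    · intro s hs
      have h3 : (s.re - s₀.re) ^ 2 + (y + 1) * (s.re - s₀.re) ≤ 2 + y * (σR - s₀.re) := by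
        rw [hs]; nlinarith
      simp only [hF, norm_mul, hexp]
      calc ‖f s‖ * (Real.exp ((s.re - s₀.re) ^ 2 + (y + 1) * (s.re - s₀.re)) *
            Real.exp (-(s.im - s₀.im) ^ 2))
          ≤ B * (Real.exp (2 + y * (σR - s₀.re)) * 1) := by
            gcongr
            · exact hR s hs
            · exact hle1 s
        _ = E₂ := by rw [hE₂, Real.exp_add]; ring
        _ ≤ E₁ + E₂ := by linarith
  simpa [hF] using key

/-! ### The self-improving bound for log L at distance 2/M from the critical line -/

namespace DirichletCharacter

variable {q : ℕ} [NeZero q]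

/-- The archimedean factor of `χ` has logarithmic derivative `½ log (q(|t| + 3))`, up to an error
of at most `C`. -/
def ArchBound (χ : DirichletCharacter ℂ q) (C : ℝ) : Prop :=
  ∀ σ t : ℝ, 1 / 2 ≤ σ → σ ≤ 3 →
    |(logDeriv (archFactor χ) ⟨σ, t⟩).re - Real.log (q * (|t| + 3)) / 2| ≤ C

namespace IsLogL

variable {χ : DirichletCharacter ℂ q} {ℓ : ℂ → ℂ} {C : ℝ}

theorem hasDerivAt_re (h : IsLogL χ ℓ) {σ t : ℝ} (hσ : 1 / 2 < σ) :
    HasDerivAt (fun x : ℝ => (ℓ ⟨x, t⟩).re)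
      ((logDerivXi χ ⟨σ, t⟩).re - (logDeriv (archFactor χ) ⟨σ, t⟩).re) σ := by
  refine (hasDerivAt_re_horizontal (h.hasDerivAt ⟨σ, t⟩ hσ)).congr_deriv ?_
  rw [logDerivXi, Complex.add_re]; ring

/-- The σ-derivative of log |L| is Re ξ'/ξ ≥ 0 minus the archimedean part, hence bounded below. -/
theorem re_le_re_add (h : IsLogL χ ℓ) (hχ : χ.IsPrimitive) (hq : 1 < q) (hC : ArchBound χ C)
    {σ σ' t : ℝ} (hσ : 1 / 2 < σ) (hσσ' : σ ≤ σ') (hσ' : σ' ≤ 3) :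
    (ℓ ⟨σ, t⟩).re ≤ (ℓ ⟨σ', t⟩).re + (σ' - σ) * (Real.log (q * (|t| + 3)) / 2 + C) := by
  set B := Real.log (q * (|t| + 3)) / 2 + C
  have hd : ∀ x ∈ Set.Icc σ σ', HasDerivAt (fun x : ℝ => (ℓ ⟨x, t⟩).re + x * B)
      ((logDerivXi χ ⟨x, t⟩).re - (logDeriv (archFactor χ) ⟨x, t⟩).re + 1 * B) x := fun x hx =>
    (h.hasDerivAt_re (by linarith [hx.1])).add ((hasDerivAt_id x).mul_const B)
  have hmono : MonotoneOn (fun x : ℝ => (ℓ ⟨x, t⟩).re + x * B) (Set.Icc σ σ') := by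
    refine monotoneOn_of_deriv_nonneg (convex_Icc _ _)
      (fun x hx => (hd x hx).continuousAt.continuousWithinAt)
      (fun x hx => (hd x (interior_subset hx)).differentiableAt.differentiableWithinAt)
      (fun x hx => ?_)
    have hx := interior_subset hx
    rw [(hd x hx).deriv]
    have h1 := h.re_logDerivXi_nonneg hχ hq (s := ⟨x, t⟩) (by simp only; linarith [hx.1])
    have h2 := (abs_le.1 (hC x t (by linarith [hx.1]) (by linarith [hx.2]))).2
    simp only [B]
    linarith
  have := hmono (Set.left_mem_Icc.2 hσσ') (Set.right_mem_Icc.2 hσσ') hσσ'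
  simp only at this
  linarith

theorem log_le_logWeight {q : ℕ} (hq : 1 < q) (T t : ℝ) :
    Real.log (q * (|t| + 3)) ≤ logWeight (Real.log (q * (|T| + 3))) T t := by
  have hq' : (0 : ℝ) < q := by positivity
  rw [logWeight, ← Real.log_mul (by positivity) (by positivity)]
  refine Real.log_le_log (by positivity) ?_
  rw [mul_assoc]
  gcongr
  have : |t| ≤ |T| + |t - T| := by
    calc |t| = |T + (t - T)| := by ring_nf
      _ ≤ _ := abs_add_le _ _
  nlinarith [mul_nonneg (abs_nonneg T) (abs_nonneg (t - T)), abs_nonneg (t - T)]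

/-- A bound on `Re s ≥ 1/2 + a` extends to the line `Re s = 1/2 + a/4`. -/
theorem norm_le_on_left_line (h : IsLogL χ ℓ) (hχ : χ.IsPrimitive) (hq : 1 < q)
    (hC : ArchBound χ C) (hC0 : 0 ≤ C) {T a K : ℝ} (ha : 0 < a) (ha' : a ≤ 1 / 4) (hK : 0 ≤ K)
    (hbd : ∀ s : ℂ, 1 / 2 + a ≤ s.re →
      ‖ℓ s‖ ≤ K * logWeight (Real.log (q * (|T| + 3))) T s.im) (t : ℝ) :
    ‖ℓ ⟨1 / 2 + a / 4, t⟩‖ ≤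
      (K + 3 / (1 - 2 * a) * (2 * K + a / 2)) * logWeight (Real.log (q * (|T| + 3))) T t +
        3 / (1 - 2 * a) * (K + a / 2 + a * C) := by
  set A := Real.log (q * (|T| + 3)) with hA
  have hA1 : 1 ≤ A := one_le_log hq T
  set w := logWeight A T t with hw
  have hw1 : 1 ≤ w := hA1.trans (le_logWeight A T t)
  -- A disc tangent to the critical line. In its part with Re s < 1/2 + a only an upper bound for
  -- log |L| is available, from the monotonicity of |ξ|; Borel–Carathéodory needs no more. Passing
  -- from distance a to a/4 produces the factor 3/(1 - 2a).
  set c : ℂ := ⟨1 / 2 + 1 / 4, t⟩ with hc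
  have hball : ∀ s ∈ Metric.ball c (1 / 4 : ℝ), 1 / 2 < s.re ∧ s.re < 1 ∧ |s.im - t| < 1 := by
    intro s hs
    rw [mem_ball_iff_norm] at hs
    have h1 : |s.re - (1 / 2 + 1 / 4)| ≤ ‖s - c‖ := Complex.abs_re_le_norm (s - c)
    have h2 : |s.im - t| ≤ ‖s - c‖ := Complex.abs_im_le_norm (s - c)
    have h3 := abs_le.1 h1
    exact ⟨by linarith [h3.1], by linarith [h3.2], by linarith⟩
  set P := K * (w + 1) + a * ((w + 1) / 2 + C) with hP
  have hwt : ∀ s : ℂ, |s.im - t| < 1 → logWeight A T s.im ≤ w + 1 := by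
    intro s hs
    have := logWeight_add_le A T t (s.im - t)
    rw [add_sub_cancel] at this
    linarith
  have hPbd : ∀ s ∈ Metric.ball c (1 / 4 : ℝ), (ℓ s).re ≤ P := by
    intro s hs
    obtain ⟨h1, h2, h3⟩ := hball s hs
    have h4 := hwt s h3
    have h5 : 0 ≤ a * ((w + 1) / 2 + C) := by positivity
    rcases le_or_gt (1 / 2 + a) s.re with h6 | h6
    · calc (ℓ s).re ≤ ‖ℓ s‖ := Complex.re_le_norm _
        _ ≤ K * logWeight A T s.im := hbd s h6
        _ ≤ K * (w + 1) := by gcongr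
        _ ≤ P := by rw [hP]; linarith
    · have h7 := h.re_le_re_add hχ hq hC (t := s.im) h1 h6.le (by linarith)
      have h8 : (ℓ ⟨1 / 2 + a, s.im⟩).re ≤ K * (w + 1) := by
        calc _ ≤ ‖ℓ ⟨1 / 2 + a, s.im⟩‖ := Complex.re_le_norm _
          _ ≤ K * logWeight A T s.im := hbd ⟨1 / 2 + a, s.im⟩ le_rfl
          _ ≤ K * (w + 1) := by gcongr
      have h9 : Real.log (q * (|s.im| + 3)) ≤ w + 1 := (log_le_logWeight hq T s.im).trans h4
      have h10 : 0 ≤ Real.log (q * (|s.im| + 3)) := by linarith [one_le_log hq s.im]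
      have h11 : (1 / 2 + a - s.re) * (Real.log (q * (|s.im| + 3)) / 2 + C) ≤
          a * ((w + 1) / 2 + C) := by
        gcongr
        linarith
      rw [show (⟨s.re, s.im⟩ : ℂ) = s from rfl] at h7
      rw [hP]
      linarith
  have e1 : ∀ x : ℝ, c - ((1 / 4 : ℝ) : ℂ) + (x : ℂ) = ⟨1 / 2 + x, t⟩ := by
    intro x
    apply Complex.ext <;> simp [hc]
  have hfa : ‖ℓ ⟨1 / 2 + a, t⟩‖ ≤ K * w := hbd ⟨1 / 2 + a, t⟩ le_rfl
  have hfa' := abs_le.1 ((Complex.abs_re_le_norm (ℓ ⟨1 / 2 + a, t⟩)).trans hfa)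
  have hlt : (ℓ (c - ((1 / 4 : ℝ) : ℂ) + (a : ℂ))).re < P := by
    rw [e1, hP]
    have : 0 < a * ((w + 1) / 2 + C) := by positivity
    nlinarith [hfa'.2]
  have key := norm_sub_le_of_re_le_on_ball (b := a / 4)
    (h.differentiableOn.mono fun s hs => (hball s hs).1) hPbd (by linarith) (by linarith) ha' hlt
  rw [e1, e1] at key
  have e2 : 2 * (P - (ℓ ⟨1 / 2 + a, t⟩).re) *
      ((a - a / 4) * (1 / 4) / (a / 4 * (2 * (1 / 4) - a))) =
      3 / (1 - 2 * a) * (P - (ℓ ⟨1 / 2 + a, t⟩).re) := by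
    have h1 : 1 - 2 * a ≠ 0 := by linarith
    rw [show 2 * (1 / 4) - a = (1 - 2 * a) / 2 by ring]
    field_simp
    ring
  rw [e2] at key
  have h3 : 0 ≤ 3 / (1 - 2 * a) := div_nonneg (by norm_num) (by linarith)
  calc ‖ℓ ⟨1 / 2 + a / 4, t⟩‖
      ≤ ‖ℓ ⟨1 / 2 + a / 4, t⟩ - ℓ ⟨1 / 2 + a, t⟩‖ + ‖ℓ ⟨1 / 2 + a, t⟩‖ := norm_le_norm_sub_add _ _
    _ ≤ 3 / (1 - 2 * a) * (P + K * w) + K * w := by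
        refine add_le_add (key.trans ?_) hfa
        gcongr
        linarith [hfa'.1]
    _ = _ := by rw [hP]; ring

end IsLogL

end DirichletCharacter

/-- The exponent is 1.99 · 1.5, the gain at rate 1.99 M across the gap 1.5/M between the abscissas
1/2 + 1/(2M) and 1/2 + 2/M. -/
theorem exp_neg_two_point_nine_eight_five_le : Real.exp (-2.985) ≤ 0.0507 := by
  have h : Real.exp (-2.985 : ℝ) = Real.exp (-1) ^ 3 * Real.exp 0.015 := by
    rw [← Real.exp_nat_mul, ← Real.exp_add]; norm_num
  have h1 := Real.exp_neg_one_lt_d9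
  have h2 : Real.exp 0.015 ≤ 1.0153 := by
    have := Real.exp_bound_div_one_sub_of_interval (x := 0.015) (by norm_num) (by norm_num)
    refine this.trans (by norm_num)
  rw [h]
  calc Real.exp (-1) ^ 3 * Real.exp 0.015 ≤ 0.3678794412 ^ 3 * 1.0153 := by gcongr
    _ ≤ _ := by norm_num

/-- The size of `M = log log (q (|T| + 3))` from which the asymptotic estimates hold. -/
structure IsLargeScale (C M : ℝ) : Prop where
  le_self : 4000 ≤ M
  const_le : 4 * (1 + 2 * C) ≤ 0.001 * Real.exp M
  exp_le : Real.exp 2 * Real.exp (0.995 * M) * M ≤ 0.001 / M * Real.exp M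

theorem eventually_isLargeScale (C : ℝ) : ∀ᶠ M in atTop, IsLargeScale C M := by
  have h1 : ∀ᶠ M : ℝ in atTop, 4 * (1 + 2 * C) ≤ 0.001 * Real.exp M :=
    (Real.tendsto_exp_atTop.const_mul_atTop (by norm_num : (0 : ℝ) < 0.001)).eventually_ge_atTop _
  have h2 : Tendsto (fun M : ℝ => (0.005 * M) ^ 2 * Real.exp (-(0.005 * M))) atTop (𝓝 0) :=
    (Real.tendsto_pow_mul_exp_neg_atTop_nhds_zero 2).comp
      (tendsto_id.const_mul_atTop (by norm_num : (0 : ℝ) < 0.005))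
  have h3 := h2.eventually_lt_const
    (show (0 : ℝ) < 0.005 ^ 2 * (0.001 / Real.exp 2) by positivity)
  filter_upwards [h1, h3, eventually_ge_atTop (4000 : ℝ)] with M hM1 hM3 hM
  refine ⟨hM, hM1, ?_⟩
  have hM0 : 0 < M := by linarith
  have h4 : M ^ 2 * Real.exp (-(0.005 * M)) * Real.exp 2 ≤ 0.001 := by
    rw [← le_div_iff₀ (Real.exp_pos 2)]
    rw [mul_pow, mul_assoc] at hM3
    exact (lt_of_mul_lt_mul_left hM3 (by positivity)).le
  have h5 : Real.exp (0.995 * M) = Real.exp (-(0.005 * M)) * Real.exp M := by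
    rw [← Real.exp_add]; congr 1; ring
  rw [h5, div_mul_eq_mul_div, le_div_iff₀ hM0]
  nlinarith [mul_le_mul_of_nonneg_right h4 (Real.exp_pos M).le]

namespace IsLargeScale

variable {C M : ℝ}

theorem pos (h : IsLargeScale C M) : 0 < M := by linarith [h.le_self]

theorem self_le (h : IsLargeScale C M) : M ≤ 0.001 / M * Real.exp M := by
  refine le_trans ?_ h.exp_le
  have h1 := h.pos
  have h2 : 1 ≤ Real.exp 2 := Real.one_le_exp (by norm_num)
  have h3 : 1 ≤ Real.exp (0.995 * M) := Real.one_le_exp (by positivity)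
  have := one_le_mul_of_one_le_of_one_le h2 h3
  nlinarith

theorem const_le_exp (h : IsLargeScale C M) : 4000 ≤ Real.exp M := by
  linarith [h.le_self, Real.add_one_le_exp M]

end IsLargeScale

namespace DirichletCharacter.IsLogL

variable {q : ℕ} [NeZero q] {χ : DirichletCharacter ℂ q} {ℓ : ℂ → ℂ} {C M T : ℝ}

/-- One round of the self-improvement: extending to the left line costs a factor of about 7.02 on K,
and the three lines theorem returns a factor 0.0507, giving 0.36. -/
theorem norm_le_decay_of_bound (h : IsLogL χ ℓ) (hχ : χ.IsPrimitive) (hq : 1 < q)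
    (hC : ArchBound χ C) (hC0 : 0 ≤ C) (hM : IsLargeScale C M)
    (hMT : Real.exp M = Real.log (q * (|T| + 3))) {K : ℝ} (hK : 0 ≤ K)
    (hbd : ∀ s : ℂ, 1 / 2 + 2 / M ≤ s.re → ‖ℓ s‖ ≤ K * logWeight (Real.exp M) T s.im)
    {s : ℂ} (hs : 1 / 2 + 2 / M ≤ s.re) (hs' : s.re ≤ 1 + 1 / M) :
    ‖ℓ s‖ ≤ Real.exp (-(1.99 * M) * (s.re - (1 / 2 + 2 / M))) *
      ((0.36 * K + 0.156 / M) * logWeight (Real.exp M) T s.im) := by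
  have hM0 := hM.pos
  have hM4 := hM.le_self
  have hi : 1 / M ≤ 1 / 4000 := one_div_le_one_div_of_le (by norm_num) hM4
  have hi0 : 0 < 1 / M := by positivity
  have ha : 2 / M = 2 * (1 / M) := by ring
  have ha4 : 2 / M / 4 = 1 / M / 2 := by ring
  have hχ1 := ne_one_of_isPrimitive hχ hq
  set w := logWeight (Real.exp M) T s.im with hw
  have hE := hM.const_le_exp
  have hwE : Real.exp M ≤ w := le_logWeight _ _ _
  have hw0 : 0 < w := (Real.exp_pos M).trans_le hwE
  set α := K + 3 / (1 - 2 * (2 / M)) * (2 * K + 2 / M / 2) with hα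
  set β := 3 / (1 - 2 * (2 / M)) * (K + 2 / M / 2 + 2 / M * C) with hβ
  have hc : 3 / (1 - 2 * (2 / M)) ≤ 3.01 := by
    rw [div_le_iff₀ (by linarith)]; linarith
  have hc0 : 0 ≤ 3 / (1 - 2 * (2 / M)) := div_nonneg (by norm_num) (by linarith)
  have hα0 : 0 ≤ α := by positivity
  have hβ0 : 0 ≤ β := by positivity
  have hα' : α ≤ 7.02 * K + 3.01 * (1 / M) := by
    calc α ≤ K + 3.01 * (2 * K + 2 / M / 2) := by rw [hα]; gcongr
      _ = 7.02 * K + 3.01 * (1 / M) := by ring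
  have hβ' : β ≤ 0.001 * w * (K + 1 / M) := by
    have h1 : 4 * (1 + 2 * C) ≤ 0.001 * w := hM.const_le.trans (by linarith)
    calc β ≤ 3.01 * (K + 2 / M / 2 + 2 / M * C) := by rw [hβ]; gcongr
      _ = 3.01 * K + 3.01 * (1 + 2 * C) * (1 / M) := by ring
      _ ≤ 4 * K + 4 * (1 + 2 * C) * (1 / M) := by gcongr <;> norm_num
      _ ≤ 0.001 * w * K + 0.001 * w * (1 / M) := by gcongr; linarith
      _ = _ := by ring
  -- Over the half unit up to Re s = 1 the rate 1.99 M costs exp(0.995 M) on the right edge, where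
  -- |ℓ| ≤ M. That is negligible against exp(M)/M; a rate of 2M or more would not be.
  have key := norm_le_of_logWeight_bounds (f := ℓ) (σL := 1 / 2 + 2 / M / 4) (σR := 1 + 1 / M)
    (A := Real.exp M) (T := T) (A₀ := 12 / (2 / M / 4)) (α := α) (β := β) (B := M) (y := 1.99 * M)
    (by positivity) hα0 hβ0 (by positivity) (by positivity) (by positivity)
    (by rw [ha4]; linarith) ?_ ?_ ?_ ?_ (s₀ := s) (by linarith [ha, ha4]) hs'
  · refine key.trans ?_
    have e1 : Real.exp (-(1.99 * M) * (s.re - (1 / 2 + 2 / M / 4))) =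
        Real.exp (-(1.99 * M) * (s.re - (1 / 2 + 2 / M))) * Real.exp (-2.985) := by
      rw [← Real.exp_add]; congr 1; field_simp; ring
    have e2 : Real.exp (1.99 * M * (1 + 1 / M - s.re)) =
        Real.exp (-(1.99 * M) * (s.re - (1 / 2 + 2 / M))) * Real.exp (0.995 * M - 1.99) := by
      rw [← Real.exp_add]; congr 1; field_simp; ring
    rw [e1, e2]
    set X := Real.exp (-(1.99 * M) * (s.re - (1 / 2 + 2 / M))) with hX
    have h1 : α * (w + 1) + β ≤ (7.03 * K + 3.02 * (1 / M)) * w := by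
      have h2 : w + 1 ≤ 1.0003 * w := by linarith
      calc α * (w + 1) + β ≤ (7.02 * K + 3.01 * (1 / M)) * (1.0003 * w) +
            0.001 * w * (K + 1 / M) := by gcongr
        _ = (7.023106 * K + 3.011903 * (1 / M)) * w := by ring
        _ ≤ _ := by gcongr <;> norm_num
    have h3 : Real.exp 2 * Real.exp (0.995 * M - 1.99) * M ≤ 0.001 / M * w := by
      calc Real.exp 2 * Real.exp (0.995 * M - 1.99) * M
          ≤ Real.exp 2 * Real.exp (0.995 * M) * M := by gcongr; linarith
        _ ≤ 0.001 / M * Real.exp M := hM.exp_le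
        _ ≤ _ := by gcongr
    calc X * Real.exp (-2.985) * (α * (w + 1) + β) +
          Real.exp 2 * (X * Real.exp (0.995 * M - 1.99)) * M
        = X * (Real.exp (-2.985) * (α * (w + 1) + β) +
          Real.exp 2 * Real.exp (0.995 * M - 1.99) * M) := by ring
      _ ≤ X * (0.0507 * ((7.03 * K + 3.02 * (1 / M)) * w) + 0.001 / M * w) := by
          gcongr
          exact exp_neg_two_point_nine_eight_five_le
      _ = X * ((0.356421 * K + 0.154114 / M) * w) := by ring
      _ ≤ _ := by gcongr <;> norm_num
  · refine DifferentiableOn.diffContOnCl (h.differentiableOn.mono ?_)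
    have : closure (Complex.re ⁻¹' Set.Ioo (1 / 2 + 2 / M / 4) (1 + 1 / M)) ⊆
        Complex.re ⁻¹' Set.Icc (1 / 2 + 2 / M / 4) (1 + 1 / M) :=
      closure_minimal (Set.preimage_mono Set.Ioo_subset_Icc_self)
        (isClosed_Icc.preimage Complex.continuous_re)
    intro z hz
    have := (this hz).1
    change 1 / 2 < z.re
    linarith
  · intro z hz _
    refine (h.norm_le_log hχ1 hq (δ := 2 / M / 4) (by positivity) (by linarith) hz.le).trans ?_
    rw [hMT]
    gcongr
    exact log_le_logWeight hq T z.im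
  · intro z hz
    have := h.norm_le_on_left_line hχ hq hC hC0 (T := T) (a := 2 / M) (K := K) (by positivity)
      (by linarith) hK (by rw [← hMT]; exact hbd) z.im
    rw [← hMT] at this
    rw [← hz] at this
    exact this
  · intro z hz
    refine (h.norm_le_inv z (by rw [hz]; linarith)).trans ?_
    rw [hz, add_sub_cancel_left, one_div_one_div]

theorem norm_le_of_right (h : IsLogL χ ℓ) (hM : IsLargeScale C M) {s : ℂ}
    (hs : 1 + 1 / M ≤ s.re) : ‖ℓ s‖ ≤ M := by
  have hM0 := hM.pos
  have hi0 : 0 < 1 / M := by positivity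
  refine (h.norm_le_inv s (by linarith)).trans ?_
  rw [div_le_iff₀ (by linarith)]
  have : M * (1 / M) = 1 := by field_simp
  nlinarith

/-- Take for K the best constant. It is finite by the crude Borel–Carathéodory bound, and then K ≤
0.36 K + 0.156/M forces K ≤ 0.25/M. -/
theorem norm_le_mul_logWeight (h : IsLogL χ ℓ) (hχ : χ.IsPrimitive) (hq : 1 < q)
    (hC : ArchBound χ C) (hC0 : 0 ≤ C) (hM : IsLargeScale C M)
    (hMT : Real.exp M = Real.log (q * (|T| + 3))) {s : ℂ} (hs : 1 / 2 + 2 / M ≤ s.re) :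
    ‖ℓ s‖ ≤ 0.25 / M * logWeight (Real.exp M) T s.im := by
  have hM0 := hM.pos
  have hM4 := hM.le_self
  have hi : 1 / M ≤ 1 / 4000 := one_div_le_one_div_of_le (by norm_num) hM4
  have hi0 : 0 < 1 / M := by positivity
  have ha : 2 / M = 2 * (1 / M) := by ring
  have hw : ∀ t, 0 < logWeight (Real.exp M) T t := fun t =>
    (Real.exp_pos M).trans_le (le_logWeight _ _ _)
  let ι := {s : ℂ // 1 / 2 + 2 / M ≤ s.re}
  let r : ι → ℝ := fun s => ‖ℓ s‖ / logWeight (Real.exp M) T (s : ℂ).im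
  have hbdd : BddAbove (Set.range r) := by
    refine ⟨12 / (2 / M), ?_⟩
    rintro _ ⟨⟨z, hz⟩, rfl⟩
    simp only [r]
    rw [div_le_iff₀ (hw _)]
    refine (h.norm_le_log (ne_one_of_isPrimitive hχ hq) hq (δ := 2 / M) (by positivity)
      (by linarith) hz).trans ?_
    rw [hMT]
    gcongr
    exact log_le_logWeight hq T z.im
  set K := ⨆ z, r z with hKdef
  have hbd : ∀ z : ℂ, 1 / 2 + 2 / M ≤ z.re → ‖ℓ z‖ ≤ K * logWeight (Real.exp M) T z.im := by
    intro z hz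
    rw [← div_le_iff₀ (hw _)]
    exact le_ciSup hbdd (⟨z, hz⟩ : ι)
  have hK : 0 ≤ K := Real.iSup_nonneg fun z => div_nonneg (norm_nonneg _) (hw _).le
  have : Nonempty ι := ⟨⟨s, hs⟩⟩
  have hK' : K ≤ 0.36 * K + 0.156 / M := by
    refine ciSup_le ?_
    rintro ⟨z, hz⟩
    simp only [r]
    rw [div_le_iff₀ (hw _)]
    rcases le_total z.re (1 + 1 / M) with h1 | h1
    · refine (h.norm_le_decay_of_bound hχ hq hC hC0 hM hMT hK hbd hz h1).trans ?_
      refine mul_le_of_le_one_left (mul_nonneg (by positivity) (hw _).le) ?_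
      rw [Real.exp_le_one_iff]
      nlinarith
    · calc ‖ℓ z‖ ≤ M := h.norm_le_of_right hM h1
        _ ≤ 0.001 / M * Real.exp M := hM.self_le
        _ ≤ (0.36 * K + 0.156 / M) * logWeight (Real.exp M) T z.im := by
          gcongr
          · have : 0.001 / M ≤ 0.156 / M := by gcongr; norm_num
            linarith
          · exact le_logWeight _ _ _
  have hK2 : K ≤ 0.25 / M := by
    have e1 : 0.156 / M = 0.156 * (1 / M) := by ring
    have e2 : 0.25 / M = 0.25 * (1 / M) := by ring
    rw [e2]; rw [e1] at hK'
    linarith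
  exact (hbd s hs).trans (mul_le_mul_of_nonneg_right hK2 (hw _).le)

/-- Under the Riemann hypothesis for `L(s, χ)`, its logarithm is `O(log Q / log log Q)` at distance
`2 / log log Q` from the critical line, with exponential decay to the right. -/
theorem norm_le_decay (h : IsLogL χ ℓ) (hχ : χ.IsPrimitive) (hq : 1 < q)
    (hC : ArchBound χ C) (hC0 : 0 ≤ C) (hM : IsLargeScale C M)
    (hMT : Real.exp M = Real.log (q * (|T| + 3))) {s : ℂ} (hs : 1 / 2 + 2 / M ≤ s.re)
    (hs' : s.re ≤ 1 + 1 / M) :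
    ‖ℓ s‖ ≤ Real.exp (-(1.99 * M) * (s.re - (1 / 2 + 2 / M))) *
      (0.25 / M * logWeight (Real.exp M) T s.im) := by
  have hM0 := hM.pos
  refine (h.norm_le_decay_of_bound hχ hq hC hC0 hM hMT (K := 0.25 / M) (by positivity)
    (fun z hz => h.norm_le_mul_logWeight hχ hq hC hC0 hM hMT hz) hs hs').trans ?_
  have : 0.36 * (0.25 / M) + 0.156 / M ≤ 0.25 / M := by
    rw [← mul_div_assoc, ← add_div]; gcongr; norm_num
  gcongr
  exact (Real.exp_pos M).le.trans (le_logWeight _ _ _)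

end DirichletCharacter.IsLogL

/-! ### Horizontal integrals of log |L|, Littlewood's rectangle, and arg L -/

namespace DirichletCharacter.IsLogL

variable {q : ℕ} [NeZero q] {χ : DirichletCharacter ℂ q} {ℓ : ℂ → ℂ} {C : ℝ}

theorem hasDerivAt_re_shift (h : IsLogL χ ℓ) {x : ℝ} (t : ℝ) (hx : 0 < x) :
    HasDerivAt (fun x : ℝ => (ℓ ⟨1 / 2 + x, t⟩).re)
      ((logDerivXi χ ⟨1 / 2 + x, t⟩).re - (logDeriv (archFactor χ) ⟨1 / 2 + x, t⟩).re) x :=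
  (h.hasDerivAt_re (t := t) (show 1 / 2 < 1 / 2 + x by linarith)).comp_const_add (1 / 2) x

theorem continuousOn_re_shift (h : IsLogL χ ℓ) (t : ℝ) :
    ContinuousOn (fun x : ℝ => (ℓ ⟨1 / 2 + x, t⟩).re) (Set.Ioi 0) := fun _ hx =>
  (h.hasDerivAt_re_shift t hx).continuousAt.continuousWithinAt

theorem intervalIntegrable_re_shift (h : IsLogL χ ℓ) (t : ℝ) {x y : ℝ} (hx : 0 < x) (hy : 0 < y) :
    IntervalIntegrable (fun x : ℝ => (ℓ ⟨1 / 2 + x, t⟩).re) MeasureTheory.volume x y :=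
  ((h.continuousOn_re_shift t).mono fun _ hz =>
    (lt_min hx hy).trans_le hz.1).intervalIntegrable

theorem hasDerivAt_integral_re_shift (h : IsLogL χ ℓ) (t : ℝ) {ε y : ℝ} (hε : 0 < ε) (hy : 0 < y) :
    HasDerivAt (fun y : ℝ => ∫ x in ε..y, (ℓ ⟨1 / 2 + x, t⟩).re) ((ℓ ⟨1 / 2 + y, t⟩).re) y :=
  intervalIntegral.integral_hasDerivAt_right (h.intervalIntegrable_re_shift t hε hy)
    ((h.continuousOn_re_shift t).stronglyMeasurableAtFilter isOpen_Ioi y hy)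
    (h.hasDerivAt_re_shift t hy).continuousAt

/-- Integration by parts in disguise: as a function of the upper limit y, the right side minus the
left has derivative (y - ε)((log |L|)' + B), which is nonnegative by positivity of Re ξ'/ξ. -/
theorem integral_re_le (h : IsLogL χ ℓ) (hχ : χ.IsPrimitive) (hq : 1 < q) (hC : ArchBound χ C)
    {ε a : ℝ} (t : ℝ) (hε : 0 < ε) (hεa : ε ≤ a) (ha : a ≤ 5 / 2) :
    ∫ x in ε..a, (ℓ ⟨1 / 2 + x, t⟩).re ≤ (a - ε) * (ℓ ⟨1 / 2 + a, t⟩).re +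
      (a - ε) ^ 2 / 2 * (Real.log (q * (|t| + 3)) / 2 + C) := by
  set B := Real.log (q * (|t| + 3)) / 2 + C with hB
  set Φ : ℝ → ℝ := fun y => (y - ε) * (ℓ ⟨1 / 2 + y, t⟩).re + (y - ε) ^ 2 / 2 * B -
    ∫ x in ε..y, (ℓ ⟨1 / 2 + x, t⟩).re with hΦ
  have hd : ∀ y ∈ Set.Icc ε a, HasDerivAt Φ ((y - ε) * ((logDerivXi χ ⟨1 / 2 + y, t⟩).re -
      (logDeriv (archFactor χ) ⟨1 / 2 + y, t⟩).re + B)) y := by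
    intro y hy
    have hy0 : 0 < y := hε.trans_le hy.1
    have h1 := ((hasDerivAt_id y).sub_const ε).mul (h.hasDerivAt_re_shift t hy0)
    have h2 := ((((hasDerivAt_id y).sub_const ε).pow 2).div_const 2).mul_const B
    refine ((h1.add h2).sub (h.hasDerivAt_integral_re_shift t hε hy0)).congr_deriv ?_
    simp only [id]
    push_cast
    ring
  have hmono : MonotoneOn Φ (Set.Icc ε a) := by
    refine monotoneOn_of_deriv_nonneg (convex_Icc _ _)
      (fun x hx => (hd x hx).continuousAt.continuousWithinAt)
      (fun x hx => (hd x (interior_subset hx)).differentiableAt.differentiableWithinAt)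
      (fun x hx => ?_)
    have hx := interior_subset hx
    rw [(hd x hx).deriv]
    have h1 := h.re_logDerivXi_nonneg hχ hq (s := ⟨1 / 2 + x, t⟩) (by simp only; linarith [hx.1])
    have h2 := (abs_le.1 (hC (1 / 2 + x) t (by linarith [hx.1]) (by linarith [hx.2]))).2
    refine mul_nonneg (by linarith [hx.1]) ?_
    linarith
  have := hmono (Set.left_mem_Icc.2 hεa) (Set.right_mem_Icc.2 hεa) hεa
  simp only [hΦ, sub_self, intervalIntegral.integral_same] at this
  linarith

theorem mul_re_logDerivXi_mono (h : IsLogL χ ℓ) (hχ : χ.IsPrimitive) (hq : 1 < q) (t : ℝ) :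
    MonotoneOn (fun a : ℝ => a * (logDerivXi χ ⟨1 / 2 + a, t⟩).re) (Set.Ioi 0) := by
  have := monotoneOn_mul_re_of_re_nonneg (c := 1 / 2) (f := logDerivXi χ)
    (differentiableOn_logDerivXi (ne_one_of_isPrimitive hχ hq) fun s hs => h.ne_zero hs)
    (fun s hs => h.re_logDerivXi_nonneg hχ hq hs) t
  simpa using this

/-- By monotonicity Re ξ'/ξ ≤ G/x for x ≤ a, so log |L| falls at most logarithmically towards the
critical line and its integral stays bounded, uniformly in ε. -/
theorem neg_integral_re_le (h : IsLogL χ ℓ) (hχ : χ.IsPrimitive) (hq : 1 < q) (hC : ArchBound χ C)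
    {ε a : ℝ} (t : ℝ) (hε : 0 < ε) (hεa : ε ≤ a) (ha : a ≤ 5 / 2) :
    -∫ x in ε..a, (ℓ ⟨1 / 2 + x, t⟩).re ≤ -((a - ε) * (ℓ ⟨1 / 2 + a, t⟩).re) +
      (a - ε) ^ 2 / 2 * C + (a - ε) * (a * (logDerivXi χ ⟨1 / 2 + a, t⟩).re) := by
  set G := a * (logDerivXi χ ⟨1 / 2 + a, t⟩).re with hG
  set Φ : ℝ → ℝ := fun y => -((y - ε) * (ℓ ⟨1 / 2 + y, t⟩).re) + (y - ε) ^ 2 / 2 * C +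
    (y - ε) * G + ∫ x in ε..y, (ℓ ⟨1 / 2 + x, t⟩).re with hΦ
  have hd : ∀ y ∈ Set.Icc ε a, HasDerivAt Φ ((y - ε) * (-(logDerivXi χ ⟨1 / 2 + y, t⟩).re +
      (logDeriv (archFactor χ) ⟨1 / 2 + y, t⟩).re + C) + G) y := by
    intro y hy
    have hy0 : 0 < y := hε.trans_le hy.1
    have h1 := (((hasDerivAt_id y).sub_const ε).mul (h.hasDerivAt_re_shift t hy0)).neg
    have h2 := ((((hasDerivAt_id y).sub_const ε).pow 2).div_const 2).mul_const C
    have h3 := ((hasDerivAt_id y).sub_const ε).mul_const G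
    refine (((h1.add h2).add h3).add (h.hasDerivAt_integral_re_shift t hε hy0)).congr_deriv ?_
    simp only [id]
    push_cast
    ring
  have hmono : MonotoneOn Φ (Set.Icc ε a) := by
    refine monotoneOn_of_deriv_nonneg (convex_Icc _ _)
      (fun x hx => (hd x hx).continuousAt.continuousWithinAt)
      (fun x hx => (hd x (interior_subset hx)).differentiableAt.differentiableWithinAt)
      (fun x hx => ?_)
    have hx := interior_subset hx
    have hx0 : 0 < x := hε.trans_le hx.1
    rw [(hd x hx).deriv]
    have h1 := h.re_logDerivXi_nonneg hχ hq (s := ⟨1 / 2 + x, t⟩) (by simp only; linarith [hx.1])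
    have h2 := (abs_le.1 (hC (1 / 2 + x) t (by linarith [hx.1]) (by linarith [hx.2]))).1
    have h3 : x * (logDerivXi χ ⟨1 / 2 + x, t⟩).re ≤ G :=
      h.mul_re_logDerivXi_mono hχ hq t hx0 (hε.trans_le hεa) hx.2
    have h4 : 0 ≤ (x - ε) * ((logDeriv (archFactor χ) ⟨1 / 2 + x, t⟩).re + C) :=
      mul_nonneg (by linarith [hx.1]) (by linarith [one_le_log hq t])
    nlinarith [mul_nonneg hε.le h1]
  have := hmono (Set.left_mem_Icc.2 hεa) (Set.right_mem_Icc.2 hεa) hεa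
  simp only [hΦ, sub_self, intervalIntegral.integral_same] at this
  linarith

/-- Beyond a the same monotonicity reads Re ξ'/ξ ≥ G/y. Integrating over [a, 2a] gives G log 2,
which the values of log |L| at both ends control. -/
theorem mul_re_logDerivXi_le (h : IsLogL χ ℓ) (hχ : χ.IsPrimitive) (hq : 1 < q) (hC : ArchBound χ C)
    {a : ℝ} (t : ℝ) (ha0 : 0 < a) (ha : 2 * a ≤ 5 / 2) :
    Real.log 2 * (a * (logDerivXi χ ⟨1 / 2 + a, t⟩).re) ≤ (ℓ ⟨1 / 2 + 2 * a, t⟩).re -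
      (ℓ ⟨1 / 2 + a, t⟩).re + a * (Real.log (q * (|t| + 3)) / 2 + C) := by
  set B := Real.log (q * (|t| + 3)) / 2 + C with hB
  set G := a * (logDerivXi χ ⟨1 / 2 + a, t⟩).re with hG
  set Φ : ℝ → ℝ := fun y => (ℓ ⟨1 / 2 + y, t⟩).re + y * B - Real.log y * G with hΦ
  have hd : ∀ y ∈ Set.Icc a (2 * a), HasDerivAt Φ ((logDerivXi χ ⟨1 / 2 + y, t⟩).re -
      (logDeriv (archFactor χ) ⟨1 / 2 + y, t⟩).re + 1 * B - y⁻¹ * G) y := by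
    intro y hy
    have hy0 : 0 < y := ha0.trans_le hy.1
    exact ((h.hasDerivAt_re_shift t hy0).add ((hasDerivAt_id y).mul_const B)).sub
      ((Real.hasDerivAt_log hy0.ne').mul_const G)
  have hmono : MonotoneOn Φ (Set.Icc a (2 * a)) := by
    refine monotoneOn_of_deriv_nonneg (convex_Icc _ _)
      (fun x hx => (hd x hx).continuousAt.continuousWithinAt)
      (fun x hx => (hd x (interior_subset hx)).differentiableAt.differentiableWithinAt)
      (fun x hx => ?_)
    have hx := interior_subset hx
    have hx0 : 0 < x := ha0.trans_le hx.1
    rw [(hd x hx).deriv]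
    have h2 := (abs_le.1 (hC (1 / 2 + x) t (by linarith [hx.1]) (by linarith [hx.2]))).2
    have h3 : G ≤ x * (logDerivXi χ ⟨1 / 2 + x, t⟩).re :=
      h.mul_re_logDerivXi_mono hχ hq t ha0 hx0 hx.1
    have h4 : x⁻¹ * G ≤ (logDerivXi χ ⟨1 / 2 + x, t⟩).re := by
      rwa [inv_mul_le_iff₀ hx0]
    linarith
  have hle : a ≤ 2 * a := by linarith
  have := hmono (Set.left_mem_Icc.2 hle) (Set.right_mem_Icc.2 hle) hle
  simp only [hΦ] at this
  rw [Real.log_mul (by norm_num) ha0.ne'] at this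
  linarith

/-- Upper and lower bounds for the integral of `log |L|` along a horizontal segment reaching close to
the critical line. -/
theorem integral_re_bounds (h : IsLogL χ ℓ) (hχ : χ.IsPrimitive) (hq : 1 < q) (hC : ArchBound χ C)
    (hC0 : 0 ≤ C) {ε a t E E₂ E₃ : ℝ} (hε : 0 < ε) (hεa : ε ≤ a) (ha : 2 * a ≤ 5 / 2)
    (hE : |(ℓ ⟨1 / 2 + a, t⟩).re| ≤ E) (hE₂ : |(ℓ ⟨1 / 2 + 2 * a, t⟩).re| ≤ E₂)
    (hE₃ : |∫ x in a..(5 / 2), (ℓ ⟨1 / 2 + x, t⟩).re| ≤ E₃) :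
    (∫ x in ε..(5 / 2), (ℓ ⟨1 / 2 + x, t⟩).re) ≤
        a * E + a ^ 2 / 2 * (Real.log (q * (|t| + 3)) / 2 + C) + E₃ ∧
      -(∫ x in ε..(5 / 2), (ℓ ⟨1 / 2 + x, t⟩).re) ≤
        a * E + a ^ 2 / 2 * C +
          a * ((E + E₂ + a * (Real.log (q * (|t| + 3)) / 2 + C)) / Real.log 2) + E₃ := by
  have ha0 : 0 < a := hε.trans_le hεa
  have hL := one_le_log hq t
  have hsplit := intervalIntegral.integral_add_adjacent_intervals
    (h.intervalIntegrable_re_shift t hε ha0) (h.intervalIntegrable_re_shift t ha0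
      (by norm_num : (0 : ℝ) < 5 / 2))
  rw [← hsplit]
  have h3 := abs_le.1 hE₃
  have h1 := abs_le.1 hE
  have h2 := abs_le.1 hE₂
  have hE0 : 0 ≤ E := (abs_nonneg _).trans hE
  have hae : a - ε ≤ a := by linarith
  have hae0 : 0 ≤ a - ε := by linarith
  have hsq : (a - ε) ^ 2 / 2 ≤ a ^ 2 / 2 := by gcongr
  have hu := h.integral_re_le hχ hq hC t hε hεa (by linarith)
  have hl := h.neg_integral_re_le hχ hq hC t hε hεa (by linarith)
  have hG := h.mul_re_logDerivXi_le hχ hq hC t ha0 ha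
  have hG0 : 0 ≤ a * (logDerivXi χ ⟨1 / 2 + a, t⟩).re := mul_nonneg ha0.le
    (h.re_logDerivXi_nonneg hχ hq (s := ⟨1 / 2 + a, t⟩) (by simp only; linarith))
  have hG' : a * (logDerivXi χ ⟨1 / 2 + a, t⟩).re ≤
      (E + E₂ + a * (Real.log (q * (|t| + 3)) / 2 + C)) / Real.log 2 := by
    rw [le_div_iff₀ (Real.log_pos (by norm_num))]
    linarith
  constructor
  · have e1 : (a - ε) * (ℓ ⟨1 / 2 + a, t⟩).re ≤ a * E :=
      (mul_le_mul_of_nonneg_left h1.2 hae0).trans (mul_le_mul_of_nonneg_right hae hE0)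
    have e2 : (a - ε) ^ 2 / 2 * (Real.log (q * (|t| + 3)) / 2 + C) ≤
        a ^ 2 / 2 * (Real.log (q * (|t| + 3)) / 2 + C) := by gcongr
    linarith
  · have e1 : -((a - ε) * (ℓ ⟨1 / 2 + a, t⟩).re) ≤ a * E := by
      rw [← mul_neg]
      exact (mul_le_mul_of_nonneg_left (by linarith) hae0).trans
        (mul_le_mul_of_nonneg_right hae hE0)
    have e2 : (a - ε) ^ 2 / 2 * C ≤ a ^ 2 / 2 * C := by gcongr
    have e3 : (a - ε) * (a * (logDerivXi χ ⟨1 / 2 + a, t⟩).re) ≤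
        a * ((E + E₂ + a * (Real.log (q * (|t| + 3)) / 2 + C)) / Real.log 2) :=
      mul_le_mul hae hG' hG0 ha0.le
    linarith

theorem continuous_im_vertical (h : IsLogL χ ℓ) {σ : ℝ} (hσ : 1 / 2 < σ) :
    Continuous fun y : ℝ => (ℓ ⟨σ, y⟩).im :=
  continuous_iff_continuousAt.2 fun y =>
    (hasDerivAt_im_of_hasDerivAt (hasDerivAt_vertical (h.hasDerivAt ⟨σ, y⟩ hσ))).continuousAt

/-- The real part of Cauchy's theorem for ℓ on the rectangle with sides Re s = 1/2 + ε and Re s = 3.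
-/
theorem integral_im_vertical (h : IsLogL χ ℓ) {ε : ℝ} (hε : 0 < ε) (t₁ t₂ : ℝ) :
    ∫ y in t₁..t₂, (ℓ ⟨1 / 2 + ε, y⟩).im = (∫ x in ε..(5 / 2), (ℓ ⟨1 / 2 + x, t₂⟩).re) -
      (∫ x in ε..(5 / 2), (ℓ ⟨1 / 2 + x, t₁⟩).re) + ∫ y in t₁..t₂, (ℓ ⟨3, y⟩).im := by
  have hcontV : ∀ {σ : ℝ}, 1 / 2 < σ → Continuous fun y : ℝ => ℓ ⟨σ, y⟩ := fun hσ =>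
    continuous_iff_continuousAt.2 fun y => (hasDerivAt_vertical (h.hasDerivAt ⟨_, y⟩ hσ)).continuousAt
  have hcontH : ∀ t : ℝ, ContinuousOn (fun x : ℝ => ℓ ⟨x, t⟩) (Set.Ioi (1 / 2)) := fun t x hx =>
    (hasDerivAt_horizontal (h.hasDerivAt ⟨x, t⟩ hx)).continuousAt.continuousWithinAt
  have hintH : ∀ t : ℝ, IntervalIntegrable (fun x : ℝ => ℓ ⟨x, t⟩) MeasureTheory.volume (1 / 2 + ε) 3 := fun t =>
    ((hcontH t).mono fun z hz =>
      (lt_min (by linarith) (by norm_num) : 1 / 2 < min (1 / 2 + ε) 3).trans_le hz.1).intervalIntegrable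
  have hshift : ∀ t : ℝ, ∫ x in ε..(5 / 2), (ℓ ⟨1 / 2 + x, t⟩).re =
      (∫ x in (1 / 2 + ε)..3, ℓ ⟨x, t⟩).re := by
    intro t
    rw [intervalIntegral.integral_comp_add_left (fun x => (ℓ ⟨x, t⟩).re)]
    rw [show (1 / 2 + 5 / 2 : ℝ) = 3 by norm_num]
    exact Complex.reCLM.intervalIntegral_comp_comm (hintH t)
  have him : ∀ {σ : ℝ}, 1 / 2 < σ → ∫ y in t₁..t₂, (ℓ ⟨σ, y⟩).im = (∫ y in t₁..t₂, ℓ ⟨σ, y⟩).im :=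
    fun hσ => Complex.imCLM.intervalIntegral_comp_comm ((hcontV hσ).intervalIntegrable _ _)
  have key := Complex.integral_boundary_rect_eq_zero_of_differentiableOn ℓ ⟨1 / 2 + ε, t₁⟩ ⟨3, t₂⟩
    (h.differentiableOn.mono fun z hz => by
      have := hz.1.1
      exact (lt_min (by linarith) (by norm_num) : 1 / 2 < min (1 / 2 + ε) 3).trans_le this)
  simp only [← Complex.mk_eq_add_mul_I] at key
  have hre := congrArg Complex.re key
  simp only [smul_eq_mul, Complex.sub_re, Complex.add_re, Complex.mul_re, Complex.I_re, Complex.I_im,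
    zero_mul, one_mul, zero_sub, Complex.zero_re] at hre
  rw [hshift, hshift, him (by linarith), him (by norm_num)]
  linarith

/-- `arg L` cannot decrease quickly along a vertical line. -/
theorem im_le_im_add (h : IsLogL χ ℓ) (hχ : χ.IsPrimitive) (hq : 1 < q) (hC : ArchBound χ C)
    {σ t t₁ t₂ : ℝ} (hσ : 1 / 2 < σ) (hσ' : σ ≤ 3) (h₁ : |t₁ - t| ≤ 1) (h₂ : |t₂ - t| ≤ 1)
    (h₁₂ : t₁ ≤ t₂) :
    (ℓ ⟨σ, t₁⟩).im ≤ (ℓ ⟨σ, t₂⟩).im +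
      (t₂ - t₁) * ((Real.log (q * (|t| + 3)) + 1) / 2 + C) := by
  set B := (Real.log (q * (|t| + 3)) + 1) / 2 + C with hB
  have hd : ∀ y ∈ Set.Icc t₁ t₂, HasDerivAt (fun y : ℝ => (ℓ ⟨σ, y⟩).im + y * B)
      ((logDerivXi χ ⟨σ, y⟩).re - (logDeriv (archFactor χ) ⟨σ, y⟩).re + 1 * B) y := by
    intro y _
    refine ((hasDerivAt_im_of_hasDerivAt (hasDerivAt_vertical (h.hasDerivAt ⟨σ, y⟩ hσ))).add
      ((hasDerivAt_id y).mul_const B)).congr_deriv ?_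
    rw [logDerivXi, Complex.add_re]
    simp
  have hmono : MonotoneOn (fun y : ℝ => (ℓ ⟨σ, y⟩).im + y * B) (Set.Icc t₁ t₂) := by
    refine monotoneOn_of_deriv_nonneg (convex_Icc _ _)
      (fun x hx => (hd x hx).continuousAt.continuousWithinAt)
      (fun x hx => (hd x (interior_subset hx)).differentiableAt.differentiableWithinAt)
      (fun x hx => ?_)
    have hx := interior_subset hx
    rw [(hd x hx).deriv]
    have h1 := h.re_logDerivXi_nonneg hχ hq (s := ⟨σ, x⟩) hσ
    have h2 := (abs_le.1 (hC σ x hσ.le hσ')).2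
    have h3 : |x - t| ≤ 1 := by
      rw [abs_le] at h₁ h₂ ⊢
      exact ⟨by linarith [hx.1], by linarith [hx.2]⟩
    have h4 := log_le_logWeight hq t x
    have h5 : Real.log (1 + |x - t|) ≤ |x - t| := by
      have := Real.log_le_sub_one_of_pos (show 0 < 1 + |x - t| by positivity)
      linarith
    rw [logWeight] at h4
    linarith
  have := hmono (Set.left_mem_Icc.2 h₁₂) (Set.right_mem_Icc.2 h₁₂) h₁₂
  simp only at this
  linarith

/-- From bounds for the horizontal integrals of `log |L|` to bounds for `arg L`. -/
theorem abs_im_le_of_integral_bounds (h : IsLogL χ ℓ) (hχ : χ.IsPrimitive) (hq : 1 < q)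
    (hC : ArchBound χ C) {ε t η P N : ℝ} (hε : 0 < ε) (hε' : ε ≤ 5 / 2) (hη : 0 < η) (hη' : η ≤ 1)
    (hP : ∀ y, |y - t| ≤ η → (∫ x in ε..(5 / 2), (ℓ ⟨1 / 2 + x, y⟩).re) ≤ P)
    (hN : ∀ y, |y - t| ≤ η → -(∫ x in ε..(5 / 2), (ℓ ⟨1 / 2 + x, y⟩).re) ≤ N) :
    |(ℓ ⟨1 / 2 + ε, t⟩).im| ≤
      (P + N) / η + η / 2 * ((Real.log (q * (|t| + 3)) + 1) / 2 + C) + 1 := by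
  set B := (Real.log (q * (|t| + 3)) + 1) / 2 + C with hB
  have hσ : 1 / 2 < 1 / 2 + ε := by linarith
  have hcont := h.continuous_im_vertical hσ
  have hright : ∀ t₁ t₂ : ℝ, t₁ ≤ t₂ → |∫ y in t₁..t₂, (ℓ ⟨3, y⟩).im| ≤ 1 * (t₂ - t₁) := by
    intro t₁ t₂ h12
    have := intervalIntegral.norm_integral_le_of_norm_le_const (a := t₁) (b := t₂) (C := 1)
      (f := fun y => (ℓ ⟨3, y⟩).im) fun y _ =>
        (Complex.abs_im_le_norm _).trans (h.norm_le_one (by norm_num))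
    rwa [abs_of_nonneg (by linarith : 0 ≤ t₂ - t₁)] at this
  have hlin : ∀ t₁ t₂ c : ℝ, ∫ y in t₁..t₂, (c - (y - t) * B) =
      (t₂ - t₁) * c - ((t₂ - t) ^ 2 - (t₁ - t) ^ 2) / 2 * B := by
    intro t₁ t₂ c
    rw [intervalIntegral.integral_sub (by simp) (by apply Continuous.intervalIntegrable; fun_prop),
      intervalIntegral.integral_const, intervalIntegral.integral_mul_const,
      intervalIntegral.integral_comp_sub_right (fun y => y)]
    simp
  have e : (P + N) / η + η / 2 * B + 1 = (P + N + η ^ 2 / 2 * B + η) / η := by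
    field_simp
  rw [e, le_div_iff₀ hη]
  have habs : ∀ {x : ℝ}, -η ≤ x → x ≤ η → |x| ≤ 1 := fun h1 h2 => (abs_le.2 ⟨h1, h2⟩).trans hη'
  set V := (ℓ ⟨1 / 2 + ε, t⟩).im with hV
  -- A large positive value persists to the right of t because arg L cannot drop quickly; a large
  -- negative value persists to the left. Each one-sided mean is a difference of two horizontal
  -- integrals, hence P + N, and the edge Re s = 3 contributes at most η.
  have hupper : V * η ≤ P + N + η ^ 2 / 2 * B + η := by
    have h1 : ∫ y in t..(t + η), (V - (y - t) * B) ≤ ∫ y in t..(t + η), (ℓ ⟨1 / 2 + ε, y⟩).im := by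
      refine intervalIntegral.integral_mono_on (by linarith)
        (by apply Continuous.intervalIntegrable; fun_prop) (hcont.intervalIntegrable _ _) ?_
      intro y hy
      have := h.im_le_im_add hχ hq hC (t := t) (t₁ := t) (t₂ := y) hσ (by linarith) (by simp)
        (habs (by linarith [hy.1]) (by linarith [hy.2])) hy.1
      rw [← hV, ← hB] at this
      linarith
    have h2 : ∫ y in t..(t + η), (V - (y - t) * B) = η * V - η ^ 2 / 2 * B := by
      rw [hlin]; ring
    have h3 := h.integral_im_vertical hε t (t + η)
    have h4 := (abs_le.1 (hright t (t + η) (by linarith))).2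
    have h5 := hP (t + η) (by simp [abs_of_pos hη])
    have h6 := hN t (by simp [hη.le])
    linarith
  have hlower : -V * η ≤ P + N + η ^ 2 / 2 * B + η := by
    have h1 : ∫ y in (t - η)..t, (ℓ ⟨1 / 2 + ε, y⟩).im ≤ ∫ y in (t - η)..t, (V - (y - t) * B) := by
      refine intervalIntegral.integral_mono_on (by linarith) (hcont.intervalIntegrable _ _)
        (by apply Continuous.intervalIntegrable; fun_prop) ?_
      intro y hy
      have := h.im_le_im_add hχ hq hC (t := t) (t₁ := y) (t₂ := t) hσ (by linarith)
        (habs (by linarith [hy.1]) (by linarith [hy.2])) (by simp) hy.2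
      rw [← hV, ← hB] at this
      linarith
    have h2 : ∫ y in (t - η)..t, (V - (y - t) * B) = η * V + η ^ 2 / 2 * B := by
      rw [hlin]; ring
    have h3 := h.integral_im_vertical hε (t - η) t
    have h4 := (abs_le.1 (hright (t - η) t (by linarith))).1
    have h5 := hP (t - η) (by simp [abs_of_pos hη])
    have h6 := hN t (by simp [hη.le])
    linarith
  rcases abs_cases V with ⟨hv, _⟩ | ⟨hv, _⟩ <;> rw [hv] <;> assumption

end DirichletCharacter.IsLogL

/-! ### Numerical bounds for arg L -/

theorem IsLargeScale.self_le_div_sq {C M : ℝ} (h : IsLargeScale C M) :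
    M ≤ 0.001 * ((1 / M) ^ 2 * Real.exp M) := by
  have hM := h.pos
  have h1 : M ≤ Real.exp 2 * Real.exp (0.995 * M) := by
    nlinarith [Real.add_one_le_exp 2, Real.add_one_le_exp (0.995 * M), h.le_self]
  have h2 : M * M ≤ 0.001 / M * Real.exp M := (mul_le_mul_of_nonneg_right h1 hM.le).trans h.exp_le
  calc M = M * M * (1 / M) := by field_simp
    _ ≤ 0.001 / M * Real.exp M * (1 / M) := by gcongr
    _ = _ := by ring

theorem integral_exp_neg_mul_le {c a b : ℝ} (hc : 0 < c) :
    ∫ x in a..b, Real.exp (-c * (x - a)) ≤ 1 / c := by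
  have hd : ∀ x ∈ Set.uIcc a b, HasDerivAt (fun x => -(1 / c) * Real.exp (-c * (x - a)))
      (Real.exp (-c * (x - a))) x := by
    intro x _
    refine (((((hasDerivAt_id x).sub_const a).const_mul (-c)).exp).const_mul (-(1 / c))).congr_deriv ?_
    simp only [id]
    field_simp
  rw [intervalIntegral.integral_eq_sub_of_hasDerivAt hd
    (by apply Continuous.intervalIntegrable; fun_prop)]
  simp only [sub_self, mul_zero, Real.exp_zero]
  have : 0 ≤ 1 / c * Real.exp (-c * (b - a)) := by positivity
  linarith

namespace DirichletCharacter.IsLogL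

variable {q : ℕ} [NeZero q] {χ : DirichletCharacter ℂ q} {ℓ : ℂ → ℂ} {C : ℝ}

theorem log_le_log_add_one {q : ℕ} (hq : 1 < q) {t y : ℝ} (hy : |y - t| ≤ 1) :
    Real.log (q * (|y| + 3)) ≤ Real.log (q * (|t| + 3)) + 1 := by
  have h1 := log_le_logWeight hq t y
  have h2 := Real.log_le_sub_one_of_pos (show 0 < 1 + |y - t| by positivity)
  rw [logWeight] at h1
  linarith

/-- A bound for `arg L` near the critical line that is uniform in all parameters. -/
theorem abs_im_le_mul_log (h : IsLogL χ ℓ) (hχ : χ.IsPrimitive) (hq : 1 < q) (hC : ArchBound χ C)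
    (hC0 : 0 ≤ C) {ε : ℝ} (hε : 0 < ε) (hε' : ε ≤ 1) (t : ℝ) :
    |(ℓ ⟨1 / 2 + ε, t⟩).im| ≤ (30 + 5 * C) * Real.log (q * (|t| + 3)) := by
  set L := Real.log (q * (|t| + 3)) with hL
  have hL1 : 1 ≤ L := one_le_log hq t
  have hbd : ∀ x y : ℝ, 1 ≤ x → |(ℓ ⟨1 / 2 + x, y⟩).re| ≤ 2 := by
    intro x y hx
    refine (Complex.abs_re_le_norm _).trans ((h.norm_le_inv ⟨1 / 2 + x, y⟩ ?_).trans ?_)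
    · change 1 < 1 / 2 + x
      linarith
    · change 1 / (1 / 2 + x - 1) ≤ 2
      rw [div_le_iff₀ (by linarith)]
      linarith
  have hE₃ : ∀ y : ℝ, |∫ x in (1 : ℝ)..(5 / 2), (ℓ ⟨1 / 2 + x, y⟩).re| ≤ 3 := by
    intro y
    have := intervalIntegral.norm_integral_le_of_norm_le_const (a := (1 : ℝ)) (b := 5 / 2) (C := 2)
      (f := fun x => (ℓ ⟨1 / 2 + x, y⟩).re) fun x hx => by
        rw [Set.uIoc_of_le (by norm_num)] at hx
        exact hbd x y hx.1.le
    refine this.trans ?_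
    norm_num [abs_of_pos]
  have hB := fun y => h.integral_re_bounds hχ hq hC hC0 (t := y) hε hε' (by norm_num)
    (hbd 1 y le_rfl) (hbd (2 * 1) y (by norm_num)) (hE₃ y)
  have hlog2 : (1 / 2 : ℝ) < Real.log 2 := by linarith [Real.log_two_gt_d9]
  refine (h.abs_im_le_of_integral_bounds hχ hq hC (t := t) (η := 1)
    (P := 1 * 2 + 1 ^ 2 / 2 * ((L + 1) / 2 + C) + 3)
    (N := 1 * 2 + 1 ^ 2 / 2 * C + 1 * ((2 + 2 + 1 * ((L + 1) / 2 + C)) / (1 / 2)) + 3)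
    hε (by linarith) one_pos le_rfl (fun y hy => (hB y).1.trans ?_)
    (fun y hy => (hB y).2.trans ?_)).trans ?_
  · have := log_le_log_add_one hq hy
    linarith
  · have h1 := log_le_log_add_one hq hy
    have h2 := one_le_log hq y
    gcongr
  · rw [← hL]
    nlinarith

/-- Up to Re s = 1 + 1/M the exponential decay integrates to 0.25/1.99 < 0.126 times the weight over
M²; beyond, |ℓ| ≤ M on a length below 2. -/
theorem abs_integral_re_tail_le (h : IsLogL χ ℓ) (hχ : χ.IsPrimitive) (hq : 1 < q)
    (hC : ArchBound χ C) (hC0 : 0 ≤ C) {M t y : ℝ} (hM : IsLargeScale C M)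
    (hMt : Real.exp M = Real.log (q * (|t| + 3))) :
    |∫ x in (2 / M)..(5 / 2), (ℓ ⟨1 / 2 + x, y⟩).re| ≤
      0.126 * (1 / M) ^ 2 * logWeight (Real.exp M) t y + 2 * M := by
  have hM0 := hM.pos
  have hi : 1 / M ≤ 1 / 4000 := one_div_le_one_div_of_le (by norm_num) hM.le_self
  have hi0 : 0 < 1 / M := by positivity
  have ha : 2 / M = 2 * (1 / M) := by ring
  set w := logWeight (Real.exp M) t y with hw
  have hw0 : 0 < w := (Real.exp_pos M).trans_le (le_logWeight _ _ _)
  rw [← intervalIntegral.integral_add_adjacent_intervals (b := 1 / 2 + 1 / M)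
    (h.intervalIntegrable_re_shift y (by positivity) (by positivity))
    (h.intervalIntegrable_re_shift y (by positivity) (by positivity))]
  refine (abs_add_le _ _).trans (add_le_add ?_ ?_)
  · have hcont : Continuous fun x : ℝ =>
        Real.exp (-(1.99 * M) * (x - 2 / M)) * (0.25 / M * w) := by fun_prop
    have h1 : |∫ x in (2 / M)..(1 / 2 + 1 / M), (ℓ ⟨1 / 2 + x, y⟩).re| ≤
        ∫ x in (2 / M)..(1 / 2 + 1 / M), Real.exp (-(1.99 * M) * (x - 2 / M)) * (0.25 / M * w) := by
      rw [← Real.norm_eq_abs]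
      refine intervalIntegral.norm_integral_le_of_norm_le (by linarith)
        (MeasureTheory.ae_of_all _ fun x hx => ?_)
        (hcont.intervalIntegrable _ _)
      have := h.norm_le_decay hχ hq hC hC0 hM hMt (s := ⟨1 / 2 + x, y⟩)
        (show 1 / 2 + 2 / M ≤ 1 / 2 + x by linarith [hx.1])
        (show 1 / 2 + x ≤ 1 + 1 / M by linarith [hx.2])
      refine (Complex.abs_re_le_norm _).trans (this.trans_eq ?_)
      simp only [add_sub_add_left_eq_sub]
      rw [hw]
    refine h1.trans ?_
    rw [intervalIntegral.integral_mul_const]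
    calc _ ≤ 1 / (1.99 * M) * (0.25 / M * w) := by
          gcongr
          exact integral_exp_neg_mul_le (by positivity)
      _ = 0.25 / 1.99 * (1 / M) ^ 2 * w := by field_simp
      _ ≤ _ := by gcongr; norm_num
  · have := intervalIntegral.norm_integral_le_of_norm_le_const (a := 1 / 2 + 1 / M) (b := 5 / 2)
      (C := M) (f := fun x => (ℓ ⟨1 / 2 + x, y⟩).re) fun x hx => by
        rw [Set.uIoc_of_le (by linarith)] at hx
        refine (Complex.abs_re_le_norm _).trans (h.norm_le_of_right hM ?_)
        change 1 + 1 / M ≤ 1 / 2 + x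
        linarith [hx.1]
    refine this.trans ?_
    rw [abs_of_nonneg (by linarith)]
    nlinarith

/-- The main bound for `arg L` near the critical line. -/
theorem abs_im_le (h : IsLogL χ ℓ) (hχ : χ.IsPrimitive) (hq : 1 < q) (hC : ArchBound χ C)
    (hC0 : 0 ≤ C) {M t ε : ℝ} (hM : IsLargeScale C M)
    (hMt : Real.exp M = Real.log (q * (|t| + 3))) (hε : 0 < ε) (hε' : ε ≤ 2 / M) :
    |(ℓ ⟨1 / 2 + ε, t⟩).im| ≤ 2.45 * (1 / M * Real.exp M) := by
  have hM0 := hM.pos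
  have hi : 1 / M ≤ 1 / 4000 := one_div_le_one_div_of_le (by norm_num) hM.le_self
  set i := 1 / M with hidef
  have hi0 : 0 < i := by positivity
  have ha : 2 / M = 2 * i := by rw [hidef]; ring
  set L := Real.exp M with hLdef
  have hL := hM.const_le_exp
  rw [← hLdef] at hL
  have hCL : C ≤ 0.000125 * L := by have := hM.const_le; rw [← hLdef] at this; linarith
  have hML := hM.self_le_div_sq
  rw [← hidef, ← hLdef] at hML
  have hlog2 : (0.6931 : ℝ) ≤ Real.log 2 := by linarith [Real.log_two_gt_d9]
  have hwt : ∀ y, |y - t| ≤ 5 * i → logWeight L t y ≤ 1.0003 * L := by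
    intro y hy
    have := logWeight_add_le L t t (y - t)
    rw [add_sub_cancel] at this
    simp only [logWeight, sub_self, abs_zero, add_zero, Real.log_one] at this ⊢
    linarith
  have hb : ∀ y, |y - t| ≤ 5 * i → Real.log (q * (|y| + 3)) / 2 + C ≤ 0.5003 * L := by
    intro y hy
    have h1 := log_le_log_add_one hq (t := t) (y := y) (by linarith)
    rw [← hMt] at h1
    linarith
  have hE : ∀ y, |y - t| ≤ 5 * i → |(ℓ ⟨1 / 2 + 2 * i, y⟩).re| ≤ 0.2501 * (i * L) := by
    intro y hy
    have := h.norm_le_mul_logWeight hχ hq hC hC0 hM hMt (s := ⟨1 / 2 + 2 * i, y⟩) (by rw [ha])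
    refine (Complex.abs_re_le_norm _).trans (this.trans ?_)
    calc 0.25 / M * logWeight L t y ≤ 0.25 / M * (1.0003 * L) := by
          gcongr
          exact hwt y hy
      _ = 0.250075 * (i * L) := by rw [hidef]; ring
      _ ≤ _ := by gcongr; norm_num
  have hE₂ : ∀ y, |y - t| ≤ 5 * i → |(ℓ ⟨1 / 2 + 2 * (2 * i), y⟩).re| ≤ 0.013 * (i * L) := by
    intro y hy
    have := h.norm_le_decay hχ hq hC hC0 hM hMt (s := ⟨1 / 2 + 2 * (2 * i), y⟩)
      (show 1 / 2 + 2 / M ≤ 1 / 2 + 2 * (2 * i) by linarith)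
      (show 1 / 2 + 2 * (2 * i) ≤ 1 + 1 / M by linarith)
    refine (Complex.abs_re_le_norm _).trans (this.trans ?_)
    have e1 : -(1.99 * M) * (1 / 2 + 2 * (2 * i) - (1 / 2 + 2 / M)) ≤ -2.985 := by
      rw [hidef]; field_simp; norm_num
    calc _ ≤ Real.exp (-2.985) * (0.25 / M * logWeight L t y) := by
          gcongr
          exact mul_nonneg (by positivity) ((Real.exp_pos M).le.trans (le_logWeight _ _ _))
      _ ≤ 0.0507 * (0.25 / M * (1.0003 * L)) := by
          gcongr
          · exact mul_nonneg (by positivity) ((Real.exp_pos M).le.trans (le_logWeight _ _ _))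
          · exact exp_neg_two_point_nine_eight_five_le
          · exact hwt y hy
      _ = 0.0507 * 0.25 * 1.0003 * (i * L) := by rw [hidef]; ring
      _ ≤ _ := by gcongr; norm_num
  have hE₃ : ∀ y, |y - t| ≤ 5 * i →
      |∫ x in (2 * i)..(5 / 2), (ℓ ⟨1 / 2 + x, y⟩).re| ≤ 0.129 * (i ^ 2 * L) := by
    intro y hy
    have := h.abs_integral_re_tail_le hχ hq hC hC0 (y := y) hM hMt
    rw [ha] at this
    refine this.trans ?_
    have h2 : 0.126 * (1 / M) ^ 2 * logWeight (Real.exp M) t y ≤ 0.126 * i ^ 2 * (1.0003 * L) := by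
      rw [← hidef]
      gcongr
      exact hwt y hy
    have h3 : 0 ≤ i ^ 2 * L := by positivity
    linarith
  rw [ha] at hε'
  have hB := fun y hy => h.integral_re_bounds hχ hq hC hC0 (t := y) hε hε' (by linarith)
    (hE y hy) (hE₂ y hy) (hE₃ y hy)
  have hLi : 0 ≤ i ^ 2 * L := by positivity
  have hLi' : 0 ≤ i * L := by positivity
  -- With i = 1/M and L = e^M, the bound for η = κi is (5.93/κ + κ/4) iL up to small errors. The
  -- choice κ = 5 is close to the minimiser 2√5.93.
  refine (h.abs_im_le_of_integral_bounds hχ hq hC (t := t) (η := 5 * i)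
    (P := 1.64 * (i ^ 2 * L)) (N := 4.29 * (i ^ 2 * L))
    hε (by linarith) (by positivity) (by linarith) (fun y hy => (hB y hy).1.trans ?_)
    (fun y hy => (hB y hy).2.trans ?_)).trans ?_
  · have h1 : (2 * i) ^ 2 / 2 * (Real.log (q * (|y| + 3)) / 2 + C) ≤
        (2 * i) ^ 2 / 2 * (0.5003 * L) := by
      gcongr
      exact hb y hy
    linarith
  · have h1 : (2 * i) ^ 2 / 2 * C ≤ (2 * i) ^ 2 / 2 * (0.000125 * L) := by gcongr
    have h2 : 2 * i * ((0.2501 * (i * L) + 0.013 * (i * L) +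
        2 * i * (Real.log (q * (|y| + 3)) / 2 + C)) / Real.log 2) ≤
        2 * i * ((0.2501 * (i * L) + 0.013 * (i * L) + 2 * i * (0.5003 * L)) / 0.6931) := by
      gcongr
      exact hb y hy
    have h3 : 2 * i * ((0.2501 * (i * L) + 0.013 * (i * L) + 2 * i * (0.5003 * L)) / 0.6931) =
        2 * 1.2637 / 0.6931 * (i ^ 2 * L) := by ring
    have h4 : 2 * 1.2637 / 0.6931 * (i ^ 2 * L) ≤ 3.65 * (i ^ 2 * L) := by gcongr; norm_num
    linarith
  · rw [← hMt]
    have h1 : (1.64 * (i ^ 2 * L) + 4.29 * (i ^ 2 * L)) / (5 * i) = 1.186 * (i * L) := by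
      field_simp; norm_num
    have h2 : 5 * i / 2 * ((L + 1) / 2 + C) ≤ 5 * i / 2 * (0.5003 * L) := by
      gcongr; linarith
    have h3 : 1 ≤ 0.001 * (i * L) := by
      have := hM.self_le
      have e : 0.001 / M * Real.exp M = 0.001 * (i * L) := by rw [hidef]; ring
      rw [e] at this
      linarith [hM.le_self]
    rw [h1]
    linarith

end DirichletCharacter.IsLogL

/-! ### Continuous variation of the argument and its jumps at zeros -/

/-- Two continuous logarithms of the same function up to a constant factor differ by a constant on a
preconnected set. -/
theorem eq_of_exp_eq_const_on {X : Type*} [TopologicalSpace X] {S : Set X} (hS : IsPreconnected S)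
    {f : X → ℂ} {c : ℂ} (hf : ContinuousOn f S) (hexp : ∀ x ∈ S, Complex.exp (f x) = c) {x y : X}
    (hx : x ∈ S) (hy : y ∈ S) : f x = f y :=
  Complex.isCoveringMap_exp.constOn_of_comp hS hf
    (fun a ha b hb => Subtype.ext ((hexp a ha).trans (hexp b hb).symm)) hx hy

theorem continuous_mk_re (t : ℝ) : Continuous fun σ : ℝ => (⟨σ, t⟩ : ℂ) := by
  simp only [Complex.mk_eq_add_mul_I]; fun_prop

theorem continuous_mk_im (σ : ℝ) : Continuous fun t : ℝ => (⟨σ, t⟩ : ℂ) := by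
  simp only [Complex.mk_eq_add_mul_I]; fun_prop

namespace DirichletCharacter

variable {q : ℕ} [NeZero q] {χ : DirichletCharacter ℂ q}

/-- Two arguments differ by a continuous function with values in 2πℤ, hence by a constant, which is
0 by the limit at infinity. Thus the choice made in `argL` is immaterial. -/
theorem isArgL_unique {t θ₁ θ₂ : ℝ} (hne : ∀ σ : ℝ, 1 / 2 ≤ σ → LFunction χ ⟨σ, t⟩ ≠ 0)
    (h₁ : IsArgL χ t θ₁) (h₂ : IsArgL χ t θ₂) : θ₁ = θ₂ := by
  obtain ⟨φ₁, hc₁, hl₁, he₁, rfl⟩ := h₁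
  obtain ⟨φ₂, hc₂, hl₂, he₂, rfl⟩ := h₂
  have hexp : ∀ σ ∈ Set.Ici (1 / 2 : ℝ),
      Complex.exp (((φ₁ σ : ℂ) - φ₂ σ) * Complex.I) = 1 := by
    intro σ hσ
    have h1 := he₁ σ hσ
    rw [he₂ σ hσ] at h1
    have h0 : (‖LFunction χ ⟨σ, t⟩‖ : ℂ) ≠ 0 := by
      simpa using hne σ hσ
    have hn : ‖(‖LFunction χ ⟨σ, t⟩‖ : ℂ) * Complex.exp ((φ₂ σ : ℂ) * Complex.I)‖ =
        ‖LFunction χ ⟨σ, t⟩‖ := by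
      rw [norm_mul, Complex.norm_exp_ofReal_mul_I]; simp
    rw [hn] at h1
    rw [sub_mul, Complex.exp_sub, mul_left_cancel₀ h0 h1, div_self (Complex.exp_ne_zero _)]
  have hcont : ContinuousOn (fun σ : ℝ => ((φ₁ σ : ℂ) - φ₂ σ) * Complex.I) (Set.Ici (1 / 2)) := by
    refine ContinuousOn.mul (ContinuousOn.sub ?_ ?_) continuousOn_const
    · exact Complex.continuous_ofReal.comp_continuousOn hc₁
    · exact Complex.continuous_ofReal.comp_continuousOn hc₂
  have hconst : ∀ σ ∈ Set.Ici (1 / 2 : ℝ), φ₁ σ - φ₂ σ = φ₁ (1 / 2) - φ₂ (1 / 2) := by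
    intro σ hσ
    have := eq_of_exp_eq_const_on isPreconnected_Ici hcont hexp hσ
      (Set.mem_Ici.2 (le_refl (1 / 2 : ℝ)))
    have := mul_right_cancel₀ Complex.I_ne_zero this
    exact_mod_cast this
  have hlim : Tendsto (fun σ => φ₁ σ - φ₂ σ) atTop (𝓝 (0 - 0)) := hl₁.sub hl₂
  have hlim' : Tendsto (fun σ => φ₁ σ - φ₂ σ) atTop (𝓝 (φ₁ (1 / 2) - φ₂ (1 / 2))) :=
    tendsto_const_nhds.congr' (by
      filter_upwards [eventually_ge_atTop (1 / 2 : ℝ)] with σ hσ using (hconst σ hσ).symm)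
  have := tendsto_nhds_unique hlim hlim'
  linarith

namespace IsLogL

variable {ℓ : ℂ → ℂ}

/-- Im ℓ is the required argument for σ > 1/2. Redefining it as its limit at the endpoint keeps it
continuous, and the polar identity passes to the limit. -/
theorem isArgL_of_tendsto (h : IsLogL χ ℓ) (hχ : χ ≠ 1) {t θ : ℝ}
    (hθ : Tendsto (fun σ : ℝ => (ℓ ⟨σ, t⟩).im) (𝓝[>] (1 / 2)) (𝓝 θ)) : IsArgL χ t θ := by
  have hv : ∀ σ : ℝ, 1 / 2 < σ → ContinuousAt (fun σ : ℝ => (ℓ ⟨σ, t⟩).im) σ := fun σ hσ =>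
    (hasDerivAt_im_of_hasDerivAt (hasDerivAt_horizontal (h.hasDerivAt ⟨σ, t⟩ hσ))).continuousAt
  have hpolar : ∀ σ : ℝ, 1 / 2 < σ → LFunction χ ⟨σ, t⟩ =
      (‖LFunction χ ⟨σ, t⟩‖ : ℂ) * Complex.exp (((ℓ ⟨σ, t⟩).im : ℂ) * Complex.I) := by
    intro σ hσ
    rw [← h.exp_eq ⟨σ, t⟩ hσ, Complex.norm_exp, Complex.ofReal_exp, ← Complex.exp_add,
      Complex.re_add_im]
  refine ⟨Function.update (fun σ : ℝ => (ℓ ⟨σ, t⟩).im) (1 / 2) θ, ?_, ?_, ?_, by simp⟩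
  · intro σ hσ
    rcases eq_or_lt_of_le (show 1 / 2 ≤ σ from hσ) with rfl | hσ
    · rw [continuousWithinAt_update_same, Set.Ici_sdiff_left]
      exact hθ
    · refine ((hv σ hσ).congr ?_).continuousWithinAt
      filter_upwards [lt_mem_nhds hσ] with x hx
      rw [Function.update_of_ne hx.ne']
  · have h1 : Tendsto (fun σ : ℝ => (2 : ℝ) ^ (2 - σ)) atTop (𝓝 0) := by
      have := (tendsto_rpow_atBot_of_base_gt_one 2 (by norm_num)).comp
        (tendsto_atBot_add_const_left atTop (2 : ℝ) tendsto_neg_atTop_atBot)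
      exact this.congr fun σ => by simp [sub_eq_add_neg]
    refine squeeze_zero_norm' ?_ h1
    filter_upwards [eventually_ge_atTop (2 : ℝ)] with σ hσ
    rw [Function.update_of_ne (by linarith)]
    exact (Complex.abs_im_le_norm _).trans (h.norm_le_two_rpow ⟨σ, t⟩ hσ)
  · intro σ hσ
    rcases eq_or_lt_of_le hσ with rfl | hσ
    · rw [Function.update_self]
      have hL : Tendsto (fun σ : ℝ => LFunction χ ⟨σ, t⟩) (𝓝[>] (1 / 2))
          (𝓝 (LFunction χ ⟨1 / 2, t⟩)) :=
        (((differentiable_LFunction hχ).continuous.comp (continuous_mk_re t)).tendsto _).mono_left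
          nhdsWithin_le_nhds
      have hR : Tendsto (fun σ : ℝ => (‖LFunction χ ⟨σ, t⟩‖ : ℂ) *
          Complex.exp (((ℓ ⟨σ, t⟩).im : ℂ) * Complex.I)) (𝓝[>] (1 / 2))
          (𝓝 ((‖LFunction χ ⟨1 / 2, t⟩‖ : ℂ) * Complex.exp ((θ : ℂ) * Complex.I))) := by
        refine Tendsto.mul ((Complex.continuous_ofReal.tendsto _).comp hL.norm) ?_
        exact (Complex.continuous_exp.tendsto _).comp
          (((Complex.continuous_ofReal.tendsto _).comp hθ).mul_const _)
      refine tendsto_nhds_unique hL (hR.congr' ?_)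
      filter_upwards [self_mem_nhdsWithin] with σ hσ using (hpolar σ hσ).symm
    · rw [Function.update_of_ne hσ.ne']
      exact hpolar σ hσ

theorem argL_eq (h : IsLogL χ ℓ) (hχ : χ ≠ 1) {t θ : ℝ} (hL : LFunction χ ⟨1 / 2, t⟩ ≠ 0)
    (hθ : Tendsto (fun σ : ℝ => (ℓ ⟨σ, t⟩).im) (𝓝[>] (1 / 2)) (𝓝 θ)) : argL χ t = θ := by
  have hex : ∃ θ : ℝ, IsArgL χ t θ := ⟨θ, h.isArgL_of_tendsto hχ hθ⟩
  rw [argL, dif_pos hex]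
  refine isArgL_unique (fun σ hσ => ?_) hex.choose_spec (h.isArgL_of_tendsto hχ hθ)
  rcases eq_or_lt_of_le hσ with rfl | hσ
  · exact hL
  · exact h.ne_zero hσ

/-- The shape of `log L` near a point of the critical line. -/
theorem exists_local_log (h : IsLogL χ ℓ) (hχ : χ ≠ 1) (t : ℝ) :
    ∃ r > 0, ∃ m : ℕ, ∃ k : ℂ → ℂ, ContinuousOn k (Metric.ball ⟨1 / 2, t⟩ r) ∧
      (LFunction χ ⟨1 / 2, t⟩ ≠ 0 → m = 0) ∧
      (∀ s ∈ Metric.ball (⟨1 / 2, t⟩ : ℂ) r, s ≠ ⟨1 / 2, t⟩ → LFunction χ s ≠ 0) ∧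
      ∀ s ∈ Metric.ball (⟨1 / 2, t⟩ : ℂ) r, 1 / 2 < s.re →
        ℓ s = m * Complex.log (s - ⟨1 / 2, t⟩) + k s := by
  set ρ : ℂ := ⟨1 / 2, t⟩ with hρ
  have han : AnalyticAt ℂ (LFunction χ) ρ := (differentiable_LFunction hχ).analyticAt ρ
  have hne : ¬∀ᶠ z in 𝓝 ρ, LFunction χ z = 0 := by
    intro hz
    have h1 : Tendsto (fun σ : ℝ => (⟨σ, t⟩ : ℂ)) (𝓝[>] (1 / 2)) (𝓝 ρ) :=
      ((continuous_mk_re t).tendsto _).mono_left nhdsWithin_le_nhds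
    obtain ⟨σ, hσ, hσ'⟩ := ((h1.eventually hz).and self_mem_nhdsWithin).exists
    exact h.ne_zero (s := ⟨σ, t⟩) hσ' hσ
  obtain ⟨m, g, hg, hg0, hLg⟩ := han.exists_eventuallyEq_pow_smul_nonzero_iff.2 hne
  have hslit : ∀ᶠ s in 𝓝 ρ, g s / g ρ ∈ Complex.slitPlane := by
    refine (hg.continuousAt.div_const (g ρ)).eventually_mem
      (Complex.isOpen_slitPlane.mem_nhds ?_)
    simp [div_self hg0]
  obtain ⟨r, hr, hball⟩ := Metric.eventually_nhds_iff_ball.1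
    ((hslit.and hg.eventually_continuousAt).and hLg)
  have hgne : ∀ s ∈ Metric.ball ρ r, g s ≠ 0 := by
    intro s hs h0
    have := (hball s hs).1.1
    simp [h0] at this
  set k₀ : ℂ → ℂ := fun s => Complex.log (g s / g ρ) with hk₀
  have hk₀c : ContinuousOn k₀ (Metric.ball ρ r) := fun s hs =>
    (((hball s hs).1.2.div_const (g ρ)).clog (hball s hs).1.1).continuousWithinAt
  set S : Set ℂ := Metric.ball ρ r ∩ {s | 1 / 2 < s.re} with hS
  have hSconn : IsPreconnected S :=
    ((convex_ball ρ r).inter (convex_halfSpace_re_gt (1 / 2))).isPreconnected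
  have hslit' : ∀ s : ℂ, 1 / 2 < s.re → s - ρ ∈ Complex.slitPlane := by
    intro s hs
    left
    simp only [hρ, Complex.sub_re]
    linarith
  -- With L(s) = (s - ρ)^m g(s), the exponential of D is the constant g(ρ), so D is constant on the
  -- convex half-disc. To the right of ρ the principal logarithm of s - ρ is continuous.
  set D : ℂ → ℂ := fun s => ℓ s - (m * Complex.log (s - ρ) + k₀ s) with hD
  have hDc : ContinuousOn D S := by
    refine ContinuousOn.sub (h.differentiableOn.continuousOn.mono fun s hs => hs.2) ?_
    refine ContinuousOn.add (ContinuousOn.mul continuousOn_const ?_)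
      (hk₀c.mono Set.inter_subset_left)
    exact ContinuousOn.clog (by fun_prop) fun s hs => hslit' s hs.2
  have hDexp : ∀ s ∈ S, Complex.exp (D s) = g ρ := by
    intro s hs
    have h1 : s - ρ ≠ 0 := Complex.slitPlane_ne_zero (hslit' s hs.2)
    have h2 := hgne s hs.1
    simp only [hD, hk₀]
    rw [Complex.exp_sub, h.exp_eq s hs.2, Complex.exp_add, Complex.exp_nat_mul, Complex.exp_log h1,
      Complex.exp_log (div_ne_zero h2 hg0), (hball s hs.1).2, smul_eq_mul]
    field_simp
  have hp : (⟨1 / 2 + r / 2, t⟩ : ℂ) ∈ S := by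
    refine ⟨?_, ?_⟩
    · rw [mem_ball_iff_norm]
      have : (⟨1 / 2 + r / 2, t⟩ : ℂ) - ρ = ((r / 2 : ℝ) : ℂ) := by
        apply Complex.ext <;> simp [hρ]
      rw [this, Complex.norm_real, Real.norm_eq_abs, abs_of_pos (by positivity)]
      linarith
    · change 1 / 2 < 1 / 2 + r / 2
      linarith
  refine ⟨r, hr, m, fun s => k₀ s + D ⟨1 / 2 + r / 2, t⟩, hk₀c.add continuousOn_const, ?_, ?_, ?_⟩
  · intro hL
    by_contra hm
    apply hL
    rw [(hball ρ (Metric.mem_ball_self hr)).2, sub_self, zero_pow hm, zero_smul]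
  · intro s hs hsρ
    rw [(hball s hs).2, smul_eq_mul]
    exact mul_ne_zero (pow_ne_zero _ (sub_ne_zero.2 hsρ)) (hgne s hs)
  · intro s hs hs'
    have := eq_of_exp_eq_const_on hSconn hDc hDexp ⟨hs, hs'⟩ hp
    rw [← this]
    simp only [hD]
    ring

theorem exists_tendsto_im (h : IsLogL χ ℓ) (hχ : χ ≠ 1) {t : ℝ}
    (hL : LFunction χ ⟨1 / 2, t⟩ ≠ 0) :
    ∃ θ : ℝ, Tendsto (fun σ : ℝ => (ℓ ⟨σ, t⟩).im) (𝓝[>] (1 / 2)) (𝓝 θ) := by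
  obtain ⟨r, hr, m, k, hk, hm, -, hℓ⟩ := h.exists_local_log hχ t
  have hm0 := hm hL
  have hkc : ContinuousAt k ⟨1 / 2, t⟩ := hk.continuousAt (Metric.ball_mem_nhds _ hr)
  refine ⟨(k ⟨1 / 2, t⟩).im, ?_⟩
  have h1 : Tendsto (fun σ : ℝ => (⟨σ, t⟩ : ℂ)) (𝓝[>] (1 / 2)) (𝓝 ⟨1 / 2, t⟩) :=
    ((continuous_mk_re t).tendsto _).mono_left nhdsWithin_le_nhds
  refine ((Complex.continuous_im.tendsto _).comp (hkc.tendsto.comp h1)).congr' ?_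
  filter_upwards [h1.eventually (Metric.ball_mem_nhds _ hr), self_mem_nhdsWithin] with σ hσ hσ'
  rw [hℓ _ hσ hσ', hm0]
  simp

/-- Near an ordinate, `arg L` is continuous up to a jump. -/
theorem exists_tendsto_argL (h : IsLogL χ ℓ) (hχ : χ ≠ 1) (t : ℝ) :
    (∀ᶠ u in 𝓝[≠] t, LFunction χ ⟨1 / 2, u⟩ ≠ 0) ∧
      (∃ a, Tendsto (fun u => argL χ u) (𝓝[>] t) (𝓝 a)) ∧
      ∃ b, Tendsto (fun u => argL χ u) (𝓝[<] t) (𝓝 b) := by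
  obtain ⟨r, hr, m, k, hk, -, hne, hℓ⟩ := h.exists_local_log hχ t
  have hvert : Tendsto (fun u : ℝ => (⟨1 / 2, u⟩ : ℂ)) (𝓝 t) (𝓝 ⟨1 / 2, t⟩) :=
    (continuous_mk_im (1 / 2)).tendsto t
  have hball := hvert.eventually (Metric.ball_mem_nhds _ hr)
  have hne' : ∀ u : ℝ, u ≠ t → (⟨1 / 2, u⟩ : ℂ) ≠ ⟨1 / 2, t⟩ := fun u hu he =>
    hu (congrArg Complex.im he)
  have hsub : ∀ u : ℝ, (⟨1 / 2, u⟩ : ℂ) - ⟨1 / 2, t⟩ = ((u - t : ℝ) : ℂ) * Complex.I := by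
    intro u; apply Complex.ext <;> simp
  have hval : ∀ u : ℝ, (⟨1 / 2, u⟩ : ℂ) ∈ Metric.ball (⟨1 / 2, t⟩ : ℂ) r → u ≠ t →
      argL χ u = m * Complex.arg (((u - t : ℝ) : ℂ) * Complex.I) + (k ⟨1 / 2, u⟩).im := by
    intro u hu hut
    refine h.argL_eq hχ (hne _ hu (hne' u hut)) ?_
    have h1 : Tendsto (fun σ : ℝ => (⟨σ, u⟩ : ℂ)) (𝓝[>] (1 / 2)) (𝓝 ⟨1 / 2, u⟩) :=
      ((continuous_mk_re u).tendsto _).mono_left nhdsWithin_le_nhds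
    have hkc : ContinuousAt k ⟨1 / 2, u⟩ := hk.continuousAt (Metric.isOpen_ball.mem_nhds hu)
    have hlog : ContinuousAt (fun s : ℂ => Complex.log (s - ⟨1 / 2, t⟩)) ⟨1 / 2, u⟩ := by
      refine ContinuousAt.clog (by fun_prop) ?_
      right
      rw [hsub]
      simpa [sub_eq_zero] using hut
    have h2 : Tendsto (fun σ : ℝ => (m * Complex.log (⟨σ, u⟩ - ⟨1 / 2, t⟩) + k ⟨σ, u⟩).im)
        (𝓝[>] (1 / 2)) (𝓝 (m * Complex.log (⟨1 / 2, u⟩ - ⟨1 / 2, t⟩) + k ⟨1 / 2, u⟩).im) :=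
      (Complex.continuous_im.tendsto _).comp
        (((hlog.tendsto.comp h1).const_mul _).add (hkc.tendsto.comp h1))
    have e : (m * Complex.log (⟨1 / 2, u⟩ - ⟨1 / 2, t⟩) + k ⟨1 / 2, u⟩).im =
        m * Complex.arg (((u - t : ℝ) : ℂ) * Complex.I) + (k ⟨1 / 2, u⟩).im := by
      rw [hsub, Complex.add_im, Complex.mul_im, Complex.log_im]
      simp
    rw [e] at h2
    refine h2.congr' ?_
    filter_upwards [h1.eventually (Metric.isOpen_ball.mem_nhds hu), self_mem_nhdsWithin]
      with σ hσ hσ'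
    rw [hℓ _ hσ hσ']
  have hkt : Tendsto (fun u : ℝ => (k ⟨1 / 2, u⟩).im) (𝓝 t) (𝓝 (k ⟨1 / 2, t⟩).im) :=
    (Complex.continuous_im.tendsto _).comp
      ((hk.continuousAt (Metric.ball_mem_nhds _ hr)).tendsto.comp hvert)
  -- On the critical line s - ρ = i(u - t) has argument π/2 above ρ and -π/2 below, so the jump is
  -- mπ.
  refine ⟨?_, ⟨m * (Real.pi / 2) + (k ⟨1 / 2, t⟩).im, ?_⟩,
    ⟨m * (-(Real.pi / 2)) + (k ⟨1 / 2, t⟩).im, ?_⟩⟩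
  · filter_upwards [nhdsWithin_le_nhds hball, self_mem_nhdsWithin] with u hu hu'
    exact hne _ hu (hne' u hu')
  · refine ((hkt.mono_left nhdsWithin_le_nhds).const_add (m * (Real.pi / 2))).congr' ?_
    filter_upwards [nhdsWithin_le_nhds hball, self_mem_nhdsWithin] with u hu (hu' : t < u)
    rw [hval u hu hu'.ne', Complex.arg_real_mul _ (sub_pos.2 hu'), Complex.arg_I]
  · refine ((hkt.mono_left nhdsWithin_le_nhds).const_add (m * (-(Real.pi / 2)))).congr' ?_
    filter_upwards [nhdsWithin_le_nhds hball, self_mem_nhdsWithin] with u hu (hu' : u < t)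
    have e : ((u - t : ℝ) : ℂ) * Complex.I = ((t - u : ℝ) : ℂ) * (-Complex.I) := by
      push_cast; ring
    rw [hval u hu hu'.ne, e, Complex.arg_real_mul _ (sub_pos.2 hu'), Complex.arg_neg_I]

end IsLogL

end DirichletCharacter

/-! ### Bounds for S(t, χ) and the final theorem -/

namespace DirichletCharacter

variable {q : ℕ} [NeZero q] {χ : DirichletCharacter ℂ q}

theorem one_lt_log {q : ℕ} (hq : 1 < q) (t : ℝ) : 1 < Real.log (q * (|t| + 3)) := by
  rw [Real.lt_log_iff_exp_lt (by positivity)]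
  have h1 : (2 : ℝ) ≤ q := by exact_mod_cast hq
  nlinarith [Real.exp_one_lt_d9, abs_nonneg t]

/-- A bound for `arg L` in terms of `x = log Q`. -/
noncomputable def argBound (C x : ℝ) : ℝ := 2.45 * (x / Real.log x) + C * (x / Real.log x ^ 2)

theorem continuousAt_argBound {C x : ℝ} (hx : 1 < x) : ContinuousAt (argBound C) x := by
  have h0 : x ≠ 0 := by linarith
  have h1 : Real.log x ≠ 0 := (Real.log_pos hx).ne'
  have h2 : ContinuousAt Real.log x := Real.continuousAt_log h0
  exact ((continuousAt_id.div h2 h1).const_mul _).add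
    ((continuousAt_id.div (h2.pow 2) (pow_ne_zero 2 h1)).const_mul _)

/-- For M = log log Q ≥ M₀ the main bound applies. For 0 < M < M₀ the crude bound O(log Q) fits into
the second term, since 1 ≤ M₀²/M². -/
theorem exists_eventually_abs_im_le : ∃ C : ℝ, 0 ≤ C ∧ ∀ (q : ℕ) [NeZero q], 1 < q →
    ∀ χ : DirichletCharacter ℂ q, χ.IsPrimitive → ∀ ℓ : ℂ → ℂ, IsLogL χ ℓ → ∀ t : ℝ,
      ∀ᶠ σ in 𝓝[>] (1 / 2 : ℝ), |(ℓ ⟨σ, t⟩).im| ≤ argBound C (Real.log (q * (|t| + 3))) := by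
  obtain ⟨C, hC0, hC⟩ := exists_abs_re_logDeriv_archFactor_le
  obtain ⟨M₀, hM₀⟩ := eventually_atTop.1 (eventually_isLargeScale C)
  refine ⟨(30 + 5 * C) * M₀ ^ 2, by positivity, fun q _ hq χ hχ ℓ h t => ?_⟩
  have hA : ArchBound χ C := fun σ t => hC q χ σ t
  set L := Real.log (q * (|t| + 3)) with hL
  have hL1 : 1 < L := one_lt_log hq t
  have hM0 : 0 < Real.log L := Real.log_pos hL1
  have hexp : Real.exp (Real.log L) = L := Real.exp_log (by linarith)
  rcases le_or_gt M₀ (Real.log L) with hM | hM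
  · have hlarge := hM₀ _ hM
    have hmem : Set.Ioc (1 / 2 : ℝ) (1 / 2 + 2 / Real.log L) ∈ 𝓝[>] (1 / 2 : ℝ) :=
      Ioc_mem_nhdsGT (by linarith [show 0 < 2 / Real.log L by positivity])
    filter_upwards [hmem] with σ hσ
    have := h.abs_im_le hχ hq hA hC0 (t := t) (ε := σ - 1 / 2) hlarge (by rw [hexp])
      (by linarith [hσ.1]) (by linarith [hσ.2])
    rw [add_sub_cancel, hexp, one_div_mul_eq_div] at this
    have h2 : 0 ≤ (30 + 5 * C) * M₀ ^ 2 * (L / Real.log L ^ 2) := by positivity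
    rw [argBound]
    linarith
  · have hmem : Set.Ioc (1 / 2 : ℝ) (1 / 2 + 1) ∈ 𝓝[>] (1 / 2 : ℝ) := Ioc_mem_nhdsGT (by norm_num)
    filter_upwards [hmem] with σ hσ
    have := h.abs_im_le_mul_log hχ hq hA hC0 (ε := σ - 1 / 2) (by linarith [hσ.1])
      (by linarith [hσ.2]) t
    rw [add_sub_cancel, ← hL] at this
    have h1 : 0 ≤ 2.45 * (L / Real.log L) := by positivity
    have h2 : (30 + 5 * C) * L ≤ (30 + 5 * C) * M₀ ^ 2 * (L / Real.log L ^ 2) := by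
      rw [mul_assoc]
      gcongr
      rw [mul_div_assoc', le_div_iff₀ (by positivity), mul_comm]
      gcongr
    rw [argBound]
    linarith

theorem isOrdinate_iff (hGRH : GRH) {t : ℝ} :
    IsOrdinate χ t ↔ LFunction χ ⟨1 / 2, t⟩ = 0 := by
  constructor
  · rintro ⟨β, h0, h1, hβ⟩
    have : β = 1 / 2 := hGRH q χ ⟨β, t⟩ h0 h1 hβ
    rwa [this] at hβ
  · exact fun h => ⟨1 / 2, by norm_num, by norm_num, h⟩

variable {ℓ : ℂ → ℂ}

theorem IsLogL.abs_argL_le (h : IsLogL χ ℓ) (hχ : χ ≠ 1) {t B : ℝ}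
    (hL : LFunction χ ⟨1 / 2, t⟩ ≠ 0)
    (hB : ∀ᶠ σ in 𝓝[>] (1 / 2 : ℝ), |(ℓ ⟨σ, t⟩).im| ≤ B) : |argL χ t| ≤ B := by
  obtain ⟨θ, hθ⟩ := h.exists_tendsto_im hχ hL
  rw [h.argL_eq hχ hL hθ]
  exact le_of_tendsto hθ.abs hB

/-- `S(t, χ)` is well defined, and inherits bounds for `arg L` to the right of the critical line. -/
theorem IsLogL.argSWellDefined_and_abs_le (h : IsLogL χ ℓ) (hχ : χ ≠ 1) (hGRH : GRH) {B : ℝ → ℝ}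
    {t : ℝ} (hBc : ContinuousAt B t)
    (hB : ∀ u, ∀ᶠ σ in 𝓝[>] (1 / 2 : ℝ), |(ℓ ⟨σ, u⟩).im| ≤ B u) :
    ArgSWellDefined t χ ∧ |argS t χ| ≤ 1 / Real.pi * B t := by
  have hpi := Real.pi_pos
  by_cases ht : IsOrdinate χ t
  · obtain ⟨hne, ⟨a, ha⟩, b, hb⟩ := h.exists_tendsto_argL hχ t
    have hS : ∀ᶠ u in 𝓝[≠] t, 1 / Real.pi * argL χ u = argS u χ := by
      filter_upwards [hne] with u hu
      rw [argS, if_neg (by rwa [isOrdinate_iff hGRH])]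
    have hle : ∀ᶠ u in 𝓝[≠] t, |argL χ u| ≤ B u := by
      filter_upwards [hne] with u hu using h.abs_argL_le hχ hu (hB u)
    have hgt : 𝓝[>] t ≤ 𝓝[≠] t := nhdsWithin_mono _ fun u hu => ne_of_gt hu
    have hlt : 𝓝[<] t ≤ 𝓝[≠] t := nhdsWithin_mono _ fun u hu => ne_of_lt hu
    have ha' := ha.const_mul (1 / Real.pi)
    have hb' := hb.const_mul (1 / Real.pi)
    have hval : argS t χ = 1 / 2 * (1 / Real.pi * a + 1 / Real.pi * b) := by
      rw [argS, if_pos ht, ha'.limUnder_eq, hb'.limUnder_eq]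
    -- The bound is known only at nearby non-ordinates u, as B(u); continuity of B carries it to the
    -- one-sided limits at t.
    have hBa : |a| ≤ B t := le_of_tendsto_of_tendsto ha.abs
      (hBc.tendsto.mono_left nhdsWithin_le_nhds) (hle.filter_mono hgt)
    have hBb : |b| ≤ B t := le_of_tendsto_of_tendsto hb.abs
      (hBc.tendsto.mono_left nhdsWithin_le_nhds) (hle.filter_mono hlt)
    refine ⟨⟨fun hn => absurd ht hn, fun _ => ⟨_, _, ha'.congr' (hS.filter_mono hgt),
      hb'.congr' (hS.filter_mono hlt), hval⟩⟩, ?_⟩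
    have e : argS t χ = 1 / Real.pi * ((a + b) / 2) := by rw [hval]; ring
    rw [e, abs_mul, abs_of_pos (by positivity)]
    gcongr
    rw [abs_le] at *
    constructor <;> linarith [hBa.1, hBa.2, hBb.1, hBb.2]
  · have hL : LFunction χ ⟨1 / 2, t⟩ ≠ 0 := by rwa [isOrdinate_iff hGRH] at ht
    have hval : argS t χ = 1 / Real.pi * argL χ t := by rw [argS, if_neg ht]
    refine ⟨⟨fun _ => ?_, fun hn => absurd hn ht⟩, ?_⟩
    · obtain ⟨θ, hθ⟩ := h.exists_tendsto_im hχ hL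
      have e : Real.pi * argS t χ = θ := by
        rw [hval, h.argL_eq hχ hL hθ]; field_simp
      rw [e]
      exact h.isArgL_of_tendsto hχ hθ
    · rw [hval, abs_mul, abs_of_pos (by positivity)]
      gcongr
      exact h.abs_argL_le hχ hL (hB t)

end DirichletCharacter

theorem theorem1 (hGRH : GRH) :
    ∃ C : ℝ, 0 < C ∧
      ∀ (q : ℕ) [NeZero q], 1 < q →
        ∀ χ : DirichletCharacter ℂ q, χ.IsPrimitive →
          ∀ t : ℝ, 0 ≤ t →
            ArgSWellDefined t χ ∧
            |argS t χ| <
              0.804 * (Real.log (q * (t + 1)) / Real.log (Real.log (q * (t + 3)))) +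
                C * (Real.log (q * (t + 3)) / (Real.log (Real.log (q * (t + 3)))) ^ 2) := by
  obtain ⟨C, hC0, hC⟩ := DirichletCharacter.exists_eventually_abs_im_le
  -- Replacing log(q(t + 3)) by log(q(t + 1)) loses at most 2, hence 1.608/M in the leading term.
  -- Since 1/M ≤ L/M², the added 2 covers this and leaves the inequality strict.
  refine ⟨C + 2, by linarith, fun q _ hq χ hχ t ht => ?_⟩
  have hχ1 := DirichletCharacter.ne_one_of_isPrimitive hχ hq
  obtain ⟨ℓ, h⟩ := DirichletCharacter.exists_isLogL hχ1
    fun s hs => DirichletCharacter.ne_zero_of_GRH hGRH hχ1 hs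
  have hq0 : (0 : ℝ) < q := by positivity
  have hBc : ContinuousAt
      (fun u : ℝ => DirichletCharacter.argBound C (Real.log (q * (|u| + 3)))) t := by
    refine ContinuousAt.comp' (DirichletCharacter.continuousAt_argBound
      (DirichletCharacter.one_lt_log hq t)) (ContinuousAt.log (by fun_prop) (by positivity))
  obtain ⟨hdef, hle⟩ := h.argSWellDefined_and_abs_le hχ1 hGRH hBc (hC q hq χ hχ ℓ h)
  refine ⟨hdef, hle.trans_lt ?_⟩
  have hL1 := DirichletCharacter.one_lt_log hq t
  rw [abs_of_nonneg ht] at hL1 ⊢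
  have hlog3 : Real.log 3 ≤ 2 := by
    linarith [Real.log_le_sub_one_of_pos (show (0 : ℝ) < 3 by norm_num)]
  have hlog : Real.log (q * (t + 3)) - 2 ≤ Real.log (q * (t + 1)) := by
    have h1 : q * (t + 3) ≤ 3 * (q * (t + 1)) := by nlinarith
    have h2 := Real.log_le_log (by positivity) h1
    rw [Real.log_mul (x := 3) (by norm_num) (by positivity)] at h2
    linarith
  set L := Real.log (q * (t + 3)) with hL
  set M := Real.log L with hM
  have hM0 : 0 < M := Real.log_pos hL1
  have hML : M ≤ L := by
    have := Real.log_le_sub_one_of_pos (show 0 < L by linarith)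
    linarith
  have h1 : (L - 2) / M ≤ Real.log (q * (t + 1)) / M := by gcongr
  have h2 : 1 / M ≤ L / M ^ 2 := by
    rw [div_le_div_iff₀ hM0 (by positivity)]
    nlinarith
  have hX : 0 < L / M := by positivity
  have hY : 0 < L / M ^ 2 := by positivity
  have hpi : 1 / Real.pi ≤ 1 / 3.14 := one_div_le_one_div_of_le (by norm_num) Real.pi_gt_d2.le
  have h3 : 1 / Real.pi * DirichletCharacter.argBound C L ≤
      1 / 3.14 * (2.45 * (L / M) + C * (L / M ^ 2)) := by
    rw [DirichletCharacter.argBound]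
    gcongr
  rw [sub_div] at h1
  have h4 : 2 / M = 2 * (1 / M) := by ring
  rw [h4] at h1
  have h5 : 0 ≤ C * (L / M ^ 2) := by positivity
  nlinarith
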